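/- Setting. Let $L$ be holomorphic on $\mathbb C\setminus\{1\}$, meromorphic at $1$ with a pole of order $q\in\{0,1\}$ there ($q=0$: no pole and no zero), nonvanishing in $\{\mathrm{Re}\,x>1\}$, with $(\log L)^{(n)}(x)=O(x^{-N})$ as $x\to+\infty$ for all $n,N\in\mathbb N$. Assume $\Xi(x)\,\mathbf G(x)=(x-1)^qL(x)$, where $\Xi$ and $\mathbf G$ are entire of order $1$, $\Xi(x)=\Xi(1-x)$, all zeros $x_k$ of $\mathbf G$ (the trivial zeros) satisfy $\mathrm{Re}\,x_k\le0$, and all zeros $\rho$ of $\Xi$ (the nontrivial zeros) satisfy $0<\mathrm{Re}\,\rho<1$ and $\rho\notin\mathbb R$. Zeros are counted with multiplicities. Write the zeros of $\Xi$ as $\rho=\frac12\pm i\tau_k$, $k=1,2,\dots$, with $\mathrm{Re}\,\tau_k>0$ and nondecreasing. Assume finally the Stirling expansion $$-\log\mathbf G(x)\sim\tilde a_1x(\log x-1)+b_1x+\tilde a_0\log x+b_0+\sum_{n\ge1}a_{-n}x^{-n}\qquad(x\to+\infty),$$ indefinitely differentiable term by term, for a continuous branch of $\log\mathbf G$ on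 $(0,\infty)$. Define, with principal powers, $$\mathcal Z(\sigma)=\sum_k(\tau_k^2)^{-\sigma}\ (\mathrm{Re}\,\sigma>\tfrac12),\quad \mathscr Z(s,\tfrac12)=\sum_\rho(\tfrac12-\rho)^{-s},\quad \mathbf Z(s,\tfrac12)=\sum_k(\tfrac12-x_k)^{-s}\ (\mathrm{Re}\,s>1).$$ Statement. These series converge absolutely in the stated half-planes. $\mathscr Z(\cdot,\frac12)$ and $\mathbf Z(\cdot,\frac12)$ extend to meromorphic functions on $\mathbb C$, holomorphic except possibly at $s=1$, with $\mathscr Z(s,\frac12)=-\tilde a_1/(s-1)-b_1+o(1)$ as $s\to1$. $\mathcal Z$ extends to a meromorphic function on $\mathbb C$, holomorphic except possibly at the points $\frac12-m$ $(m=0,1,2,\dots)$, and: 1. $\mathcal Z(\sigma)=(2\cos\pi\sigma)^{-1}\mathscr Z(2\sigma,\frac12)$ for all $\sigma\in\mathbb C$ with $\cos\pi\sigma\ne0$, hence as meromorphic functions on $\mathbb C$. 2. As $\varepsilon\to0$, $\displaystyle\mathcal Z(\tfrac12+\varepsilon)=\frac{\tilde a_1}{4\pi\varepsilon^2}+\frac{b_1}{2\pi\varepsilon}+O(1)$;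 so $\sigma=\frac12$ is a double pole if $\tilde a_1\ne0$. 3. For $m=1,2,\dots$, as $\varepsilon\to0$, $\mathcal Z(\frac12-m+\varepsilon)=\mathcal R_m/\varepsilon+O(1)$ with $$\mathcal R_m=\frac{(-1)^{m+1}}{2\pi}\mathscr Z(1-2m,\tfrac12)=\frac{(-1)^m}{2\pi}\Bigl[\mathbf Z(1-2m,\tfrac12)+q\,2^{1-2m}\Bigr];$$ so $\frac12-m$ is a simple pole with residue $\mathcal R_m$ if $\mathcal R_m\ne0$. 4. $\mathcal Z(m)=\frac12(-1)^m\mathscr Z(2m,\frac12)$ for all $m\in\mathbb Z$, and $\mathcal Z'(0)=\mathscr Z'(0,\frac12)$. -/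

import Mathlib

open Filter Topology Asymptotics
open scoped NNReal ENNReal

noncomputable section

/-- The order of growth of an entire function: the infimum of the exponents `A ≥ 0` such that
`f z = O(exp (|z| ^ A))` as `|z| → ∞` (it is `∞` if there is no such exponent). -/
def entireOrder (f : ℂ → ℂ) : ℝ≥0∞ :=
  ⨅ (A : ℝ≥0) (_ : f =O[Bornology.cobounded ℂ] fun z : ℂ => Real.exp (‖z‖ ^ (A : ℝ))), (A : ℝ≥0∞)

/-- `L` is a primary zeta or `L`-function, with a pole of order `q ∈ {0, 1}` at `1`, with trivial
factor `G` and completed function `Ξ = G⁻¹ (x - 1) ^ q L`. The value of `L` at `1` is immaterial. -/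
structure IsPrimaryFunction (L : ℂ → ℂ) (q : ℕ) (G Ξ : ℂ → ℂ) : Prop where
  q_le_one : q ≤ 1
  differentiableOn : DifferentiableOn ℂ L {1}ᶜ
  meromorphicAt_one : MeromorphicAt L 1
  order_at_one : meromorphicOrderAt L 1 = ((-(q : ℤ) : ℤ) : WithTop ℤ)
  ne_zero : ∀ x : ℂ, 1 < x.re → L x ≠ 0
  /-- `(log L)⁽ⁿ⁾(x) = O(x ^ (-∞))` as `x → +∞`. Since this makes `L x` tend to `1`, the principal
  logarithm is the right branch for large `x`. -/
  log_isBigO : ∀ n N : ℕ,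
    iteratedDeriv n (fun x : ℝ => Complex.log (L (x : ℂ))) =O[atTop]
      fun x : ℝ => x ^ (-(N : ℤ))
  G_entire : Differentiable ℂ G
  G_order : entireOrder G = 1
  /-- The trivial zeros. -/
  G_zeros : ∀ x : ℂ, G x = 0 → x.re ≤ 0
  Xi_entire : Differentiable ℂ Ξ
  Xi_order : entireOrder Ξ = 1
  factorization : ∀ x : ℂ, x ≠ 1 → Ξ x * G x = (x - 1) ^ q * L x
  functional_equation : ∀ x : ℂ, Ξ x = Ξ (1 - x)
  /-- The nontrivial zeros lie in the open critical strip, and none of them is real. -/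
  Xi_zeros : ∀ x : ℂ, Ξ x = 0 → 0 < x.re ∧ x.re < 1 ∧ x.im ≠ 0

/-- The Stirling expansion, as `x → +∞`,
`-log G(x) ∼ a₁ x (log x - 1) + b₁ x + a₀ log x + b₀ + ∑_{n ≥ 1} a n * x ^ (-n)`,
for a continuous branch of `log G` on `(0, ∞)`, indefinitely differentiable term by term. -/
def HasStirlingExpansion (G : ℂ → ℂ) (a₁ b₁ a₀ b₀ : ℂ) (a : ℕ → ℂ) : Prop :=
  ∃ logG : ℝ → ℂ, ContinuousOn logG (Set.Ioi 0) ∧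
    (∀ x : ℝ, 0 < x → Complex.exp (logG x) = G (x : ℂ)) ∧
    ∀ N j : ℕ,
      iteratedDeriv j (fun x : ℝ => -logG x -
          (a₁ * x * ((Real.log x : ℂ) - 1) + b₁ * x + a₀ * (Real.log x : ℂ) + b₀ +
            ∑ n ∈ Finset.Icc 1 N, a n * (x : ℂ) ^ (-(n : ℤ)))) =O[atTop]
        fun x : ℝ => x ^ (-((N : ℤ) + 1 + j))

/-- `τ` lists, with multiplicities, the numbers with positive nondecreasing real parts such that the
zeros of `Ξ` are the `1/2 ± i τ k` (those with the minus sign being given by the functional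
equation). -/
structure EnumeratesZeros (Ξ : ℂ → ℂ) (τ : ℕ → ℂ) : Prop where
  re_pos : ∀ k, 0 < (τ k).re
  monotone : Monotone fun k => (τ k).re
  multiplicity : ∀ z : ℂ, 0 < z.re →
    Set.encard {k | τ k = z} = analyticOrderAt Ξ (1 / 2 + Complex.I * z)

/-- The term at the zero `ρ` of `f` of the series `∑_ρ (x - ρ) ^ (-s)` over the zeros of `f`,
counted with multiplicities (principal branch). -/
def zeroZetaTerm (f : ℂ → ℂ) (x : ℂ) (ρ : {ρ : ℂ // f ρ = 0}) (s : ℂ) : ℂ :=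
  (analyticOrderNatAt f ρ : ℂ) * (x - ρ) ^ (-s)

/-- The terms of the series `∑_k (τ_k ^ 2 + v) ^ (-σ)`. -/
def secondZetaTerm (τ : ℕ → ℂ) (v : ℂ) (k : ℕ) (σ : ℂ) : ℂ :=
  (τ k ^ 2 + v) ^ (-σ)

/-- `F` is the meromorphic continuation to `ℂ` of the sum of the series `∑ i, term i s`, which
converges (absolutely) for `c < Re s`, and `F` is holomorphic outside `P`. When `P` is closed and
discrete, `F` is thereby determined uniquely outside `P`. -/
structure IsMeromorphicContinuation {ι : Type*} (term : ι → ℂ → ℂ) (c : ℝ) (P : Set ℂ)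
    (F : ℂ → ℂ) : Prop where
  hasSum : ∀ s : ℂ, c < s.re → HasSum (fun i => term i s) (F s)
  meromorphicOn : MeromorphicOn F Set.univ
  analyticAt : ∀ s : ℂ, s ∉ P → AnalyticAt ℂ F s

end

noncomputable section

/-! ### Zeros of entire functions of order 1 and the second derivative of their logarithm -/

section EntireFunctions

/-! Let f be entire of order 1, with no zero on c + [0, ∞), and put F(y) = -(log f)''(c + y). Two
derivatives kill the exponential factors of the Hadamard product, so F(y) = ∑ (y + c - ρ)^(-2) over
the zeros (`hasSum_inv_sq_eq_neg_deriv_logDeriv`). This is obtained without the product: divide out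
the zeros in a large disc and bound the second logarithmic derivative of the quotient by
Borel–Carathéodory and Cauchy.

Since ∫_0^∞ y^(1-s) (y + u)^(-2) dy = u^(-s) π(1-s)/sin πs, termwise integration gives, for 1 < Re s
< 2, ∑ (c - ρ)^(-s) = sin πs / (π(1-s)) · ∫_0^∞ y^(1-s) F(y) dy
(`IsZetaAdmissible.tsum_eq_integral`). An expansion F ∼ ∑ d_n y^(-n) at infinity continues the
integral: d_n y^(-n) contributes a pole at s = 2 - n, which the sine cancels. Only s = 1 can remain
singular, because of the factor 1 - s (`exists_isExpansionContinuation`).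

For `G` the expansion is Stirling's, differentiated twice. For `Ξ` it follows from the
factorization: the two functions F add up to q/(y - 1/2)^2 up to O(y^(-∞)). The value at 1 - 2m is
-d_{2m+1}/(2m), so in the sum of the two zeta values the Stirling coefficients cancel and only the
q-term survives. The finite part at 1 is the limit of ∫_0^Y F - d_1 log Y; it is computed from (log
Ξ)'(1/2) = 0, a consequence of the functional equation, and from the once differentiated Stirling
expansion.

Finally, the zeros come in pairs 1/2 ± iτ, and (∓iτ)^(-s) = exp(±iπs/2) τ^(-s) when Re τ > 0. Hence
the series over all zeros is 2 cos(πs/2) ∑ τ^(-s), which at s = 2σ is the basic relation.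
Continuation, polar parts and special values of the second zeta function all follow from it, by
expanding 1/cos πσ. -/

theorem exists_growth_bound {f : ℂ → ℂ} (hf : Differentiable ℂ f) (h1 : entireOrder f = 1)
    (c : ℂ) (hc : ‖c‖ ≤ 1) {A : ℝ} (hA : 1 < A) :
    ∃ C : ℝ, 0 < C ∧ ∀ z, ‖f z‖ ≤ C * Real.exp ((‖z - c‖ + 1) ^ A) := by
  -- The infimum may not be attained; A > 1 leaves room for an admissible exponent below A, and a
  -- compact set absorbs the small arguments.
  have hlt : entireOrder f < ENNReal.ofReal A := by
    rw [h1]; simpa using hA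
  unfold entireOrder at hlt
  simp only [iInf_lt_iff] at hlt
  obtain ⟨B, hB, hBA⟩ := hlt
  have hBA' : (B : ℝ) < A := by
    have := (ENNReal.lt_ofReal_iff_toReal_lt (by simp)).1 hBA
    simpa using this
  obtain ⟨C, hC⟩ := hB.bound
  rw [Filter.Eventually, Metric.cobounded_eq_cocompact, Filter.mem_cocompact] at hC
  obtain ⟨K, hK, hKC⟩ := hC
  obtain ⟨D, hD⟩ := hK.exists_bound_of_continuousOn hf.continuous.continuousOn
  refine ⟨|C| + |D| + 1, by positivity, fun z => ?_⟩
  have hone : (1 : ℝ) ≤ ‖z - c‖ + 1 := by linarith [norm_nonneg (z - c)]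
  have hz : ‖z‖ ≤ ‖z - c‖ + 1 := by
    calc ‖z‖ = ‖(z - c) + c‖ := by ring_nf
      _ ≤ _ := (norm_add_le _ _).trans (by linarith)
  have hE : (1 : ℝ) ≤ Real.exp ((‖z - c‖ + 1) ^ A) := Real.one_le_exp (by positivity)
  by_cases hzK : z ∈ K
  · calc ‖f z‖ ≤ D := hD z hzK
      _ ≤ (|C| + |D| + 1) * 1 := by linarith [le_abs_self D, abs_nonneg C]
      _ ≤ _ := by gcongr
  · have := hKC hzK
    simp only [Set.mem_ofPred_eq, Real.norm_eq_abs, Real.abs_exp] at this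
    have h2 : ‖z‖ ^ (B : ℝ) ≤ (‖z - c‖ + 1) ^ A :=
      (Real.rpow_le_rpow (norm_nonneg _) hz B.2).trans
        (Real.rpow_le_rpow_of_exponent_le hone hBA'.le)
    calc ‖f z‖ ≤ C * Real.exp (‖z‖ ^ (B : ℝ)) := this
      _ ≤ (|C| + |D| + 1) * Real.exp ((‖z - c‖ + 1) ^ A) := by
        gcongr
        linarith [le_abs_self C, abs_nonneg D]

theorem analyticOrderAt_ne_top_of_entire {f : ℂ → ℂ} (hf : Differentiable ℂ f) {c : ℂ}
    (hc : f c ≠ 0) (z : ℂ) : analyticOrderAt f z ≠ ⊤ := by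
  rw [Ne, AnalyticOnNhd.analyticOrderAt_eq_top_iff_eq_zero z (fun w => hf.analyticAt w)]
  rintro rfl
  exact hc rfl

theorem finite_zeros_inter_closedBall {f : ℂ → ℂ} (hf : Differentiable ℂ f) {c : ℂ}
    (hc : f c ≠ 0) (x : ℂ) (R : ℝ) : ({z | f z = 0} ∩ Metric.closedBall x R).Finite := by
  have h : f ⁻¹' {0}ᶜ ∈ codiscrete ℂ :=
    AnalyticOnNhd.preimage_zero_mem_codiscrete (fun w _ => hf.analyticAt w) hc
  have h' := (compl_mem_codiscrete_iff (S := {z | f z = 0})).1 (by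
    have he : {z | f z = 0}ᶜ = f ⁻¹' {0}ᶜ := by ext z; simp
    rwa [he])
  refine IsCompact.finite ?_ (h'.2.mono Set.inter_subset_left)
  exact (isCompact_closedBall x R).inter_left h'.1

theorem exists_entire_quotient {f : ℂ → ℂ} (hf : Differentiable ℂ f) {c : ℂ}
    (hc : f c ≠ 0) (ρ : ℂ) : ∃ g : ℂ → ℂ, Differentiable ℂ g ∧
      (∀ z, f z = (z - ρ) ^ analyticOrderNatAt f ρ * g z) ∧ g ρ ≠ 0 := by
  obtain ⟨h, hh, h0, he⟩ := (hf.analyticAt ρ).analyticOrderAt_ne_top.1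
    (analyticOrderAt_ne_top_of_entire hf hc ρ)
  classical
  set n := analyticOrderNatAt f ρ
  have key : ∀ z, f z = (z - ρ) ^ n * (if z = ρ then h ρ else f z / (z - ρ) ^ n) := by
    intro z
    split_ifs with hz
    · subst hz
      simpa using he.self_of_nhds
    · have : (z - ρ) ^ n ≠ 0 := pow_ne_zero _ (sub_ne_zero.2 hz)
      field_simp
  refine ⟨fun z => if z = ρ then h ρ else f z / (z - ρ) ^ n, fun z => ?_, key, by simpa using h0⟩
  by_cases hz : z = ρ
  · subst hz
    refine hh.differentiableAt.congr_of_eventuallyEq ?_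
    filter_upwards [he] with w hw
    split_ifs with hwz
    · rw [hwz]
    · have : (w - z) ^ n ≠ 0 := pow_ne_zero _ (sub_ne_zero.2 hwz)
      rw [hw, smul_eq_mul]
      field_simp
  · have : DifferentiableAt ℂ (fun z => f z / (z - ρ) ^ n) z :=
      (hf z).div (by fun_prop) (pow_ne_zero _ (sub_ne_zero.2 hz))
    refine this.congr_of_eventuallyEq ?_
    filter_upwards [isOpen_ne.mem_nhds hz] with w hw
    rw [if_neg hw]

theorem exists_entire_quotient_finset {f : ℂ → ℂ} (hf : Differentiable ℂ f) {c : ℂ}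
    (hc : f c ≠ 0) (S : Finset ℂ) : ∃ g : ℂ → ℂ, Differentiable ℂ g ∧
      (∀ z, f z = (∏ ρ ∈ S, (z - ρ) ^ analyticOrderNatAt f ρ) * g z) ∧ ∀ ρ ∈ S, g ρ ≠ 0 := by
  classical
  induction S using Finset.induction_on with
  | empty => exact ⟨f, hf, by simp, by simp⟩
  | insert a S ha ih =>
    obtain ⟨g, hg, hfg, hgS⟩ := ih
    have hgc : g c ≠ 0 := fun h => hc (by rw [hfg, h, mul_zero])
    obtain ⟨k, hk, hgk, hka⟩ := exists_entire_quotient hg hgc a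
    -- The factor already removed does not vanish at a, so the multiplicity there is unchanged.
    have hord : analyticOrderNatAt f a = analyticOrderNatAt g a := by
      have hfe : f = (fun z => ∏ ρ ∈ S, (z - ρ) ^ analyticOrderNatAt f ρ) * g := funext hfg
      have hP : Differentiable ℂ (fun z => ∏ ρ ∈ S, (z - ρ) ^ analyticOrderNatAt f ρ) := by
        fun_prop
      have hP0 : (∏ ρ ∈ S, (a - ρ) ^ analyticOrderNatAt f ρ) ≠ 0 :=
        Finset.prod_ne_zero_iff.2 fun ρ hρ => pow_ne_zero _
          (sub_ne_zero.2 fun h => ha (h ▸ hρ))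
      have : analyticOrderAt f a = analyticOrderAt g a := by
        conv_lhs => rw [hfe]
        rw [analyticOrderAt_mul (hP.analyticAt a) (hg.analyticAt a),
          (hP.analyticAt a).analyticOrderAt_eq_zero.2 hP0, zero_add]
      simp [analyticOrderNatAt, this]
    refine ⟨k, hk, fun z => ?_, fun ρ hρ => ?_⟩
    · rw [Finset.prod_insert ha, hord]
      conv_lhs => rw [hfg z, hgk z]
      ring
    · rcases Finset.mem_insert.1 hρ with rfl | hρ
      · exact hka
      · intro h
        exact hgS ρ hρ (by rw [hgk, h, mul_zero])

/-- Jensen-type bound. On the circle of radius 3R each factor (z - ρ)/(c - ρ) has modulus at least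
2R/R = 2, so dividing by the product gains 2^n there, and the maximum principle carries this gain
inside. Normalizing the factors to be 1 at c keeps g c = f c. -/
theorem exists_quotient_norm_le {f : ℂ → ℂ} (hf : Differentiable ℂ f) {c : ℂ}
    (hc : f c ≠ 0) (S : Finset ℂ) {R M : ℝ} (hR : 0 < R) (hS : ∀ ρ ∈ S, ‖ρ - c‖ ≤ R)
    (hcS : c ∉ S) (hM : ∀ z, ‖z - c‖ ≤ 3 * R → ‖f z‖ ≤ M) :
    ∃ g : ℂ → ℂ, Differentiable ℂ g ∧
      (∀ z, f z = (∏ ρ ∈ S, ((z - ρ) / (c - ρ)) ^ analyticOrderNatAt f ρ) * g z) ∧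
      (∀ ρ ∈ S, g ρ ≠ 0) ∧
      ∀ z, ‖z - c‖ ≤ 3 * R → ‖g z‖ * 2 ^ (∑ ρ ∈ S, analyticOrderNatAt f ρ) ≤ M := by
  obtain ⟨g, hg, hfg, hgS⟩ := exists_entire_quotient_finset hf hc S
  set K := ∏ ρ ∈ S, (c - ρ) ^ analyticOrderNatAt f ρ with hKdef
  have hcρ : ∀ ρ ∈ S, c - ρ ≠ 0 := fun ρ hρ => sub_ne_zero.2 fun h => hcS (h ▸ hρ)
  have hK : K ≠ 0 := Finset.prod_ne_zero_iff.2 fun ρ hρ => pow_ne_zero _ (hcρ ρ hρ)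
  have hfac : ∀ z, f z = (∏ ρ ∈ S, ((z - ρ) / (c - ρ)) ^ analyticOrderNatAt f ρ) * (K * g z) := by
    intro z
    simp only [div_pow, Finset.prod_div_distrib]
    rw [← hKdef, hfg z]
    field_simp
  refine ⟨fun z => K * g z, hg.const_mul K, hfac,
    fun ρ hρ => mul_ne_zero hK (hgS ρ hρ), ?_⟩
  set n := ∑ ρ ∈ S, analyticOrderNatAt f ρ with hn
  have hbd : ∀ z ∈ Metric.sphere c (3 * R), ‖K * g z‖ ≤ M / 2 ^ n := by
    intro z hz
    rw [mem_sphere_iff_norm] at hz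
    rw [le_div_iff₀ (by positivity)]
    refine le_trans ?_ (hM z hz.le)
    rw [hfac z, norm_mul _ (K * g z), mul_comm]
    refine mul_le_mul_of_nonneg_right ?_ (norm_nonneg _)
    rw [norm_prod, hn, ← Finset.prod_pow_eq_pow_sum]
    refine Finset.prod_le_prod (fun _ _ => by positivity) fun ρ hρ => ?_
    rw [norm_pow]
    refine pow_le_pow_left₀ (by norm_num) ?_ _
    rw [norm_div, le_div_iff₀ (norm_pos_iff.2 (hcρ ρ hρ))]
    have h1 := hS ρ hρ
    rw [norm_sub_rev] at h1
    have h2 : ‖z - c‖ ≤ ‖z - ρ‖ + ‖c - ρ‖ := by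
      calc ‖z - c‖ = ‖(z - ρ) - (c - ρ)‖ := by ring_nf
        _ ≤ _ := norm_sub_le _ _
    linarith
  intro z hz
  rw [← le_div_iff₀ (by positivity)]
  have hR3 : (3 * R) ≠ 0 := by positivity
  refine Complex.norm_le_of_forall_mem_frontier_norm_le (U := Metric.ball c (3 * R))
    Metric.isBounded_ball (hg.const_mul K).diffContOnCl ?_ ?_
  · rw [frontier_ball c hR3]
    exact hbd
  · rw [closure_ball c hR3, mem_closedBall_iff_norm]
    exact hz

/-- Evaluate the previous bound at the centre: 2^n ‖f c‖ ≤ C exp((3R + 1)^A), and take logarithms.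
-/
theorem exists_sum_order_le {f : ℂ → ℂ} (hf : Differentiable ℂ f) {c : ℂ} (hc : f c ≠ 0)
    {A C : ℝ} (hA : 0 < A) (hC : 0 < C)
    (hgrow : ∀ z, ‖f z‖ ≤ C * Real.exp ((‖z - c‖ + 1) ^ A)) :
    ∃ B : ℝ, 0 < B ∧ ∀ R : ℝ, 1 ≤ R → ∀ S : Finset ℂ, (∀ ρ ∈ S, f ρ = 0 ∧ ‖ρ - c‖ ≤ R) →
      ((∑ ρ ∈ S, analyticOrderNatAt f ρ : ℕ) : ℝ) ≤ B * R ^ A := by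
  have hl2 : 0 < Real.log 2 := Real.log_pos (by norm_num)
  refine ⟨(|Real.log (C / ‖f c‖)| + 4 ^ A) / Real.log 2, by positivity, fun R hR S hS => ?_⟩
  have hR0 : 0 < R := by linarith
  have hcS : c ∉ S := fun h => hc (hS c h).1
  obtain ⟨g, -, hfg, -, hg⟩ := exists_quotient_norm_le hf hc S hR0 (fun ρ hρ => (hS ρ hρ).2) hcS
    (M := C * Real.exp ((3 * R + 1) ^ A)) (fun z hz => (hgrow z).trans (by gcongr))
  have hgc : g c = f c := by
    rw [hfg c, Finset.prod_eq_one, one_mul]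
    intro ρ hρ
    have hne : c - ρ ≠ 0 := sub_ne_zero.2 fun h => hcS (h ▸ hρ)
    rw [div_self hne, one_pow]
  have h1 := hg c (by simp; positivity)
  rw [hgc] at h1
  set n := ∑ ρ ∈ S, analyticOrderNatAt f ρ
  have hfc : 0 < ‖f c‖ := norm_pos_iff.2 hc
  have h2 : (2 : ℝ) ^ n ≤ C / ‖f c‖ * Real.exp ((3 * R + 1) ^ A) := by
    rw [div_mul_eq_mul_div, le_div_iff₀ hfc, mul_comm]
    exact h1
  have h3 := Real.log_le_log (by positivity) h2
  rw [Real.log_pow, Real.log_mul (by positivity) (by positivity), Real.log_exp] at h3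
  have h4 : (3 * R + 1) ^ A ≤ 4 ^ A * R ^ A := by
    rw [← Real.mul_rpow (by norm_num) hR0.le]
    exact Real.rpow_le_rpow (by positivity) (by linarith) hA.le
  have h5 : 1 ≤ R ^ A := Real.one_le_rpow hR hA.le
  rw [div_mul_eq_mul_div, le_div_iff₀ hl2, add_mul]
  have h6 : |Real.log (C / ‖f c‖)| * 1 ≤ |Real.log (C / ‖f c‖)| * R ^ A := by gcongr
  linarith [le_abs_self (Real.log (C / ‖f c‖))]

/-- Dyadic shells: the k-th has O(2^(kA)) zeros, each contributing at most 2^(-ks), and the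
geometric series of ratio 2^(A-s) converges. -/
theorem summable_order_mul_rpow {f : ℂ → ℂ} (hf : Differentiable ℂ f) {c : ℂ} (hc : f c ≠ 0)
    {A C : ℝ} (hA : 0 < A) (hC : 0 < C)
    (hgrow : ∀ z, ‖f z‖ ≤ C * Real.exp ((‖z - c‖ + 1) ^ A)) {s : ℝ} (hs : A < s) :
    Summable fun ρ : {ρ : ℂ // f ρ = 0} =>
      (analyticOrderNatAt f ρ : ℝ) * (1 + ‖c - ρ‖) ^ (-s) := by
  classical
  obtain ⟨B, hB, hcount⟩ := exists_sum_order_le hf hc hA hC hgrow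
  have hnear : ∀ ρ : {ρ : ℂ // f ρ = 0}, ∃ j : ℕ, (2 : ℝ) ^ j ≤ 1 + ‖c - ρ‖ ∧
      1 + ‖c - ρ‖ < 2 ^ (j + 1) := fun ρ =>
    exists_nat_pow_near (by linarith [norm_nonneg (c - ρ)]) (by norm_num)
  choose j hj1 hj2 using hnear
  have hr : (2 : ℝ) ^ (A - s) < 1 := Real.rpow_lt_one_of_one_lt_of_neg (by norm_num) (by linarith)
  have hgeo : Summable fun k : ℕ => B * 2 ^ A * ((2 : ℝ) ^ (A - s)) ^ k :=
    (summable_geometric_of_lt_one (by positivity) hr).mul_left _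
  refine summable_of_sum_le (c := ∑' k : ℕ, B * 2 ^ A * ((2 : ℝ) ^ (A - s)) ^ k)
    (fun ρ => by positivity) fun u => ?_
  rw [← Finset.sum_fiberwise_of_maps_to (g := j) (t := u.image j)
    (fun x hx => Finset.mem_image_of_mem j hx)]
  refine le_trans (Finset.sum_le_sum fun k _ => ?_)
    (hgeo.sum_le_tsum (u.image j) (fun _ _ => by positivity))
  have h1 : ∀ ρ ∈ u.filter (fun ρ => j ρ = k),
      (analyticOrderNatAt f ρ : ℝ) * (1 + ‖c - ρ‖) ^ (-s) ≤
        (analyticOrderNatAt f ρ : ℝ) * ((2 : ℝ) ^ k) ^ (-s) := by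
    intro ρ hρ
    have hk := (Finset.mem_filter.1 hρ).2
    have := hj1 ρ
    rw [hk] at this
    exact mul_le_mul_of_nonneg_left (Real.rpow_le_rpow_of_nonpos (by positivity) this
      (by linarith)) (by positivity)
  refine (Finset.sum_le_sum h1).trans ?_
  rw [← Finset.sum_mul]
  have h2 := hcount (2 ^ (k + 1)) (one_le_pow₀ (by norm_num))
    ((u.filter (fun ρ => j ρ = k)).image Subtype.val) (by
      intro ρ hρ
      obtain ⟨ρ', hρ', rfl⟩ := Finset.mem_image.1 hρ
      refine ⟨ρ'.2, ?_⟩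
      have := hj2 ρ'
      rw [(Finset.mem_filter.1 hρ').2] at this
      rw [norm_sub_rev]
      linarith)
  rw [Finset.sum_image (fun a _ b _ h => Subtype.ext h)] at h2
  push_cast at h2
  refine (mul_le_mul_of_nonneg_right h2 (by positivity)).trans (le_of_eq ?_)
  rw [← Real.rpow_natCast, ← Real.rpow_natCast, ← Real.rpow_natCast, ← Real.rpow_mul (by norm_num),
    ← Real.rpow_mul (by norm_num), ← Real.rpow_mul (by norm_num), mul_assoc, mul_assoc,
    ← Real.rpow_add (by norm_num), ← Real.rpow_add (by norm_num)]
  congr 2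
  push_cast
  ring

/-- On the disc g = g(c) exp h with h(c) = 0 and Re h ≤ K. Borel–Carathéodory turns this one-sided
bound into a bound on |h|, and Cauchy's estimate then bounds h''. -/
theorem norm_deriv_logDeriv_le {g : ℂ → ℂ} (hg : Differentiable ℂ g) {c : ℂ} {R K : ℝ}
    (hR : 0 < R) (hg0 : ∀ z ∈ Metric.ball c R, g z ≠ 0) (hK : 0 < K)
    (hbd : ∀ z ∈ Metric.ball c R, ‖g z‖ ≤ ‖g c‖ * Real.exp K) {z : ℂ} (hz : ‖z - c‖ < R / 4) :
    ‖deriv (logDeriv g) z‖ ≤ 64 * K / R ^ 2 := by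
  have hcR : c ∈ Metric.ball c R := Metric.mem_ball_self hR
  have hld : DifferentiableOn ℂ (logDeriv g) (Metric.ball c R) := by
    intro w hw
    exact ((hg.analyticAt w).deriv.differentiableAt.div (hg w) (hg0 w hw)).differentiableWithinAt
  obtain ⟨h, hh0, hh⟩ := hld.isExactOn_ball.with_val_at c 0
  have hconst : ∀ w ∈ Metric.ball c R, g w * Complex.exp (-h w) = g c := by
    intro w hw
    have hd : ∀ x ∈ Metric.ball c R, HasDerivAt (fun x => g x * Complex.exp (-h x)) 0 x := by
      intro x hx
      have h1 := (hg x).hasDerivAt.mul (hh x hx).neg.cexp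
      refine h1.congr_deriv ?_
      rw [logDeriv_apply]
      have := hg0 x hx
      field_simp
      ring
    have := (convex_ball c R).is_const_of_fderivWithin_eq_zero (𝕜 := ℂ)
      (f := fun x => g x * Complex.exp (-h x))
      (fun x hx => (hd x hx).differentiableAt.differentiableWithinAt)
      (fun x hx => by
        rw [fderivWithin_of_isOpen Metric.isOpen_ball hx]
        ext
        simpa using (hd x hx).deriv) hw hcR
    simpa [hh0] using this
  have hre : ∀ w ∈ Metric.ball c R, (h w).re ≤ K := by
    intro w hw
    have h1 : g w = g c * Complex.exp (h w) := by
      rw [← hconst w hw, mul_assoc, ← Complex.exp_add]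
      simp
    have h2 := hbd w hw
    rw [h1, norm_mul, Complex.norm_exp] at h2
    exact Real.exp_le_exp.1 (le_of_mul_le_mul_left h2 (norm_pos_iff.2 (hg0 c hcR)))
  have hmem : ∀ w : ℂ, w ∈ Metric.ball (0 : ℂ) R → c + w ∈ Metric.ball c R := by
    intro w hw
    simpa using hw
  have hbc : ∀ w : ℂ, ‖w - c‖ ≤ R / 2 → ‖h w‖ ≤ 2 * K := by
    intro w hw
    have := Complex.borelCaratheodory_zero (f := fun w => h (c + w)) (M := K) (R := R) (z := w - c)
      hK (fun x hx => by
        have := (hh _ (hmem x hx)).differentiableAt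
        exact (DifferentiableAt.comp x this (by fun_prop)).differentiableWithinAt)
      (fun x hx => hre _ (hmem x hx)) hR (by rw [mem_ball_zero_iff]; linarith) (by simpa using hh0)
    simp only [add_sub_cancel] at this
    refine this.trans ?_
    rw [div_le_iff₀ (by linarith)]
    nlinarith
  have hzR : z ∈ Metric.ball c R := by rw [mem_ball_iff_norm]; linarith
  have hder : deriv (logDeriv g) z = iteratedDeriv 2 h z := by
    rw [iteratedDeriv_succ, iteratedDeriv_one]
    refine Filter.EventuallyEq.deriv_eq ?_
    filter_upwards [Metric.isOpen_ball.mem_nhds hzR] with w hw using (hh w hw).deriv.symm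
  rw [hder]
  have hsub : ∀ w : ℂ, w ∈ Metric.closedBall z (R / 4) → ‖w - c‖ ≤ R / 2 := by
    intro w hw
    rw [mem_closedBall_iff_norm] at hw
    calc ‖w - c‖ = ‖(w - z) + (z - c)‖ := by ring_nf
      _ ≤ _ := (norm_add_le _ _).trans (by linarith)
  have hdiff : DiffContOnCl ℂ h (Metric.ball z (R / 4)) := by
    refine DifferentiableOn.diffContOnCl (s := Metric.ball z (R / 4)) ?_
    rw [closure_ball z (by positivity)]
    intro w hw
    have hwR : w ∈ Metric.ball c R := by
      rw [mem_ball_iff_norm]; linarith [hsub w hw]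
    exact (hh w hwR).differentiableAt.differentiableWithinAt
  -- On the half-radius disc |h| ≤ 2K, and circles of radius R/4 about z stay in it: 2! · 2K/(R/4)²
  -- = 64K/R².
  have := Complex.norm_iteratedDeriv_le_of_forall_mem_sphere_norm_le 2 (by positivity) hdiff
    (fun w hw => hbc w (hsub w (Metric.sphere_subset_closedBall hw)))
  refine this.trans (le_of_eq ?_)
  simp [Nat.factorial]
  field_simp
  ring

/-- The left side is (log g)'' for the quotient g of f by its zeros in the disc, to which the
preceding estimate applies. -/
theorem norm_deriv_logDeriv_add_sum_le {f : ℂ → ℂ} (hf : Differentiable ℂ f) {c : ℂ}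
    (hc : f c ≠ 0) (S : Finset ℂ) {R M : ℝ} (hR : 0 < R)
    (hS : ∀ ρ, ρ ∈ S ↔ f ρ = 0 ∧ ‖ρ - c‖ ≤ R)
    (hM : ∀ z, ‖z - c‖ ≤ 3 * R → ‖f z‖ ≤ M) {K : ℝ} (hK : 0 < K) (hMK : M ≤ ‖f c‖ * Real.exp K)
    {z : ℂ} (hz : ‖z - c‖ < R / 4) (hfz : f z ≠ 0) :
    ‖deriv (logDeriv f) z + ∑ ρ ∈ S, (analyticOrderNatAt f ρ : ℂ) * ((z - ρ) ^ 2)⁻¹‖ ≤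
      64 * K / R ^ 2 := by
  have hcS : c ∉ S := fun h => hc ((hS c).1 h).1
  obtain ⟨g, hg, hfg, hgS, hgM⟩ := exists_quotient_norm_le hf hc S hR
    (fun ρ hρ => ((hS ρ).1 hρ).2) hcS hM
  have hcρ : ∀ ρ ∈ S, c - ρ ≠ 0 := fun ρ hρ => sub_ne_zero.2 fun h => hcS (h ▸ hρ)
  have hgc : g c = f c := by
    rw [hfg c, Finset.prod_eq_one, one_mul]
    intro ρ hρ
    rw [div_self (hcρ ρ hρ), one_pow]
  have hg0 : ∀ w, ‖w - c‖ ≤ R → g w ≠ 0 := by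
    intro w hw h
    exact hgS w ((hS w).2 ⟨by rw [hfg, h, mul_zero], hw⟩) h
  have key := norm_deriv_logDeriv_le hg hR
    (fun w hw => hg0 w (by rw [mem_ball_iff_norm] at hw; exact hw.le)) hK
    (fun w hw => by
      rw [mem_ball_iff_norm] at hw
      rw [hgc]
      refine le_trans ?_ ((hgM w (by linarith)).trans hMK)
      exact le_mul_of_one_le_right (norm_nonneg _) (one_le_pow₀ (by norm_num))) hz
  have hld : ∀ w, f w ≠ 0 → logDeriv f w =
      ∑ ρ ∈ S, (analyticOrderNatAt f ρ : ℂ) * (w - ρ)⁻¹ + logDeriv g w := by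
    intro w hw
    have hwS : ∀ ρ ∈ S, w - ρ ≠ 0 := fun ρ hρ => sub_ne_zero.2 fun h =>
      hw (h ▸ ((hS ρ).1 hρ).1)
    have hgw : g w ≠ 0 := fun h => hw (by rw [hfg, h, mul_zero])
    have hfe : f = fun w => (∏ ρ ∈ S, ((w - ρ) / (c - ρ)) ^ analyticOrderNatAt f ρ) * g w :=
      funext hfg
    have hne : ∀ ρ ∈ S, ((w - ρ) / (c - ρ)) ^ analyticOrderNatAt f ρ ≠ 0 := fun ρ hρ =>
      pow_ne_zero _ (div_ne_zero (hwS ρ hρ) (hcρ ρ hρ))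
    conv_lhs => rw [hfe]
    rw [logDeriv_mul w (Finset.prod_ne_zero_iff.2 hne) hgw (by fun_prop) (hg w),
      logDeriv_prod hne (fun ρ _ => by fun_prop)]
    congr 1
    refine Finset.sum_congr rfl fun ρ hρ => ?_
    rw [logDeriv_fun_pow (by fun_prop), logDeriv_apply]
    congr 1
    have h1 : HasDerivAt (fun w : ℂ => (w - ρ) / (c - ρ)) (1 / (c - ρ)) w :=
      ((hasDerivAt_id w).sub_const ρ).div_const _
    rw [h1.deriv]
    have := hcρ ρ hρ
    have := hwS ρ hρ
    field_simp
  have hzS : ∀ ρ ∈ S, z - ρ ≠ 0 := fun ρ hρ => sub_ne_zero.2 fun h =>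
      hfz (h ▸ ((hS ρ).1 hρ).1)
  have hdz : HasDerivAt (fun w => ∑ ρ ∈ S, (analyticOrderNatAt f ρ : ℂ) * (w - ρ)⁻¹ + logDeriv g w)
      (∑ ρ ∈ S, (analyticOrderNatAt f ρ : ℂ) * (-1 / (z - ρ) ^ 2) + deriv (logDeriv g) z) z := by
    refine HasDerivAt.add (HasDerivAt.fun_sum fun ρ hρ => ?_) ?_
    · exact (((hasDerivAt_id z).sub_const ρ).inv (hzS ρ hρ)).const_mul _
    · exact ((hg.analyticAt z).deriv.differentiableAt.div (hg z)
        (hg0 z (by linarith))).hasDerivAt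
  have hd : deriv (logDeriv f) z =
      ∑ ρ ∈ S, (analyticOrderNatAt f ρ : ℂ) * (-1 / (z - ρ) ^ 2) + deriv (logDeriv g) z := by
    rw [← hdz.deriv]
    refine Filter.EventuallyEq.deriv_eq ?_
    filter_upwards [hf.continuous.continuousAt.eventually_ne hfz] with w hw using hld w hw
  have : deriv (logDeriv f) z + ∑ ρ ∈ S, (analyticOrderNatAt f ρ : ℂ) * ((z - ρ) ^ 2)⁻¹ =
      deriv (logDeriv g) z := by
    rw [hd, add_right_comm, ← Finset.sum_add_distrib, Finset.sum_eq_zero, zero_add]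
    intro ρ _
    ring
  rw [this]
  exact key

/-- The zeros stay at distance at least δ from z, so |z - ρ| and 1 + |c - ρ| are comparable. -/
theorem summable_order_mul_inv_sq {f : ℂ → ℂ} (hf : Differentiable ℂ f) {c : ℂ}
    (hsum : Summable fun ρ : {ρ : ℂ // f ρ = 0} =>
      (analyticOrderNatAt f ρ : ℝ) * (1 + ‖c - ρ‖) ^ (-2 : ℝ)) {z : ℂ} (hfz : f z ≠ 0) :
    Summable fun ρ : {ρ : ℂ // f ρ = 0} =>
      (analyticOrderNatAt f ρ : ℂ) * ((z - ρ) ^ 2)⁻¹ := by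
  obtain ⟨δ, hδ, hball⟩ := Metric.eventually_nhds_iff.1
    (hf.continuous.continuousAt.eventually_ne hfz)
  set D : ℝ := 1 + (1 + ‖c - z‖) / δ with hD
  refine Summable.of_norm_bounded (hsum.mul_left (D ^ 2)) fun ρ => ?_
  have hρδ : δ ≤ ‖z - ρ‖ := by
    by_contra h
    push Not at h
    exact hball (y := ρ) (by rwa [dist_comm, dist_eq_norm]) ρ.2
  have h0 : 0 < ‖z - ρ‖ := hδ.trans_le hρδ
  have h1 : 1 + ‖c - ρ‖ ≤ D * ‖z - ρ‖ := by
    have h2 : ‖c - (ρ : ℂ)‖ ≤ ‖c - z‖ + ‖z - ρ‖ := norm_sub_le_norm_sub_add_norm_sub _ _ _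
    have h3 : (1 + ‖c - z‖) ≤ (1 + ‖c - z‖) / δ * ‖z - ρ‖ := by
      rw [div_mul_eq_mul_div, le_div_iff₀ hδ]
      gcongr
    rw [hD, add_mul, one_mul]
    linarith
  rw [norm_mul, norm_inv, norm_pow, Complex.norm_natCast, mul_left_comm]
  refine mul_le_mul_of_nonneg_left ?_ (by positivity)
  rw [Real.rpow_neg (by positivity), Real.rpow_two, ← div_eq_mul_inv, inv_eq_one_div,
    div_le_div_iff₀ (by positivity) (by positivity), one_mul, ← mul_pow]
  exact pow_le_pow_left₀ (by positivity) h1 2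

/-- With the zeros of the disc of radius n removed, the error is O(n^(A-2)), which tends to 0
because A < 2. Absolute convergence identifies the limit along these discs with the unconditional
sum. -/
theorem hasSum_inv_sq_eq_neg_deriv_logDeriv {f : ℂ → ℂ} (hf : Differentiable ℂ f) {c : ℂ}
    (hc : f c ≠ 0) {A C : ℝ} (hA : 0 < A) (hA2 : A < 2) (hC : 0 < C)
    (hgrow : ∀ z, ‖f z‖ ≤ C * Real.exp ((‖z - c‖ + 1) ^ A)) {z : ℂ} (hfz : f z ≠ 0) :
    HasSum (fun ρ : {ρ : ℂ // f ρ = 0} => (analyticOrderNatAt f ρ : ℂ) * ((z - ρ) ^ 2)⁻¹)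
      (-deriv (logDeriv f) z) := by
  classical
  have hs := summable_order_mul_inv_sq hf
    (summable_order_mul_rpow hf hc hA hC hgrow hA2) hfz
  have hfin := fun n : ℕ => finite_zeros_inter_closedBall hf hc c (n : ℝ)
  set S : ℕ → Finset ℂ := fun n => (hfin n).toFinset with hSdef
  have hS : ∀ n ρ, ρ ∈ S n ↔ f ρ = 0 ∧ ‖ρ - c‖ ≤ n := by
    intro n ρ
    simp [hSdef, dist_eq_norm]
  set S' : ℕ → Finset {ρ : ℂ // f ρ = 0} := fun n => (S n).subtype (fun ρ => f ρ = 0) with hS'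
  have hlim1 : Tendsto S' atTop atTop := by
    refine tendsto_atTop_finset_of_monotone ?_ ?_
    · intro m n hmn ρ hρ
      simp only [hS', Finset.mem_subtype, hS] at hρ ⊢
      exact ⟨hρ.1, hρ.2.trans (by exact_mod_cast hmn)⟩
    · intro ρ
      obtain ⟨n, hn⟩ := exists_nat_ge ‖(ρ : ℂ) - c‖
      exact ⟨n, by simp only [hS', Finset.mem_subtype, hS]; exact ⟨ρ.2, hn⟩⟩
  have hlim2 := hs.hasSum.comp hlim1
  have hsumeq : ∀ n, ∑ ρ ∈ S' n, (analyticOrderNatAt f ρ : ℂ) * ((z - ρ) ^ 2)⁻¹ =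
      ∑ ρ ∈ S n, (analyticOrderNatAt f ρ : ℂ) * ((z - ρ) ^ 2)⁻¹ := fun n =>
    Finset.sum_subtype_of_mem (fun ρ => (analyticOrderNatAt f ρ : ℂ) * ((z - ρ) ^ 2)⁻¹)
      fun ρ hρ => ((hS n ρ).1 hρ).1
  have hfc : 0 < ‖f c‖ := norm_pos_iff.2 hc
  set k : ℝ := |Real.log (C / ‖f c‖)| with hk
  have hbd : ∀ᶠ n : ℕ in atTop,
      ‖deriv (logDeriv f) z + ∑ ρ ∈ S n, (analyticOrderNatAt f ρ : ℂ) * ((z - ρ) ^ 2)⁻¹‖ ≤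
        64 * (k + 4 ^ A) * (n : ℝ) ^ (-(2 - A)) := by
    -- This choice puts z within n/4 of the centre and makes n at least 1.
    obtain ⟨N, hN⟩ := exists_nat_gt (4 * ‖z - c‖ + 1)
    filter_upwards [eventually_ge_atTop N] with n hn
    have hnN : 4 * ‖z - c‖ + 1 < (n : ℝ) := hN.trans_le (by exact_mod_cast hn)
    have hn1 : (1 : ℝ) ≤ n := by linarith [norm_nonneg (z - c)]
    have hn0 : (0 : ℝ) < n := by linarith
    refine (norm_deriv_logDeriv_add_sum_le hf hc (S n) hn0 (hS n)
      (M := C * Real.exp ((3 * n + 1) ^ A)) (K := (k + 4 ^ A) * (n : ℝ) ^ A)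
      (fun w hw => (hgrow w).trans (by gcongr)) (by positivity) ?_ (by linarith) hfz).trans ?_
    · have h1 : C ≤ ‖f c‖ * Real.exp k := by
        rw [mul_comm, ← div_le_iff₀ hfc]
        calc C / ‖f c‖ = Real.exp (Real.log (C / ‖f c‖)) := (Real.exp_log (by positivity)).symm
          _ ≤ _ := Real.exp_le_exp.2 (le_abs_self _)
      have h4 : (3 * (n : ℝ) + 1) ^ A ≤ 4 ^ A * n ^ A := by
        rw [← Real.mul_rpow (by norm_num) hn0.le]
        exact Real.rpow_le_rpow (by positivity) (by linarith) hA.le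
      have h5 : 1 ≤ (n : ℝ) ^ A := Real.one_le_rpow hn1 hA.le
      have h6 : k * 1 ≤ k * (n : ℝ) ^ A := by gcongr
      calc C * Real.exp ((3 * n + 1) ^ A) ≤ ‖f c‖ * Real.exp k * Real.exp ((3 * n + 1) ^ A) := by
            gcongr
        _ = ‖f c‖ * Real.exp (k + (3 * n + 1) ^ A) := by rw [mul_assoc, ← Real.exp_add]
        _ ≤ _ := by
          gcongr
          linarith
    · refine le_of_eq ?_
      rw [neg_sub, Real.rpow_sub hn0, Real.rpow_two]
      ring
  have hz0 : Tendsto (fun n : ℕ => 64 * (k + 4 ^ A) * (n : ℝ) ^ (-(2 - A))) atTop (𝓝 0) := by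
    have := ((tendsto_rpow_neg_atTop (y := 2 - A) (by linarith)).comp
      tendsto_natCast_atTop_atTop).const_mul (64 * (k + 4 ^ A))
    simpa using this
  have hlim3 := squeeze_zero_norm' hbd hz0
  have hlim4 := hlim3.const_add (-deriv (logDeriv f) z)
  simp only [neg_add_cancel_left, add_zero] at hlim4
  have hval := tendsto_nhds_unique hlim2 (hlim4.congr fun n => (hsumeq n).symm)
  rw [← hval]
  exact hs.hasSum

end EntireFunctions

/-! ### The Mellin transform of (y + w)^(-2) -/

section MellinKernel

open MeasureTheory Set

/-- The difference of the two sides is exactly (|u| - Re u)(y - |u|)² ≥ 0. -/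
theorem norm_add_re_mul_sq_le (u : ℂ) {y : ℝ} :
    (‖u‖ + u.re) * (y + ‖u‖) ^ 2 ≤ 2 * ‖u‖ * ‖(y : ℂ) + u‖ ^ 2 := by
  have h1 : ‖(y : ℂ) + u‖ ^ 2 = y ^ 2 + 2 * y * u.re + ‖u‖ ^ 2 := by
    rw [Complex.sq_norm, Complex.sq_norm, Complex.normSq_apply, Complex.normSq_apply]
    simp
    ring
  have h2 : 0 ≤ (‖u‖ - u.re) * (y - ‖u‖) ^ 2 :=
    mul_nonneg (sub_nonneg.2 (Complex.re_le_norm u)) (sq_nonneg _)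
  rw [h1]
  nlinarith

theorem mul_add_norm_le_of_sq_mul_le {u : ℂ} (hu : u ≠ 0) {κ : ℝ}
    (h : 2 * ‖u‖ * κ ^ 2 ≤ ‖u‖ + u.re) {y : ℝ} : κ * (y + ‖u‖) ≤ ‖(y : ℂ) + u‖ := by
  have hu0 : 0 < ‖u‖ := norm_pos_iff.2 hu
  refine le_of_abs_le ((sq_le_sq.1 ?_).trans (abs_norm _).le)
  have h1 := norm_add_re_mul_sq_le u (y := y)
  have h2 : 2 * ‖u‖ * κ ^ 2 * (y + ‖u‖) ^ 2 ≤ 2 * ‖u‖ * ‖(y : ℂ) + u‖ ^ 2 :=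
    (mul_le_mul_of_nonneg_right h (sq_nonneg _)).trans h1
  rw [mul_pow]
  refine le_of_mul_le_mul_left ?_ (by positivity : 0 < 2 * ‖u‖)
  linarith

theorem exists_mul_add_norm_le {u : ℂ} (hu : u ∈ Complex.slitPlane) :
    ∃ κ : ℝ, 0 < κ ∧ ∀ y : ℝ, κ * (y + ‖u‖) ≤ ‖(y : ℂ) + u‖ := by
  have hu0 := Complex.slitPlane_ne_zero hu
  have hu1 : 0 < ‖u‖ := norm_pos_iff.2 hu0
  have h : 0 < ‖u‖ + u.re := by
    rcases hu with h | h
    · positivity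
    · have := Complex.abs_re_lt_norm.2 h
      linarith [neg_abs_le u.re]
  refine ⟨√((‖u‖ + u.re) / (2 * ‖u‖)), by positivity, fun y =>
    mul_add_norm_le_of_sq_mul_le hu0 ?_⟩
  rw [Real.sq_sqrt (by positivity)]
  exact (mul_div_cancel₀ _ (by positivity)).le

/-- A constant independent of u, needed to sum over zeros: far from the centre, zeros with Re u ≥
-1/2 satisfy Re u ≥ -|u|/2. -/
theorem half_mul_add_norm_le {u : ℂ} (hu : 1 ≤ ‖u‖) (hre : -(1 / 2) ≤ u.re) (y : ℝ) :
    1 / 2 * (y + ‖u‖) ≤ ‖(y : ℂ) + u‖ :=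
  mul_add_norm_le_of_sq_mul_le (norm_pos_iff.1 (by linarith)) (by linarith)

theorem norm_kernel {s : ℂ} {y : ℝ} (hy : 0 < y) (w : ℂ) :
    ‖(y : ℂ) ^ (1 - s) * (((y : ℂ) + w) ^ 2)⁻¹‖ = y ^ (1 - s.re) * (‖(y : ℂ) + w‖ ^ 2)⁻¹ := by
  rw [norm_mul, norm_inv, norm_pow, Complex.norm_cpow_eq_rpow_re_of_pos hy]
  simp

theorem integrableOn_rpow_mul_inv_sq {σ r : ℝ} (h0 : 0 < σ) (h2 : σ < 2) (hr : 0 < r) :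
    IntegrableOn (fun y : ℝ => y ^ (1 - σ) * ((y + r) ^ 2)⁻¹) (Ioi 0) := by
  have hc : ContinuousOn (fun y : ℝ => y ^ (1 - σ) * ((y + r) ^ 2)⁻¹) (Ioi 0) := by
    intro y hy
    have hy' : (0 : ℝ) < y := hy
    have h3 : (y + r) ^ 2 ≠ 0 := by positivity
    have h4 : ContinuousAt (fun y : ℝ => y ^ (1 - σ)) y :=
      Real.continuousAt_rpow_const _ _ (Or.inl hy'.ne')
    have h5 : ContinuousAt (fun y : ℝ => ((y + r) ^ 2)⁻¹) y :=
      ContinuousAt.inv₀ (by fun_prop) h3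
    exact (h4.mul h5).continuousWithinAt
  rw [← Ioc_union_Ioi_eq_Ioi zero_le_one]
  refine IntegrableOn.union ?_ ?_
  · have h1 : IntegrableOn (fun y : ℝ => y ^ (1 - σ) * (r ^ 2)⁻¹) (Ioc 0 1) := by
      refine Integrable.mul_const ?_ _
      have := (intervalIntegral.intervalIntegrable_rpow' (a := 0) (b := 1) (r := 1 - σ)
        (by linarith))
      exact (intervalIntegrable_iff_integrableOn_Ioc_of_le zero_le_one).1 this
    refine Integrable.mono' h1
      ((hc.mono Ioc_subset_Ioi_self).aestronglyMeasurable measurableSet_Ioc) ?_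
    refine (ae_restrict_mem measurableSet_Ioc).mono fun y hy => ?_
    have hy0 : 0 < y := hy.1
    rw [Real.norm_of_nonneg (by positivity)]
    gcongr
    linarith
  · have h1 : IntegrableOn (fun y : ℝ => y ^ (-1 - σ)) (Ioi 1) :=
      integrableOn_Ioi_rpow_of_lt (by linarith) one_pos
    refine Integrable.mono' h1
      ((hc.mono (Ioi_subset_Ioi zero_le_one)).aestronglyMeasurable measurableSet_Ioi) ?_
    refine (ae_restrict_mem measurableSet_Ioi).mono fun y hy => ?_
    have hy0 : 0 < y := one_pos.trans hy
    rw [Real.norm_of_nonneg (by positivity)]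
    calc y ^ (1 - σ) * ((y + r) ^ 2)⁻¹ ≤ y ^ (1 - σ) * (y ^ 2)⁻¹ := by
          gcongr
          linarith
      _ = y ^ (-1 - σ) := by
          rw [← Real.rpow_two, ← Real.rpow_neg hy0.le, ← Real.rpow_add hy0]
          ring_nf

theorem continuousOn_kernel (s : ℂ) {w : ℂ} (hw : w ∈ Complex.slitPlane) :
    ContinuousOn (fun y : ℝ => (y : ℂ) ^ (1 - s) * (((y : ℂ) + w) ^ 2)⁻¹) (Ioi 0) := by
  intro y hy
  have hy' : (0 : ℝ) < y := hy
  obtain ⟨κ, hκ, h⟩ := exists_mul_add_norm_le hw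
  have h1 : (y : ℂ) + w ≠ 0 := by
    refine norm_pos_iff.1 (lt_of_lt_of_le ?_ (h y))
    positivity
  have h4 : ContinuousAt (fun y : ℝ => (y : ℂ) ^ (1 - s)) y :=
    Complex.continuousAt_ofReal_cpow_const _ _ (Or.inr hy'.ne')
  have h5 : ContinuousAt (fun y : ℝ => (((y : ℂ) + w) ^ 2)⁻¹) y :=
    ContinuousAt.inv₀ (by fun_prop) (pow_ne_zero 2 h1)
  exact (h4.mul h5).continuousWithinAt

theorem norm_kernel_le {s w : ℂ} {κ r y : ℝ} (hκ : 0 < κ) (hr : 0 < r) (hy : 0 < y)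
    (h : κ * (y + r) ≤ ‖(y : ℂ) + w‖) :
    ‖(y : ℂ) ^ (1 - s) * (((y : ℂ) + w) ^ 2)⁻¹‖ ≤
      (κ ^ 2)⁻¹ * (y ^ (1 - s.re) * ((y + r) ^ 2)⁻¹) := by
  rw [norm_kernel hy, mul_left_comm, ← mul_inv, ← mul_pow]
  have : 0 < κ * (y + r) := by positivity
  gcongr

theorem integrableOn_kernel {s : ℂ} (h0 : 0 < s.re) (h2 : s.re < 2) {w : ℂ}
    (hw : w ∈ Complex.slitPlane) :
    IntegrableOn (fun y : ℝ => (y : ℂ) ^ (1 - s) * (((y : ℂ) + w) ^ 2)⁻¹) (Ioi 0) := by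
  obtain ⟨κ, hκ, h⟩ := exists_mul_add_norm_le hw
  have hw0 : 0 < ‖w‖ := norm_pos_iff.2 (Complex.slitPlane_ne_zero hw)
  refine Integrable.mono' ((integrableOn_rpow_mul_inv_sq h0 h2 hw0).const_mul (κ ^ 2)⁻¹)
    ((continuousOn_kernel s hw).aestronglyMeasurable measurableSet_Ioi) ?_
  exact (ae_restrict_mem measurableSet_Ioi).mono fun y hy => norm_kernel_le hκ hw0 hy (h y)

/-- Scaling y by r isolates the decay r^(-Re s), which makes the sum of these integrals over the
zeros converge. -/
theorem integral_norm_kernel_le {s : ℂ} (h0 : 0 < s.re) (h2 : s.re < 2) {w : ℂ} {κ r : ℝ}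
    (hκ : 0 < κ) (hr : 0 < r) (hw : w ∈ Complex.slitPlane)
    (h : ∀ y : ℝ, κ * (y + r) ≤ ‖(y : ℂ) + w‖) :
    ∫ y in Ioi (0 : ℝ), ‖(y : ℂ) ^ (1 - s) * (((y : ℂ) + w) ^ 2)⁻¹‖ ≤
      (κ ^ 2)⁻¹ * (r ^ (-s.re) * ∫ y in Ioi (0 : ℝ), y ^ (1 - s.re) * ((y + 1) ^ 2)⁻¹) := by
  have hscale : ∫ y in Ioi (0 : ℝ), y ^ (1 - s.re) * ((y + r) ^ 2)⁻¹ =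
      r ^ (-s.re) * ∫ y in Ioi (0 : ℝ), y ^ (1 - s.re) * ((y + 1) ^ 2)⁻¹ := by
    have h1 := integral_comp_mul_left_Ioi (fun y : ℝ => y ^ (1 - s.re) * ((y + r) ^ 2)⁻¹) 0 hr
    rw [mul_zero, smul_eq_mul, eq_comm, inv_mul_eq_iff_eq_mul₀ hr.ne'] at h1
    rw [h1, ← integral_const_mul, ← integral_const_mul]
    refine setIntegral_congr_fun measurableSet_Ioi fun y hy => ?_
    have hy' : (0 : ℝ) < y := hy
    have e1 : (r * y) ^ (1 - s.re) = r * r ^ (-s.re) * y ^ (1 - s.re) := by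
      rw [Real.mul_rpow hr.le hy'.le, sub_eq_add_neg, Real.rpow_add hr, Real.rpow_one]
    have e2 : r * y + r = r * (y + 1) := by ring
    simp only [e1, e2]
    have : y + 1 ≠ 0 := by positivity
    field_simp
  rw [← hscale, ← integral_const_mul]
  refine setIntegral_mono_on (integrableOn_kernel h0 h2 hw).norm
    ((integrableOn_rpow_mul_inv_sq h0 h2 hr).const_mul _) measurableSet_Ioi fun y hy => ?_
  exact norm_kernel_le hκ hr hy (h y)

/-- Substitute y = x/(1 - x). -/
theorem integral_kernel_one {s : ℂ} :
    ∫ y in Ioi (0 : ℝ), (y : ℂ) ^ (1 - s) * (((y : ℂ) + 1) ^ 2)⁻¹ =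
      Complex.betaIntegral (2 - s) s := by
  have himg : (fun x : ℝ => x / (1 - x)) '' Ioo 0 1 = Ioi 0 := by
    ext y
    constructor
    · rintro ⟨x, hx, rfl⟩
      exact div_pos hx.1 (by linarith [hx.2])
    · intro hy
      have hy' : (0 : ℝ) < y := hy
      refine ⟨y / (1 + y), ⟨by positivity, (div_lt_one (by positivity)).2 (by linarith)⟩, ?_⟩
      have : 1 + y ≠ 0 := by positivity
      field_simp
      ring
  have hder : ∀ x ∈ Ioo (0 : ℝ) 1,
      HasDerivWithinAt (fun x : ℝ => x / (1 - x)) (((1 - x) ^ 2)⁻¹) (Ioo 0 1) x := by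
    intro x hx
    have h1 : (1 : ℝ) - x ≠ 0 := by linarith [hx.2]
    refine (((hasDerivAt_id x).div ((hasDerivAt_id x).const_sub 1) h1).congr_deriv
      ?_).hasDerivWithinAt
    simp
  have hinj : InjOn (fun x : ℝ => x / (1 - x)) (Ioo 0 1) := by
    intro x hx y hy hxy
    have h1 : (1 : ℝ) - x ≠ 0 := by linarith [hx.2]
    have h2 : (1 : ℝ) - y ≠ 0 := by linarith [hy.2]
    simp only [div_eq_div_iff h1 h2] at hxy
    linarith
  rw [← himg, integral_image_eq_integral_abs_deriv_smul measurableSet_Ioo hder hinj,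
    Complex.betaIntegral, intervalIntegral.integral_of_le zero_le_one, integral_Ioc_eq_integral_Ioo]
  refine setIntegral_congr_fun measurableSet_Ioo fun x hx => ?_
  have hx0 : 0 < x := hx.1
  have hx1 : 0 < 1 - x := by linarith [hx.2]
  have e0 : (1 - (x : ℂ)) = ((1 - x : ℝ) : ℂ) := by push_cast; ring
  have hxc : ((1 - x : ℝ) : ℂ) ≠ 0 := by exact_mod_cast hx1.ne'
  have e1 : ((x / (1 - x) : ℝ) : ℂ) ^ (1 - s) = (x : ℂ) ^ (1 - s) * (1 - (x : ℂ)) ^ (s - 1) := by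
    rw [div_eq_mul_inv, Complex.ofReal_mul, Complex.mul_cpow_ofReal_nonneg hx0.le (by positivity),
      Complex.ofReal_inv, Complex.inv_cpow _ _ (by
        rw [Complex.arg_ofReal_of_nonneg hx1.le]; exact Real.pi_pos.ne), ← Complex.cpow_neg, e0,
      neg_sub]
  have e2 : ((x / (1 - x) : ℝ) : ℂ) + 1 = ((1 - x : ℝ) : ℂ)⁻¹ := by
    push_cast at hxc ⊢
    field_simp
    ring
  simp only [e1, e2]
  rw [abs_of_pos (by positivity), Complex.real_smul,
    show (2 - s - 1 : ℂ) = 1 - s by ring]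
  have : (((1 - x : ℝ) : ℂ)⁻¹ ^ 2)⁻¹ = ((1 - x : ℝ) : ℂ) ^ 2 := by simp
  rw [this]
  push_cast at hxc ⊢
  field_simp

theorem integral_kernel_ofReal {s : ℂ} {r : ℝ} (hr : 0 < r) :
    ∫ y in Ioi (0 : ℝ), (y : ℂ) ^ (1 - s) * (((y : ℂ) + r) ^ 2)⁻¹ =
      (r : ℂ) ^ (-s) * Complex.betaIntegral (2 - s) s := by
  have h1 := integral_comp_mul_left_Ioi
    (fun y : ℝ => (y : ℂ) ^ (1 - s) * (((y : ℂ) + r) ^ 2)⁻¹) 0 hr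
  have hrc : (r : ℂ) ≠ 0 := by exact_mod_cast hr.ne'
  rw [mul_zero, Complex.real_smul, Complex.ofReal_inv, eq_comm, inv_mul_eq_iff_eq_mul₀ hrc] at h1
  rw [h1, ← integral_kernel_one, ← integral_const_mul, ← integral_const_mul]
  refine setIntegral_congr_fun measurableSet_Ioi fun y hy => ?_
  have hy' : (0 : ℝ) < y := hy
  have e1 : ((r * y : ℝ) : ℂ) ^ (1 - s) = (r : ℂ) * (r : ℂ) ^ (-s) * (y : ℂ) ^ (1 - s) := by
    rw [Complex.ofReal_mul, Complex.mul_cpow_ofReal_nonneg hr.le hy'.le, sub_eq_add_neg,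
      Complex.cpow_add _ _ hrc, Complex.cpow_one]
  have e2 : ((r * y : ℝ) : ℂ) + r = r * (y + 1) := by push_cast; ring
  simp only [e1, e2]
  have : (y : ℂ) + 1 ≠ 0 := by
    have : y + 1 ≠ 0 := by positivity
    exact_mod_cast this
  field_simp

theorem differentiableAt_integral_kernel {s : ℂ} (h0 : 0 < s.re) (h2 : s.re < 2) {w : ℂ}
    (hw : w ∈ Complex.slitPlane) :
    DifferentiableAt ℂ
      (fun w : ℂ => ∫ y in Ioi (0 : ℝ), (y : ℂ) ^ (1 - s) * (((y : ℂ) + w) ^ 2)⁻¹) w := by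
  obtain ⟨κ, hκ, h⟩ := exists_mul_add_norm_le hw
  set r := ‖w‖ with hrdef
  have hr : 0 < r := norm_pos_iff.2 (Complex.slitPlane_ne_zero hw)
  obtain ⟨ε, hε, hball⟩ := Metric.isOpen_iff.1 Complex.isOpen_slitPlane w hw
  -- Moving w by less than κr/2 costs at most half of the lower bound κ(y + r), which gives one
  -- dominating function on the ball.
  set δ := min ε (κ * r / 2) with hδ
  have hδ0 : 0 < δ := by positivity
  have hlow : ∀ v ∈ Metric.ball w δ, ∀ y : ℝ, 0 < y → κ / 2 * (y + r) ≤ ‖(y : ℂ) + v‖ := by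
    intro v hv y hy
    rw [mem_ball_iff_norm] at hv
    have h3 : ‖(y : ℂ) + w‖ ≤ ‖(y : ℂ) + v‖ + ‖v - w‖ := by
      calc ‖(y : ℂ) + w‖ = ‖((y : ℂ) + v) - (v - w)‖ := by ring_nf
        _ ≤ _ := norm_sub_le _ _
    have h4 := h y
    have h5 : δ ≤ κ * r / 2 := min_le_right _ _
    nlinarith [mul_pos hκ hy]
  have key := hasDerivAt_integral_of_dominated_loc_of_deriv_le
    (μ := volume.restrict (Ioi (0 : ℝ))) (𝕜 := ℂ)
    (F := fun (w : ℂ) (y : ℝ) => (y : ℂ) ^ (1 - s) * (((y : ℂ) + w) ^ 2)⁻¹)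
    (F' := fun (w : ℂ) (y : ℝ) => (y : ℂ) ^ (1 - s) * (((y : ℂ) + w) ^ 2)⁻¹ *
      (-2 * ((y : ℂ) + w)⁻¹))
    (x₀ := w) (s := Metric.ball w δ)
    (bound := fun y => ((κ / 2) ^ 2)⁻¹ * (y ^ (1 - s.re) * ((y + r) ^ 2)⁻¹) *
      (2 * (κ / 2 * r)⁻¹))
    (Metric.ball_mem_nhds w hδ0) ?_ (integrableOn_kernel h0 h2 hw) ?_ ?_ ?_ ?_
  · exact key.2.differentiableAt
  · filter_upwards [Metric.ball_mem_nhds w hε] with v hv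
    exact (integrableOn_kernel h0 h2 (hball hv)).aestronglyMeasurable
  · refine (integrableOn_kernel h0 h2 hw).aestronglyMeasurable.mul ?_
    refine ContinuousOn.aestronglyMeasurable ?_ measurableSet_Ioi
    intro y hy
    have hy' : (0 : ℝ) < y := hy
    have : (y : ℂ) + w ≠ 0 := norm_pos_iff.1 (lt_of_lt_of_le (by positivity) (h y))
    exact (ContinuousAt.mul continuousAt_const (ContinuousAt.inv₀
      (f := fun y : ℝ => (y : ℂ) + w) (by fun_prop) this)).continuousWithinAt
  · refine (ae_restrict_mem measurableSet_Ioi).mono fun y hy v hv => ?_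
    have hy' : (0 : ℝ) < y := hy
    have hl := hlow v hv y hy
    rw [norm_mul]
    refine mul_le_mul (norm_kernel_le (by positivity) hr hy hl) ?_ (norm_nonneg _) (by positivity)
    rw [norm_mul, norm_neg, Complex.norm_ofNat, norm_inv]
    have : κ / 2 * r ≤ κ / 2 * (y + r) := by gcongr; linarith
    have h3 : 0 < κ / 2 * r := by positivity
    gcongr
    exact this.trans hl
  · exact ((integrableOn_rpow_mul_inv_sq h0 h2 hr).const_mul _).mul_const _
  · refine (ae_restrict_mem measurableSet_Ioi).mono fun y hy v hv => ?_
    have hy' : (0 : ℝ) < y := hy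
    have hne : (y : ℂ) + v ≠ 0 := norm_pos_iff.1 (lt_of_lt_of_le (by positivity) (hlow v hv y hy))
    have h1 : HasDerivAt (fun v : ℂ => (((y : ℂ) + v) ^ 2)⁻¹)
        (-(((2 : ℕ) : ℂ) * ((y : ℂ) + v) ^ (2 - 1) * 1) / (((y : ℂ) + v) ^ 2) ^ 2) v :=
      ((((hasDerivAt_id v).const_add (y : ℂ)).fun_pow 2)).fun_inv (pow_ne_zero 2 hne)
    refine (h1.const_mul _).congr_deriv ?_
    field_simp
    simp
    ring

/-- Both sides are analytic in w on the slit plane and agree at real w > 1, which accumulate at 1.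
-/
theorem integral_kernel {s : ℂ} (h0 : 0 < s.re) (h2 : s.re < 2) {w : ℂ}
    (hw : w ∈ Complex.slitPlane) :
    ∫ y in Ioi (0 : ℝ), (y : ℂ) ^ (1 - s) * (((y : ℂ) + w) ^ 2)⁻¹ =
      w ^ (-s) * (Complex.Gamma (2 - s) * Complex.Gamma s) := by
  have hbeta : Complex.betaIntegral (2 - s) s = Complex.Gamma (2 - s) * Complex.Gamma s := by
    rw [Complex.betaIntegral_eq_Gamma_mul_div _ _ (by simpa using h2) h0]
    simp
  rw [← hbeta]
  have h1 : AnalyticOnNhd ℂ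
      (fun w : ℂ => ∫ y in Ioi (0 : ℝ), (y : ℂ) ^ (1 - s) * (((y : ℂ) + w) ^ 2)⁻¹)
      Complex.slitPlane :=
    DifferentiableOn.analyticOnNhd (fun w hw =>
      (differentiableAt_integral_kernel h0 h2 hw).differentiableWithinAt)
      Complex.isOpen_slitPlane
  have h3 : AnalyticOnNhd ℂ (fun w : ℂ => w ^ (-s) * Complex.betaIntegral (2 - s) s)
      Complex.slitPlane :=
    DifferentiableOn.analyticOnNhd (fun w hw =>
      ((differentiableAt_id.cpow_const hw).mul_const _).differentiableWithinAt)
      Complex.isOpen_slitPlane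
  have hone : (1 : ℂ) ∈ Complex.slitPlane := Complex.one_mem_slitPlane
  refine h1.eqOn_of_preconnected_of_frequently_eq h3
    (Complex.starConvex_one_slitPlane.isPathConnected hone).isConnected.isPreconnected hone ?_ hw
  have hreal : Tendsto (fun r : ℝ => (r : ℂ)) (𝓝[>] 1) (𝓝[≠] 1) := by
    refine tendsto_nhdsWithin_iff.2 ⟨?_, ?_⟩
    · exact (Complex.continuous_ofReal.tendsto' 1 1 (by simp)).mono_left nhdsWithin_le_nhds
    · filter_upwards [self_mem_nhdsWithin] with r hr
      have : (1 : ℝ) < r := hr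
      simpa using this.ne'
  refine hreal.frequently (Eventually.frequently ?_)
  filter_upwards [self_mem_nhdsWithin] with r hr
  exact integral_kernel_ofReal (one_pos.trans hr)

theorem Gamma_two_sub_mul_Gamma {s : ℂ} (hs : s ≠ 1) :
    Complex.Gamma (2 - s) * Complex.Gamma s =
      (1 - s) * (Real.pi / Complex.sin (Real.pi * s)) := by
  rw [← Complex.Gamma_mul_Gamma_one_sub, show (2 - s : ℂ) = (1 - s) + 1 by ring,
    Complex.Gamma_add_one _ (sub_ne_zero.2 hs.symm)]
  ring

end MellinKernel

/-! ### The zeta series over the zeros and its integral representation -/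

section ZeroZeta

open MeasureTheory Set

/-- An entire function of order at most `1` whose zeros `ρ` satisfy `Re ρ ≤ Re c + 1/2`, none of
them lying on the half-line `c + [0, ∞)`. -/
structure IsZetaAdmissible (f : ℂ → ℂ) (c : ℂ) : Prop where
  differentiable : Differentiable ℂ f
  growth : ∀ A : ℝ, 1 < A → ∃ C : ℝ, 0 < C ∧ ∀ z, ‖f z‖ ≤ C * Real.exp ((‖z - c‖ + 1) ^ A)
  mem_slitPlane : ∀ ρ, f ρ = 0 → c - ρ ∈ Complex.slitPlane
  le_re : ∀ ρ, f ρ = 0 → -(1 / 2) ≤ (c - ρ).re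

variable {f : ℂ → ℂ} {c : ℂ}

theorem IsZetaAdmissible.ne_zero (hf : IsZetaAdmissible f c) {y : ℝ} (hy : 0 ≤ y) :
    f (c + y) ≠ 0 := by
  intro h
  have := hf.mem_slitPlane _ h
  rw [sub_add_cancel_left, Complex.mem_slitPlane_iff] at this
  simp at this
  linarith

theorem IsZetaAdmissible.ne_zero_center (hf : IsZetaAdmissible f c) : f c ≠ 0 := by
  simpa using hf.ne_zero le_rfl

theorem IsZetaAdmissible.summable_rpow (hf : IsZetaAdmissible f c) {σ : ℝ} (hσ : 1 < σ) :
    Summable fun ρ : {ρ : ℂ // f ρ = 0} =>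
      (analyticOrderNatAt f ρ : ℝ) * (1 + ‖c - ρ‖) ^ (-σ) := by
  obtain ⟨C, hC, hg⟩ := hf.growth ((1 + σ) / 2) (by linarith)
  exact summable_order_mul_rpow hf.differentiable hf.ne_zero_center (by linarith) hC hg
    (by linarith)

theorem IsZetaAdmissible.hasSum_inv_sq (hf : IsZetaAdmissible f c) {y : ℝ} (hy : 0 ≤ y) :
    HasSum (fun ρ : {ρ : ℂ // f ρ = 0} =>
      (analyticOrderNatAt f ρ : ℂ) * (((y : ℂ) + (c - ρ)) ^ 2)⁻¹)
      (-deriv (logDeriv f) (c + y)) := by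
  obtain ⟨C, hC, hg⟩ := hf.growth (3 / 2) (by norm_num)
  have := hasSum_inv_sq_eq_neg_deriv_logDeriv hf.differentiable hf.ne_zero_center
    (by norm_num) (by norm_num) hC hg (hf.ne_zero hy)
  convert this using 4
  ring

theorem IsZetaAdmissible.finite_norm_lt (hf : IsZetaAdmissible f c) (R : ℝ) :
    {ρ : {ρ : ℂ // f ρ = 0} | ‖c - ρ‖ < R}.Finite := by
  have h := finite_zeros_inter_closedBall hf.differentiable hf.ne_zero_center c R
  refine (h.preimage (f := ((↑) : {ρ : ℂ // f ρ = 0} → ℂ))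
    Subtype.val_injective.injOn).subset fun ρ hρ => ?_
  refine ⟨ρ.2, ?_⟩
  rw [mem_closedBall_iff_norm, norm_sub_rev]
  exact le_of_lt hρ

theorem IsZetaAdmissible.countable (hf : IsZetaAdmissible f c) :
    Countable {ρ : ℂ // f ρ = 0} := by
  rw [← Set.countable_univ_iff]
  refine (Set.countable_iUnion fun n : ℕ => (hf.finite_norm_lt (n : ℝ)).countable).mono ?_
  intro ρ _
  obtain ⟨n, hn⟩ := exists_nat_gt ‖c - (ρ : ℂ)‖
  exact Set.mem_iUnion.2 ⟨n, hn⟩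

/-- A bound uniform in s over bounded parts of a half-plane. For |u| < 1 the power may be large, but
only finitely many zeros are that close, so the extra term is harmless for summability. -/
theorem norm_cpow_neg_le {u s : ℂ} (hu : u ≠ 0) {σ K : ℝ} (hσ : 0 ≤ σ) (h1 : σ ≤ s.re)
    (hK : ‖s‖ ≤ K) :
    ‖u ^ (-s)‖ ≤ Real.exp (Real.pi * K) *
      (2 ^ σ * (1 + ‖u‖) ^ (-σ) + if ‖u‖ < 1 then ‖u‖ ^ (-K) else 0) := by
  have hu0 : 0 < ‖u‖ := norm_pos_iff.2 hu
  rw [Complex.norm_cpow_of_ne_zero hu, div_eq_mul_inv, ← Real.exp_neg, mul_comm]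
  have hexp : -(u.arg * (-s).im) ≤ Real.pi * K := by
    have h2 : |u.arg * (-s).im| ≤ Real.pi * K := by
      rw [abs_mul]
      refine mul_le_mul (Complex.abs_arg_le_pi u) ?_ (abs_nonneg _) Real.pi_pos.le
      rw [Complex.neg_im, abs_neg]
      exact (Complex.abs_im_le_norm s).trans hK
    linarith [neg_abs_le (u.arg * (-s).im)]
  refine mul_le_mul (Real.exp_le_exp.2 hexp) ?_ (by positivity) (by positivity)
  rw [Complex.neg_re]
  split_ifs with h
  · refine le_add_of_nonneg_of_le (by positivity) ?_
    exact Real.rpow_le_rpow_of_exponent_ge hu0 h.le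
      (neg_le_neg ((Complex.re_le_norm s).trans hK))
  · push Not at h
    rw [add_zero]
    have h3 : ‖u‖ ^ (-s.re) ≤ ‖u‖ ^ (-σ) :=
      Real.rpow_le_rpow_of_exponent_le h (neg_le_neg h1)
    refine h3.trans ?_
    rw [Real.rpow_neg hu0.le, Real.rpow_neg (by positivity), ← div_eq_mul_inv, inv_eq_one_div,
      div_le_div_iff₀ (by positivity) (by positivity), one_mul,
      ← Real.mul_rpow (by norm_num) hu0.le]
    exact Real.rpow_le_rpow (by positivity) (by linarith) hσ

theorem IsZetaAdmissible.exists_summable_bound (hf : IsZetaAdmissible f c) {σ : ℝ} (hσ : 1 < σ)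
    (K : ℝ) : ∃ b : {ρ : ℂ // f ρ = 0} → ℝ, Summable b ∧
      ∀ ρ (s : ℂ), σ ≤ s.re → ‖s‖ ≤ K → ‖zeroZetaTerm f c ρ s‖ ≤ b ρ := by
  classical
  have h1 := (hf.summable_rpow hσ).mul_left (2 ^ σ)
  have h2 : Summable fun ρ : {ρ : ℂ // f ρ = 0} =>
      (analyticOrderNatAt f ρ : ℝ) * (if ‖c - ρ‖ < 1 then ‖c - (ρ : ℂ)‖ ^ (-K) else 0) := by
    refine summable_of_hasFiniteSupport ((hf.finite_norm_lt 1).subset fun ρ hρ => ?_)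
    by_contra h
    rw [Set.mem_ofPred_eq] at h
    simp [h] at hρ
  refine ⟨_, (h1.add h2).mul_left (Real.exp (Real.pi * K)), fun ρ s hs hK => ?_⟩
  have := norm_cpow_neg_le (Complex.slitPlane_ne_zero (hf.mem_slitPlane ρ ρ.2))
    (by linarith) hs hK
  rw [zeroZetaTerm, norm_mul, Complex.norm_natCast]
  refine (mul_le_mul_of_nonneg_left this (by positivity)).trans (le_of_eq ?_)
  ring

theorem IsZetaAdmissible.summable_norm (hf : IsZetaAdmissible f c) {s : ℂ} (hs : 1 < s.re) :
    Summable fun ρ => ‖zeroZetaTerm f c ρ s‖ := by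
  obtain ⟨b, hb, h⟩ := hf.exists_summable_bound hs ‖s‖
  exact Summable.of_nonneg_of_le (fun _ => norm_nonneg _) (fun ρ => h ρ s le_rfl le_rfl) hb

theorem isOpen_re_gt (r : ℝ) : IsOpen {s : ℂ | r < s.re} :=
  isOpen_lt continuous_const Complex.continuous_re

theorem IsZetaAdmissible.differentiableOn_tsum (hf : IsZetaAdmissible f c) :
    DifferentiableOn ℂ (fun s => ∑' ρ, zeroZetaTerm f c ρ s) {s | 1 < s.re} := by
  intro s hs
  have hs' : 1 < s.re := hs
  obtain ⟨b, hb, h⟩ := hf.exists_summable_bound (σ := (1 + s.re) / 2) (by linarith) (‖s‖ + 1)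
  have hopen : IsOpen ({w : ℂ | (1 + s.re) / 2 < w.re} ∩ {w : ℂ | ‖w‖ < ‖s‖ + 1}) :=
    (isOpen_re_gt _).inter (isOpen_lt continuous_norm continuous_const)
  have hmem : s ∈ ({w : ℂ | (1 + s.re) / 2 < w.re} ∩ {w : ℂ | ‖w‖ < ‖s‖ + 1}) :=
    ⟨by rw [Set.mem_ofPred_eq]; linarith, by rw [Set.mem_ofPred_eq]; linarith⟩
  refine DifferentiableAt.differentiableWithinAt ?_
  refine (Complex.differentiableOn_tsum_of_summable_norm hb (fun ρ => ?_) hopen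
    (fun ρ w hw => h ρ w hw.1.le hw.2.le)).differentiableAt (hopen.mem_nhds hmem)
  refine Differentiable.differentiableOn fun w => ?_
  have hne := Complex.slitPlane_ne_zero (hf.mem_slitPlane ρ ρ.2)
  exact (((differentiableAt_id.neg).const_cpow (Or.inl hne))).const_mul _

/-- Sum and integral are interchanged in F(y) = ∑ (y + c - ρ)^(-2). Re s > 1 makes the sum of the
integrals of the norms finite, and Re s < 2 gives integrability at 0. -/
theorem IsZetaAdmissible.tsum_eq_integral (hf : IsZetaAdmissible f c) {s : ℂ} (h1 : 1 < s.re)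
    (h2 : s.re < 2) :
    ∑' ρ, zeroZetaTerm f c ρ s = Complex.sin (Real.pi * s) / (Real.pi * (1 - s)) *
      ∫ y in Ioi (0 : ℝ), (y : ℂ) ^ (1 - s) * -deriv (logDeriv f) (c + y) := by
  have := hf.countable
  have h0 : 0 < s.re := by linarith
  set I1 := ∫ y in Ioi (0 : ℝ), y ^ (1 - s.re) * ((y + 1) ^ 2)⁻¹ with hI1
  have hslit := fun ρ : {ρ : ℂ // f ρ = 0} => hf.mem_slitPlane ρ ρ.2
  set F : {ρ : ℂ // f ρ = 0} → ℝ → ℂ := fun ρ y =>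
    (analyticOrderNatAt f ρ : ℂ) * ((y : ℂ) ^ (1 - s) * (((y : ℂ) + (c - ρ)) ^ 2)⁻¹) with hF
  have hFint : ∀ ρ, IntegrableOn (F ρ) (Ioi 0) := fun ρ =>
    (integrableOn_kernel h0 h2 (hslit ρ)).const_mul _
  have hI0 : 0 ≤ I1 := setIntegral_nonneg measurableSet_Ioi fun y hy => by
    have hy' : (0 : ℝ) < y := hy
    positivity
  have hFsum : Summable fun ρ => ∫ y in Ioi (0 : ℝ), ‖F ρ y‖ := by
    refine Summable.of_norm_bounded_eventually
      ((hf.summable_rpow h1).mul_left ((((1 : ℝ) / 2) ^ 2)⁻¹ * (2 ^ s.re * I1))) ?_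
    -- The comparison is needed only for |c - ρ| ≥ 1, where the uniform constant 1/2 is available;
    -- the remaining zeros are finitely many.
    refine (hf.finite_norm_lt 1).subset fun ρ hρ => ?_
    by_contra hlt
    refine hρ ?_
    rw [Set.mem_ofPred_eq, not_lt] at hlt
    have hu0 : 0 < ‖c - (ρ : ℂ)‖ := by linarith
    have h3 := integral_norm_kernel_le h0 h2 (κ := 1 / 2) (by norm_num) hu0 (hslit ρ)
      (half_mul_add_norm_le hlt (hf.le_re ρ ρ.2))
    change ‖∫ y in Ioi (0 : ℝ), ‖F ρ y‖‖ ≤ _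
    rw [Real.norm_of_nonneg (setIntegral_nonneg measurableSet_Ioi fun y _ => norm_nonneg _)]
    have h4 : ∫ y in Ioi (0 : ℝ), ‖F ρ y‖ = (analyticOrderNatAt f ρ : ℝ) *
        ∫ y in Ioi (0 : ℝ), ‖(y : ℂ) ^ (1 - s) * (((y : ℂ) + (c - ρ)) ^ 2)⁻¹‖ := by
      rw [← integral_const_mul]
      refine setIntegral_congr_fun measurableSet_Ioi fun y _ => ?_
      simp only [hF]
      rw [norm_mul, Complex.norm_natCast]
    have h5 : ‖c - (ρ : ℂ)‖ ^ (-s.re) ≤ 2 ^ s.re * (1 + ‖c - (ρ : ℂ)‖) ^ (-s.re) := by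
      rw [Real.rpow_neg hu0.le, Real.rpow_neg (by positivity), ← div_eq_mul_inv, inv_eq_one_div,
        div_le_div_iff₀ (by positivity) (by positivity), one_mul,
        ← Real.mul_rpow (by norm_num) hu0.le]
      exact Real.rpow_le_rpow (by positivity) (by linarith) h0.le
    rw [h4]
    calc _ ≤ (analyticOrderNatAt f ρ : ℝ) * ((((1 : ℝ) / 2) ^ 2)⁻¹ *
          ((2 ^ s.re * (1 + ‖c - (ρ : ℂ)‖) ^ (-s.re)) * I1)) := by
          refine mul_le_mul_of_nonneg_left (h3.trans ?_) (by positivity)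
          gcongr
      _ = _ := by ring
  have key := hasSum_integral_of_summable_integral_norm hFint hFsum
  have hint : ∀ ρ, ∫ y in Ioi (0 : ℝ), F ρ y = zeroZetaTerm f c ρ s *
      (Complex.Gamma (2 - s) * Complex.Gamma s) := by
    intro ρ
    simp only [hF]
    rw [integral_const_mul, integral_kernel h0 h2 (hslit ρ), zeroZetaTerm, mul_assoc]
  have hsumF : ∫ y in Ioi (0 : ℝ), ∑' ρ, F ρ y =
      ∫ y in Ioi (0 : ℝ), (y : ℂ) ^ (1 - s) * -deriv (logDeriv f) (c + y) := by
    refine setIntegral_congr_fun measurableSet_Ioi fun y hy => ?_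
    have hy' : (0 : ℝ) < y := hy
    have h6 := (hf.hasSum_inv_sq hy'.le).mul_left ((y : ℂ) ^ (1 - s))
    rw [← h6.tsum_eq]
    refine tsum_congr fun ρ => ?_
    simp only [hF]
    ring
  have h7 := key.tsum_eq
  rw [hsumF] at h7
  simp only [hint] at h7
  rw [tsum_mul_right] at h7
  have hs1 : s ≠ 1 := fun h => by simp [h] at h1
  have hs1' : 1 - s ≠ 0 := sub_ne_zero.2 hs1.symm
  have hΓ := Gamma_two_sub_mul_Gamma hs1
  have hΓ0 : Complex.Gamma (2 - s) * Complex.Gamma s ≠ 0 := mul_ne_zero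
    (Complex.Gamma_ne_zero_of_re_pos (by simpa using h2)) (Complex.Gamma_ne_zero_of_re_pos h0)
  have hsin : Complex.sin (Real.pi * s) ≠ 0 := by
    intro h
    rw [hΓ, h] at hΓ0
    simp at hΓ0
  have hpi : (Real.pi : ℂ) ≠ 0 := by exact_mod_cast Real.pi_ne_zero
  rw [← h7, hΓ]
  field_simp

end ZeroZeta

/-! ### Meromorphic continuation from an expansion in inverse powers -/

section Continuation

open MeasureTheory Set

/-- `F y = ∑_{1 ≤ n ≤ N} d n * y ^ (-n) + O(y ^ (-(N + 1)))` as `y → +∞`. -/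
def HasInvExpansion (F : ℝ → ℂ) (N : ℕ) (d : ℕ → ℂ) : Prop :=
  (fun y : ℝ => F y - ∑ n ∈ Finset.Icc 1 N, d n * (y : ℂ) ^ (-(n : ℤ))) =O[atTop]
    fun y : ℝ => y ^ (-((N : ℤ) + 1))

/-- The truncation of an expansion in negative powers, restricted to `(1, ∞)`. -/
def invTruncation (N : ℕ) (d : ℕ → ℂ) (y : ℝ) : ℂ :=
  (Ioi (1 : ℝ)).indicator (fun y => ∑ n ∈ Finset.Icc 1 N, d n * (y : ℂ) ^ (-(n : ℤ))) y

/-- The entire function `sin (π s) / (s - k)`. -/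
def sinSlope (k : ℂ) (s : ℂ) : ℂ := dslope (fun s => Complex.sin (Real.pi * s)) k s

/-- `π (1 - s)` times the continuation of `sin (π s) / (π (1 - s)) * ∫ y ^ (1 - s) F y`. -/
def mellinNumerator (F : ℝ → ℂ) (N : ℕ) (d : ℕ → ℂ) (s : ℂ) : ℂ :=
  Complex.sin (Real.pi * s) * mellin (fun y => F y - invTruncation N d y) (2 - s) +
    ∑ n ∈ Finset.Icc 1 N, d n * sinSlope (2 - n) s

theorem differentiable_sin_pi : Differentiable ℂ fun s : ℂ => Complex.sin (Real.pi * s) := by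
  fun_prop

theorem hasDerivAt_sin_pi (s : ℂ) : HasDerivAt (fun s : ℂ => Complex.sin (Real.pi * s))
    (Real.pi * Complex.cos (Real.pi * s)) s := by
  have := ((hasDerivAt_id s).const_mul (Real.pi : ℂ)).csin
  simpa [mul_comm] using this

theorem differentiable_sinSlope (k : ℂ) : Differentiable ℂ (sinSlope k) := by
  have := (Complex.differentiableOn_dslope (f := fun s => Complex.sin (Real.pi * s)) (c := k)
    (s := univ) univ_mem).2 differentiable_sin_pi.differentiableOn
  rwa [differentiableOn_univ] at this

theorem sinSlope_self (k : ℂ) : sinSlope k k = Real.pi * Complex.cos (Real.pi * k) := by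
  rw [sinSlope, dslope_same, (hasDerivAt_sin_pi k).deriv]

theorem sin_pi_mul_int (k : ℤ) : Complex.sin (Real.pi * k) = 0 := by
  rw [mul_comm]; exact Complex.sin_int_mul_pi k

theorem sinSlope_of_ne {k : ℤ} {s : ℂ} (h : s ≠ k) :
    sinSlope k s = Complex.sin (Real.pi * s) / (s - k) := by
  rw [sinSlope, dslope_of_ne _ h, slope_def_field, sin_pi_mul_int, sub_zero]

theorem continuousOn_invSum (N : ℕ) (d : ℕ → ℂ) :
    ContinuousOn (fun y : ℝ => ∑ n ∈ Finset.Icc 1 N, d n * (y : ℂ) ^ (-(n : ℤ))) (Ioi 0) := by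
  refine continuousOn_finsetSum _ fun n _ => continuousOn_const.mul ?_
  intro y hy
  have hy' : (0 : ℝ) < y := hy
  exact ((Complex.continuous_ofReal.continuousAt).zpow₀ _
    (Or.inl (by exact_mod_cast hy'.ne'))).continuousWithinAt

theorem locallyIntegrableOn_invTruncation (N : ℕ) (d : ℕ → ℂ) :
    LocallyIntegrableOn (invTruncation N d) (Ioi 0) := by
  intro y hy
  obtain ⟨t, ht, hint⟩ := ((continuousOn_invSum N d).locallyIntegrableOn (μ := volume)
    measurableSet_Ioi) y hy
  exact ⟨t, ht, hint.indicator measurableSet_Ioi⟩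

variable {F : ℝ → ℂ} {N : ℕ} {d : ℕ → ℂ}

theorem isBigO_sub_invTruncation_top (h : HasInvExpansion F N d) :
    (fun y => F y - invTruncation N d y) =O[atTop] fun y : ℝ => y ^ (-((N : ℝ) + 1)) := by
  refine h.congr' ?_ ?_
  · filter_upwards [eventually_gt_atTop 1] with y hy
    rw [invTruncation, indicator_of_mem (show y ∈ Ioi (1 : ℝ) from hy)]
  · filter_upwards [eventually_gt_atTop 1] with y hy
    rw [← Real.rpow_intCast]
    push_cast
    rfl

theorem isBigO_sub_invTruncation_bot (hF : ContinuousOn F (Ici 0)) :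
    (fun y => F y - invTruncation N d y) =O[𝓝[>] 0] fun y : ℝ => y ^ (-(0 : ℝ)) := by
  have h1 : F =O[𝓝[>] 0] fun _ : ℝ => (1 : ℝ) :=
    ((hF 0 self_mem_Ici).mono Ioi_subset_Ici_self).isBigO_one ℝ
  refine h1.congr' ?_ ?_
  · filter_upwards [Ioo_mem_nhdsGT one_pos] with y hy
    rw [invTruncation, indicator_of_notMem (by simpa using hy.2.le), sub_zero]
  · filter_upwards with y
    simp

theorem locallyIntegrableOn_sub_invTruncation (hF : ContinuousOn F (Ici 0)) :
    LocallyIntegrableOn (fun y => F y - invTruncation N d y) (Ioi 0) :=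
  ((hF.mono Ioi_subset_Ici_self).locallyIntegrableOn measurableSet_Ioi).sub
    (locallyIntegrableOn_invTruncation N d)

/-- The truncation lives on (1, ∞): the difference remains bounded at 0 (hence Re s < 2) and is
O(y^(-N-1)) at infinity (hence Re s > 1 - N). -/
theorem mellinConvergent_sub_invTruncation (hF : ContinuousOn F (Ici 0))
    (h : HasInvExpansion F N d) {s : ℂ} (h1 : 1 - (N : ℝ) < s.re) (h2 : s.re < 2) :
    MellinConvergent (fun y => F y - invTruncation N d y) (2 - s) :=
  mellinConvergent_of_isBigO_rpow (locallyIntegrableOn_sub_invTruncation hF)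
    (isBigO_sub_invTruncation_top h) (by simp; linarith) (isBigO_sub_invTruncation_bot hF)
    (by simpa using h2)

theorem differentiableAt_mellin_sub_invTruncation (hF : ContinuousOn F (Ici 0))
    (h : HasInvExpansion F N d) {s : ℂ} (h1 : 1 - (N : ℝ) < s.re) (h2 : s.re < 2) :
    DifferentiableAt ℂ (fun s => mellin (fun y => F y - invTruncation N d y) (2 - s)) s := by
  have := mellin_differentiableAt_of_isBigO_rpow (s := 2 - s)
    (locallyIntegrableOn_sub_invTruncation hF)
    (isBigO_sub_invTruncation_top h) (by simp; linarith) (isBigO_sub_invTruncation_bot hF)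
    (by simpa using h2)
  exact this.comp s (by fun_prop)

theorem differentiableAt_mellinNumerator (hF : ContinuousOn F (Ici 0))
    (h : HasInvExpansion F N d) {s : ℂ} (h1 : 1 - (N : ℝ) < s.re) (h2 : s.re < 2) :
    DifferentiableAt ℂ (mellinNumerator F N d) s := by
  refine ((differentiable_sin_pi s).mul
    (differentiableAt_mellin_sub_invTruncation hF h h1 h2)).add ?_
  exact DifferentiableAt.fun_sum fun n _ => ((differentiable_sinSlope _) s).const_mul _

theorem mellin_invTruncation {s : ℂ} (h1 : 1 < s.re) :
    MellinConvergent (invTruncation N d) (2 - s) ∧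
      mellin (invTruncation N d) (2 - s) = ∑ n ∈ Finset.Icc 1 N, d n * (s - (2 - n))⁻¹ := by
  have heq : ∀ y : ℝ, (y : ℂ) ^ (2 - s - 1) • invTruncation N d y =
      (Ioi (1 : ℝ)).indicator
        (fun y : ℝ => ∑ n ∈ Finset.Icc 1 N, d n * (y : ℂ) ^ (1 - s - n)) y := by
    intro y
    by_cases hy : y ∈ Ioi (1 : ℝ)
    · have hy0 : (y : ℂ) ≠ 0 := by
        have : (0 : ℝ) < y := one_pos.trans hy
        exact_mod_cast this.ne'
      rw [invTruncation, indicator_of_mem hy, indicator_of_mem hy, smul_eq_mul, Finset.mul_sum]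
      refine Finset.sum_congr rfl fun n _ => ?_
      rw [mul_left_comm, ← Complex.cpow_intCast, ← Complex.cpow_add _ _ hy0]
      congr 2
      push_cast
      ring
    · rw [invTruncation, indicator_of_notMem hy, indicator_of_notMem hy, smul_zero]
  have hre : ∀ n ∈ Finset.Icc 1 N, (1 - s - (n : ℂ)).re < -1 := by
    intro n hn
    have : (1 : ℝ) ≤ n := by exact_mod_cast (Finset.mem_Icc.1 hn).1
    simp
    linarith
  have hint : ∀ n ∈ Finset.Icc 1 N,
      IntegrableOn (fun y : ℝ => d n * (y : ℂ) ^ (1 - s - (n : ℂ))) (Ioi 1) := fun n hn =>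
    (integrableOn_Ioi_cpow_of_lt (hre n hn) one_pos).const_mul _
  have hsub : Ioi (0 : ℝ) ∩ Ioi 1 = Ioi 1 := by
    rw [Ioi_inter_Ioi]; simp
  constructor
  · rw [MellinConvergent]
    simp only [heq]
    exact ((integrable_indicator_iff measurableSet_Ioi).2 (integrable_finsetSum _ hint)).integrableOn
  · rw [mellin]
    simp only [heq]
    rw [setIntegral_indicator measurableSet_Ioi, hsub, integral_finsetSum _ hint]
    refine Finset.sum_congr rfl fun n hn => ?_
    rw [integral_const_mul, integral_Ioi_cpow_of_lt (hre n hn) one_pos]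
    have : (1 - s - (n : ℂ) + 1) = -(s - (2 - n)) := by ring
    rw [this, Complex.ofReal_one, Complex.one_cpow, neg_div_neg_eq, one_div]

theorem HasInvExpansion.mellinConvergent (hF : ContinuousOn F (Ici 0))
    (h : HasInvExpansion F N d) {s : ℂ} (h1 : 1 < s.re) (h2 : s.re < 2) :
    MellinConvergent F (2 - s) := by
  have h3 : MellinConvergent (fun y => (F y - invTruncation N d y) + invTruncation N d y) (2 - s) :=
    (hasMellin_add (mellinConvergent_sub_invTruncation hF h
      (by have : (0 : ℝ) ≤ N := by positivity
          linarith) h2) (mellin_invTruncation h1).1).1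
  simpa using h3

/-- In the strip of convergence the removed terms integrate to d_n/(s - (2 - n)), and the `sinSlope`
terms restore them times the sine. -/
theorem mellinNumerator_eq (hF : ContinuousOn F (Ici 0))
    (h : HasInvExpansion F N d) {s : ℂ} (h1 : 1 < s.re) (h2 : s.re < 2) :
    mellinNumerator F N d s = Complex.sin (Real.pi * s) * mellin F (2 - s) := by
  have h3 := (hasMellin_sub (h.mellinConvergent hF h1 h2) (mellin_invTruncation (d := d)
    (N := N) h1).1).2
  rw [mellinNumerator, h3, (mellin_invTruncation h1).2, mul_sub, Finset.mul_sum, sub_add,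
    ← Finset.sum_sub_distrib, Finset.sum_eq_zero, sub_zero]
  intro n hn
  have hn1 : (1 : ℝ) ≤ n := by exact_mod_cast (Finset.mem_Icc.1 hn).1
  have hne : s ≠ ((2 - n : ℤ) : ℂ) := by
    intro h
    rw [h] at h1
    simp at h1
    linarith
  have := sinSlope_of_ne hne
  push_cast at this
  rw [this]
  ring

theorem isPreconnected_re_strip (a b : ℝ) : IsPreconnected {s : ℂ | a < s.re ∧ s.re < b} :=
  ((convex_halfSpace_re_gt a).inter (convex_halfSpace_re_lt b)).isPreconnected

theorem isOpen_re_strip (a b : ℝ) : IsOpen {s : ℂ | a < s.re ∧ s.re < b} :=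
  (isOpen_re_gt a).inter (isOpen_lt Complex.continuous_re continuous_const)

/-- Both numerators equal the same Mellin integral on 1 < Re s < 2, hence agree on the common strip
by the identity theorem. This lets N depend on s in the continuation. -/
theorem mellinNumerator_unique (hF : ContinuousOn F (Ici 0)) {N' : ℕ} {d' : ℕ → ℂ}
    (h : HasInvExpansion F N d) (h' : HasInvExpansion F N' d') {s : ℂ} (h1 : 1 - (N : ℝ) < s.re)
    (h1' : 1 - (N' : ℝ) < s.re) (h2 : s.re < 2) :
    mellinNumerator F N d s = mellinNumerator F N' d' s := by
  set U := {s : ℂ | 1 - (min N N' : ℝ) < s.re ∧ s.re < 2} with hU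
  have hUo : IsOpen U := isOpen_re_strip _ _
  have hle : (min N N' : ℝ) ≤ N := min_le_left _ _
  have hle' : (min N N' : ℝ) ≤ N' := min_le_right _ _
  have hmin0 : (0 : ℝ) ≤ min (N : ℝ) N' := le_min (by positivity) (by positivity)
  have ha : AnalyticOnNhd ℂ (mellinNumerator F N d) U := DifferentiableOn.analyticOnNhd
    (fun w hw => (differentiableAt_mellinNumerator hF h (by linarith [hw.1])
      hw.2).differentiableWithinAt) hUo
  have ha' : AnalyticOnNhd ℂ (mellinNumerator F N' d') U := DifferentiableOn.analyticOnNhd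
    (fun w hw => (differentiableAt_mellinNumerator hF h' (by linarith [hw.1])
      hw.2).differentiableWithinAt) hUo
  have hz : ((3 / 2 : ℝ) : ℂ) ∈ {s : ℂ | 1 < s.re ∧ s.re < 2} := by
    constructor <;> rw [Complex.ofReal_re] <;> norm_num
  refine ha.eqOn_of_preconnected_of_eventuallyEq ha' (isPreconnected_re_strip _ _)
    (z₀ := ((3 / 2 : ℝ) : ℂ)) ⟨by linarith [hz.1], hz.2⟩ ?_ ⟨?_, h2⟩
  · filter_upwards [(isOpen_re_strip 1 2).mem_nhds hz] with w hw
    rw [mellinNumerator_eq hF h hw.1 hw.2, mellinNumerator_eq hF h' hw.1 hw.2]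
  · rcases min_choice (N : ℝ) N' with h | h <;> rw [h] <;> assumption

/-- `E` continues `T`, is holomorphic outside `1`, and is given to the left of the half-plane of
convergence by the expansion of `F`. -/
structure IsExpansionContinuation (T : ℂ → ℂ) (F : ℝ → ℂ) (E : ℂ → ℂ) : Prop where
  eq : ∀ s : ℂ, 1 < s.re → E s = T s
  analyticAt : ∀ s : ℂ, s ≠ 1 → AnalyticAt ℂ E s
  meromorphicAt : MeromorphicAt E 1
  formula : ∀ (N : ℕ) (d : ℕ → ℂ), HasInvExpansion F N d → ∀ s : ℂ, s ≠ 1 → 1 - (N : ℝ) < s.re →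
    s.re < 2 → E s = mellinNumerator F N d s / (Real.pi * (1 - s))

theorem exists_isExpansionContinuation {T : ℂ → ℂ} (hT : DifferentiableOn ℂ T {s | 1 < s.re})
    (hF : ContinuousOn F (Ici 0)) (hexp : ∀ N, ∃ d, HasInvExpansion F N d)
    (hTF : ∀ s : ℂ, 1 < s.re → s.re < 2 → T s = Complex.sin (Real.pi * s) / (Real.pi * (1 - s)) *
      ∫ y in Ioi (0 : ℝ), (y : ℂ) ^ (1 - s) * F y) :
    ∃ E, IsExpansionContinuation T F E := by
  classical
  choose d hd using hexp
  -- The added 1 makes the inequality 1 - N < Re s strict.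
  set n : ℂ → ℕ := fun s => ⌈1 - s.re⌉₊ + 1 with hn
  have hns : ∀ s, 1 - (n s : ℝ) < s.re := by
    intro s
    have := Nat.le_ceil (1 - s.re)
    simp only [hn]
    push_cast
    linarith
  -- At s = 1 the division by zero gives 0; this value is immaterial, since only a punctured
  -- neighbourhood of 1 matters.
  set E : ℂ → ℂ := fun s => if 1 < s.re then T s else
    mellinNumerator F (n s) (d (n s)) s / (Real.pi * (1 - s)) with hE
  have hformula : ∀ (N : ℕ) (d : ℕ → ℂ), HasInvExpansion F N d → ∀ s : ℂ, s ≠ 1 →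
      1 - (N : ℝ) < s.re → s.re < 2 → E s = mellinNumerator F N d s / (Real.pi * (1 - s)) := by
    intro N d' hd' s hs h1 h2
    simp only [hE]
    split_ifs with h
    · rw [hTF s h h2, mellinNumerator_eq hF hd' h h2, mellin]
      simp only [show (2 - s - 1 : ℂ) = 1 - s by ring, smul_eq_mul]
      ring
    · rw [mellinNumerator_unique hF (hd (n s)) hd' (hns s) h1 h2]
  have hpi : (Real.pi : ℂ) ≠ 0 := by exact_mod_cast Real.pi_ne_zero
  have hanum : ∀ s : ℂ, s.re < 2 → AnalyticAt ℂ (mellinNumerator F (n s) (d (n s))) s := by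
    intro s hs
    refine DifferentiableOn.analyticAt (s := {w : ℂ | 1 - (n s : ℝ) < w.re ∧ w.re < 2})
      (fun w hw => ?_) ((isOpen_re_strip _ _).mem_nhds ⟨hns s, hs⟩)
    exact (differentiableAt_mellinNumerator hF (hd (n s)) hw.1 hw.2).differentiableWithinAt
  have hloc : ∀ s : ℂ, s.re < 2 → ∀ᶠ w in 𝓝 s, w ≠ 1 →
      E w = mellinNumerator F (n s) (d (n s)) w / (Real.pi * (1 - w)) := by
    intro s hs
    filter_upwards [(isOpen_re_strip (1 - (n s : ℝ)) 2).mem_nhds ⟨hns s, hs⟩] with w hw hw1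
    exact hformula _ _ (hd (n s)) w hw1 hw.1 hw.2
  refine ⟨E, fun s hs => if_pos hs, fun s hs => ?_, ?_, hformula⟩
  · by_cases h : 1 < s.re
    · refine (hT.analyticAt ((isOpen_re_gt 1).mem_nhds h)).congr ?_
      filter_upwards [(isOpen_re_gt 1).mem_nhds h] with w hw
      exact (if_pos hw).symm
    · push Not at h
      have h2 : s.re < 2 := by linarith
      refine ((hanum s h2).fun_div (analyticAt_const.mul (analyticAt_const.sub analyticAt_id))
        (mul_ne_zero hpi (sub_ne_zero.2 (Ne.symm hs)))).congr ?_
      filter_upwards [hloc s h2, isOpen_ne.mem_nhds hs] with w hw hw1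
      exact (hw hw1).symm
  · have h2 : (1 : ℂ).re < 2 := by norm_num
    have hmer : MeromorphicAt
        (fun w => mellinNumerator F (n 1) (d (n 1)) w / (Real.pi * (1 - w))) 1 :=
      (hanum 1 h2).meromorphicAt.div
        (analyticAt_const.mul (analyticAt_const.sub analyticAt_id)).meromorphicAt
    refine hmer.congr ?_
    filter_upwards [eventually_nhdsWithin_of_eventually_nhds (hloc 1 h2),
      self_mem_nhdsWithin] with w hw hw1
    exact (hw hw1).symm

end Continuation

/-! ### Values at negative odd integers and the finite part at 1 -/

section ContinuationValues

open MeasureTheory Set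

variable {T : ℂ → ℂ} {F : ℝ → ℂ} {E : ℂ → ℂ}

/-- The sine vanishes at 1 - 2m, so only the term with 2 - n = 1 - 2m survives. It contributes π
cos(π(1 - 2m)) d_{2m+1} = -π d_{2m+1}, to be divided by 2πm. -/
theorem IsExpansionContinuation.apply_one_sub_two_mul (hE : IsExpansionContinuation T F E)
    {m : ℕ} (hm : 1 ≤ m) {d : ℕ → ℂ} (hd : HasInvExpansion F (2 * m + 1) d) :
    E (1 - 2 * m) = -d (2 * m + 1) / (2 * m) := by
  have hm0 : (m : ℂ) ≠ 0 := by exact_mod_cast (by omega : m ≠ 0)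
  have hmr : (1 : ℝ) ≤ m := by exact_mod_cast hm
  have hpi : (Real.pi : ℂ) ≠ 0 := by exact_mod_cast Real.pi_ne_zero
  have hcast : (1 - 2 * (m : ℂ)) = ((1 - 2 * m : ℤ) : ℂ) := by push_cast; ring
  have hre : (1 - 2 * (m : ℂ)).re = 1 - 2 * m := by simp
  rw [hE.formula _ d hd _ (by
      intro h
      have : 2 * (m : ℂ) = 0 := by linear_combination -h
      simp [hm0] at this)
    (by rw [hre]; push_cast; linarith) (by rw [hre]; linarith)]
  have hsin : Complex.sin (Real.pi * (1 - 2 * (m : ℂ))) = 0 := by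
    rw [hcast]; exact sin_pi_mul_int _
  have hcos : Complex.cos (Real.pi * (1 - 2 * (m : ℂ))) = -1 := by
    rw [show (Real.pi : ℂ) * (1 - 2 * m) = Real.pi - m * (2 * Real.pi) by ring,
      Complex.cos_sub_nat_mul_two_pi, Complex.cos_pi]
  have hsum : ∑ n ∈ Finset.Icc 1 (2 * m + 1), d n * sinSlope (2 - n) (1 - 2 * m) =
      -(Real.pi * d (2 * m + 1)) := by
    rw [Finset.sum_eq_single (2 * m + 1)]
    · have : (2 - ((2 * m + 1 : ℕ) : ℂ)) = 1 - 2 * m := by push_cast; ring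
      rw [this, sinSlope_self, hcos]
      ring
    · intro n _ hn
      have hne : (1 - 2 * (m : ℂ)) ≠ ((2 - n : ℤ) : ℂ) := by
        rw [hcast]
        intro h
        have := Int.cast_injective h
        omega
      have := sinSlope_of_ne hne
      push_cast at this
      rw [this, hsin, zero_div, mul_zero]
    · intro h
      exact absurd (Finset.mem_Icc.2 ⟨by omega, le_rfl⟩) h
  rw [mellinNumerator, hsin, zero_mul, zero_add, hsum]
  field_simp
  ring

/-- The entire function `sin (π s) / (π (1 - s))`. -/
def sinKernel (s : ℂ) : ℂ := -sinSlope 1 s / Real.pi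

theorem sinKernel_one : sinKernel 1 = 1 := by
  have hpi : (Real.pi : ℂ) ≠ 0 := by exact_mod_cast Real.pi_ne_zero
  rw [sinKernel, sinSlope_self]
  simp [hpi]

theorem sinKernel_of_ne {s : ℂ} (hs : s ≠ 1) :
    sinKernel s = Complex.sin (Real.pi * s) / (Real.pi * (1 - s)) := by
  have h1 := sinSlope_of_ne (k := 1) (s := s) (by simpa using hs)
  rw [Int.cast_one] at h1
  rw [sinKernel, h1, ← neg_div_neg_eq, neg_neg, div_div]
  congr 1
  ring

theorem differentiable_sinKernel : Differentiable ℂ sinKernel :=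
  (differentiable_sinSlope 1).neg.div_const _

theorem sinKernel_two_sub (s : ℂ) : sinKernel (2 - s) = sinKernel s := by
  by_cases hs : s = 1
  · subst hs; norm_num
  · have hs' : 2 - s ≠ 1 := fun h => hs (by linear_combination -h)
    rw [sinKernel_of_ne hs, sinKernel_of_ne hs',
      show (Real.pi : ℂ) * (2 - s) = 2 * Real.pi - Real.pi * s by ring,
      Complex.sin_two_pi_sub, show (Real.pi : ℂ) * (1 - (2 - s)) = -(Real.pi * (1 - s)) by ring,
      neg_div_neg_eq]

/-- The kernel is symmetric about 1. Having no first-order term there, it adds nothing to the finite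
part when it multiplies the pole. -/
theorem deriv_sinKernel_one : deriv sinKernel 1 = 0 := by
  have h1 : HasDerivAt (fun s => sinKernel (2 - s)) (-deriv sinKernel 1) 1 := by
    have h2 : HasDerivAt sinKernel (deriv sinKernel 1) (2 - 1) := by
      rw [show (2 - 1 : ℂ) = 1 by norm_num]
      exact (differentiable_sinKernel 1).hasDerivAt
    exact (h2.comp (1 : ℂ) ((hasDerivAt_id (1 : ℂ)).const_sub 2)).congr_deriv (by ring)
  rw [funext sinKernel_two_sub] at h1
  have := h1.unique (differentiable_sinKernel 1).hasDerivAt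
  linear_combination (-1 / 2) * this

/-- Near 1, E(s) = k(s) M(s) + d_1 k(s)/(s - 1), where k = `sinKernel` and M is the Mellin transform
of the truncated F. Since k(1) = 1 and k'(1) = 0, the finite part is M(1), the regularized integral
of F. -/
theorem IsExpansionContinuation.tendsto_sub_one (hE : IsExpansionContinuation T F E)
    (hF : ContinuousOn F (Ici 0)) {d : ℕ → ℂ} (hd : HasInvExpansion F 1 d) {l : ℂ}
    (hl : Tendsto (fun Y : ℝ => (∫ y in (0 : ℝ)..Y, F y) - d 1 * (Real.log Y : ℂ)) atTop (𝓝 l)) :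
    Tendsto (fun s => E s - d 1 / (s - 1)) (𝓝[≠] 1) (𝓝 l) := by
  have hpi : (Real.pi : ℂ) ≠ 0 := by exact_mod_cast Real.pi_ne_zero
  set H : ℝ → ℂ := fun y => F y - invTruncation 1 d y with hH
  set M : ℂ → ℂ := fun s => mellin H (2 - s) with hM
  have h1re : 1 - ((1 : ℕ) : ℝ) < (1 : ℂ).re := by norm_num
  have h2re : (1 : ℂ).re < 2 := by norm_num
  have hMc : ContinuousAt M 1 :=
    (differentiableAt_mellin_sub_invTruncation hF hd h1re h2re).continuousAt
  have hM1 : M 1 = l := by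
    have hint : IntegrableOn H (Ioi 0) := by
      have := mellinConvergent_sub_invTruncation hF hd h1re h2re
      rw [MellinConvergent] at this
      refine this.congr_fun (fun y _ => ?_) measurableSet_Ioi
      norm_num
      rfl
    have hval : M 1 = ∫ y in Ioi (0 : ℝ), H y := by
      simp only [hM, mellin]
      norm_num
    rw [hval]
    refine tendsto_nhds_unique (intervalIntegral_tendsto_integral_Ioi 0 hint tendsto_id)
      (hl.congr' ?_)
    filter_upwards [eventually_gt_atTop 1] with Y hY
    have hY0 : 0 < Y := by linarith
    have hFi : IntervalIntegrable F volume 0 Y :=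
      (hF.mono (by rw [uIcc_of_le hY0.le]; exact Icc_subset_Ici_self)).intervalIntegrable
    have hHi : IntervalIntegrable H volume 0 Y :=
      (intervalIntegrable_iff_integrableOn_Ioc_of_le hY0.le).2 (hint.mono_set Ioc_subset_Ioi_self)
    have hPi : ∫ y in (0 : ℝ)..Y, invTruncation 1 d y = d 1 * (Real.log Y : ℂ) := by
      rw [intervalIntegral.integral_of_le hY0.le]
      simp only [invTruncation]
      rw [setIntegral_indicator measurableSet_Ioi,
        show Ioc (0 : ℝ) Y ∩ Ioi 1 = Ioc 1 Y by
          rw [Ioc_inter_Ioi]; simp,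
        ← intervalIntegral.integral_of_le hY.le]
      simp only [Finset.Icc_self, Finset.sum_singleton]
      rw [intervalIntegral.integral_const_mul]
      congr 1
      have : ∫ y in (1 : ℝ)..Y, (y : ℂ) ^ (-((1 : ℕ) : ℤ)) = ∫ y in (1 : ℝ)..Y, ((y⁻¹ : ℝ) : ℂ) := by
        refine intervalIntegral.integral_congr fun y _ => ?_
        simp
      rw [this, intervalIntegral.integral_ofReal, integral_inv_of_pos one_pos hY0, div_one]
    have hsplit : ∫ y in (0 : ℝ)..Y, H y =
        (∫ y in (0 : ℝ)..Y, F y) - ∫ y in (0 : ℝ)..Y, invTruncation 1 d y := by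
      rw [← intervalIntegral.integral_sub hFi]
      have : invTruncation 1 d = fun y => F y - H y := by
        ext y; simp [hH]
      rw [this]
      exact hFi.sub hHi
    rw [id, hsplit, hPi]
  have hk : Tendsto (fun s => (sinKernel s - 1) / (s - 1)) (𝓝[≠] 1) (𝓝 0) := by
    have := (differentiable_sinKernel 1).hasDerivAt.tendsto_slope
    rw [deriv_sinKernel_one] at this
    refine this.congr fun s => ?_
    rw [slope_def_field, sinKernel_one]
  have hkM : Tendsto (fun s => sinKernel s * M s) (𝓝[≠] 1) (𝓝 l) := by
    have := ((differentiable_sinKernel 1).continuousAt.mul hMc).tendsto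
    rw [Pi.mul_apply, sinKernel_one, one_mul, hM1] at this
    exact this.mono_left nhdsWithin_le_nhds
  have hlim := hkM.add (hk.const_mul (d 1))
  rw [mul_zero, add_zero] at hlim
  refine hlim.congr' ?_
  filter_upwards [self_mem_nhdsWithin,
    nhdsWithin_le_nhds ((isOpen_re_strip (1 - ((1 : ℕ) : ℝ)) 2).mem_nhds ⟨h1re, h2re⟩)]
    with s hs hs2
  have hs1 : s ≠ 1 := hs
  have hs3 : 1 - s ≠ 0 := sub_ne_zero.2 hs1.symm
  have hs4 : s - 1 ≠ 0 := sub_ne_zero.2 hs1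
  rw [hE.formula 1 d hd s hs1 hs2.1 hs2.2, mellinNumerator]
  simp only [Finset.Icc_self, Finset.sum_singleton, Nat.cast_one]
  rw [show (2 - 1 : ℂ) = 1 by norm_num]
  have h5 : sinSlope 1 s = Complex.sin (Real.pi * s) / (s - 1) := by
    have h := sinSlope_of_ne (k := 1) (s := s) (by simpa using hs1)
    simpa using h
  rw [h5, sinKernel_of_ne hs1]
  change _ = (Complex.sin (Real.pi * s) * M s + _) / _ - _
  field_simp
  ring

end ContinuationValues

/-! ### Inverse-power expansions and the differentiated Stirling formula -/

section Asymptotics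

open Set

theorem HasInvExpansion.sub {F G : ℝ → ℂ} {N : ℕ} {d e : ℕ → ℂ} (hF : HasInvExpansion F N d)
    (hG : HasInvExpansion G N e) :
    HasInvExpansion (fun y => F y - G y) N (fun n => d n - e n) := by
  refine (IsBigO.sub hF hG).congr_left fun y => ?_
  simp only [sub_mul, Finset.sum_sub_distrib]
  ring

theorem HasInvExpansion.of_sub_isBigO {F G : ℝ → ℂ} {N : ℕ} {d : ℕ → ℂ}
    (hG : HasInvExpansion G N d)
    (h : (fun y => F y - G y) =O[atTop] fun y : ℝ => y ^ (-((N : ℤ) + 1))) :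
    HasInvExpansion F N d := by
  refine (IsBigO.add h hG).congr_left fun y => ?_
  ring

theorem tendsto_inv_ofReal_atTop : Tendsto (fun y : ℝ => ((y : ℂ))⁻¹) atTop (𝓝 0) := by
  have := (Complex.continuous_ofReal.tendsto 0).comp tendsto_inv_atTop_zero
  simpa [Function.comp_def] using this

theorem exists_hasInvExpansion_of_analyticAt {φ : ℂ → ℂ} (hφ : AnalyticAt ℂ φ 0) (h0 : φ 0 = 0)
    (N : ℕ) : ∃ d, HasInvExpansion (fun y : ℝ => φ (y : ℂ)⁻¹) N d := by
  obtain ⟨p, hp⟩ := hφ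
  refine ⟨p.coeff, ?_⟩
  have h1 := (hp.isBigO_sub_partialSum_pow (N + 1)).comp_tendsto tendsto_inv_ofReal_atTop
  refine (h1.congr' ?_ ?_)
  · filter_upwards with y
    have hc0 : p.coeff 0 = 0 := by
      have := hp.coeff_zero (fun _ => 0)
      rw [h0] at this
      rw [FormalMultilinearSeries.coeff]
      convert this
    simp only [Function.comp, zero_add, FormalMultilinearSeries.partialSum]
    congr 1
    rw [Finset.sum_range_succ', ← Finset.Ico_add_one_right_eq_Icc, Finset.sum_Ico_eq_sum_range]
    simp only [FormalMultilinearSeries.apply_eq_pow_smul_coeff, smul_eq_mul, pow_zero, hc0,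
      mul_zero, add_zero]
    refine Finset.sum_congr (by simp) fun n _ => ?_
    rw [inv_pow, mul_comm, add_comm n 1, zpow_neg, zpow_natCast]
  · filter_upwards [eventually_gt_atTop 0] with y hy
    simp only [Function.comp, norm_inv, Complex.norm_real, Real.norm_of_nonneg hy.le]
    rw [zpow_neg, inv_pow]
    norm_cast

theorem hasInvExpansion_inv_sq (N : ℕ) (q : ℂ) :
    HasInvExpansion (fun y : ℝ => q / ((y : ℂ) - 1 / 2) ^ 2) N
      (fun n => q * (4 * ((n : ℂ) - 1) * (1 / 2) ^ n)) := by
  -- With w = 1/(2y), 1/(y - 1/2)² = 4w²/(1 - w)² = ∑ 4(n - 1)w^n; this is the exact remainder.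
  have hid : ∀ w : ℂ, w ≠ 1 → 4 * w ^ 2 / (1 - w) ^ 2 -
      ∑ n ∈ Finset.Icc 1 N, 4 * ((n : ℂ) - 1) * w ^ n =
      4 * w ^ (N + 1) * (N - (N - 1) * w) / (1 - w) ^ 2 := by
    intro w hw
    have hw' : (1 - w) ^ 2 ≠ 0 := pow_ne_zero 2 (sub_ne_zero.2 hw.symm)
    induction N with
    | zero => simp; ring
    | succ n ih =>
      rw [Finset.sum_Icc_succ_top (by omega), ← sub_sub, ih]
      push_cast
      field_simp
      ring
  have hw : Tendsto (fun y : ℝ => 1 / 2 * ((y : ℂ))⁻¹) atTop (𝓝 0) := by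
    simpa using tendsto_inv_ofReal_atTop.const_mul (1 / 2 : ℂ)
  have hbdd : (fun y : ℝ => q * (4 * (1 / 2) ^ (N + 1) * (N - (N - 1) * (1 / 2 * ((y : ℂ))⁻¹)) /
      (1 - 1 / 2 * ((y : ℂ))⁻¹) ^ 2)) =O[atTop] fun _ => (1 : ℝ) := by
    have hc : ContinuousAt (fun w : ℂ => q * (4 * (1 / 2) ^ (N + 1) * (N - (N - 1) * w) /
      (1 - w) ^ 2)) 0 := by
      refine continuousAt_const.mul (ContinuousAt.div (by fun_prop) (by fun_prop) (by norm_num))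
    exact (hc.tendsto.comp hw).isBigO_one ℝ
  have hpow : (fun y : ℝ => ((y : ℂ) ^ (N + 1))⁻¹) =O[atTop] fun y : ℝ => y ^ (-((N : ℤ) + 1)) := by
    refine IsBigO.of_norm_eventuallyLE ?_
    filter_upwards [eventually_gt_atTop 0] with y hy
    rw [norm_inv, norm_pow, Complex.norm_real, Real.norm_of_nonneg hy.le, zpow_neg]
    norm_cast
  refine ((hbdd.mul hpow).congr' ?_ ?_)
  · filter_upwards [eventually_gt_atTop 1] with y hy
    have hy0 : (y : ℂ) ≠ 0 := by
      have : y ≠ 0 := by linarith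
      exact_mod_cast this
    have hy1 : (y : ℂ) - 1 / 2 ≠ 0 := by
      have : y - 1 / 2 ≠ 0 := by linarith
      have h2 : ((y - 1 / 2 : ℝ) : ℂ) ≠ 0 := by exact_mod_cast this
      simpa using h2
    have hw1 : 1 / 2 * ((y : ℂ))⁻¹ ≠ 1 := by
      intro h
      field_simp at h
      apply hy1
      linear_combination -h / 2
    have h3 := hid _ hw1
    have h4 : q / ((y : ℂ) - 1 / 2) ^ 2 =
        q * (4 * (1 / 2 * ((y : ℂ))⁻¹) ^ 2 / (1 - 1 / 2 * ((y : ℂ))⁻¹) ^ 2) := by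
      have h5 : 1 - 1 / 2 * ((y : ℂ))⁻¹ = ((y : ℂ) - 1 / 2) / y := by field_simp
      rw [h5]
      field_simp
      norm_num
    have h6 : ∑ n ∈ Finset.Icc 1 N, q * (4 * ((n : ℂ) - 1) * (1 / 2) ^ n) * (y : ℂ) ^ (-(n : ℤ)) =
        q * ∑ n ∈ Finset.Icc 1 N, 4 * ((n : ℂ) - 1) * (1 / 2 * ((y : ℂ))⁻¹) ^ n := by
      rw [Finset.mul_sum]
      refine Finset.sum_congr rfl fun n _ => ?_
      rw [mul_pow, zpow_neg, zpow_natCast, inv_pow]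
      ring
    rw [h4, h6, ← mul_sub, h3, mul_pow _ _ (N + 1), inv_pow]
    ring
  · filter_upwards with y
    rw [one_mul]

theorem analyticAt_logDeriv {f : ℂ → ℂ} {z : ℂ} (hf : AnalyticAt ℂ f z) (h : f z ≠ 0) :
    AnalyticAt ℂ (logDeriv f) z := hf.deriv.div hf h

/-- By continuity g(y) - g(x) has imaginary part in (-π, π) near x, so there it is the principal
logarithm of f(y)/f(x). -/
theorem hasDerivAt_of_exp_eq {f : ℂ → ℂ} {g : ℝ → ℂ} {x : ℝ} (hf : DifferentiableAt ℂ f x)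
    (hg : ContinuousAt g x) (h : ∀ᶠ y : ℝ in 𝓝 x, Complex.exp (g y) = f y) :
    HasDerivAt g (logDeriv f x) x := by
  have hx : Complex.exp (g x) = f x := h.self_of_nhds
  have hfx : f x ≠ 0 := hx ▸ Complex.exp_ne_zero _
  have hd : HasDerivAt (fun y : ℝ => f y / f x) (deriv f x / f x) x :=
    (hf.hasDerivAt.comp_ofReal).div_const _
  have hd2 : HasDerivAt (fun y : ℝ => Complex.log (f y / f x) + g x) (logDeriv f x) x := by
    have h1 : f x / f x ∈ Complex.slitPlane := by
      rw [div_self hfx]; exact Complex.one_mem_slitPlane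
    refine ((hd.clog_real h1).add_const (g x)).congr_deriv ?_
    rw [div_self hfx, div_one, logDeriv_apply]
  refine hd2.congr_of_eventuallyEq ?_
  have hclose : ∀ᶠ y in 𝓝 x, ‖g y - g x‖ < Real.pi := by
    have : Tendsto (fun y => ‖g y - g x‖) (𝓝 x) (𝓝 0) := by
      simpa using (hg.tendsto.sub_const (g x)).norm
    exact this.eventually_lt_const Real.pi_pos
  filter_upwards [h, hclose] with y hy hyc
  have him : |(g y - g x).im| < Real.pi := (Complex.abs_im_le_norm _).trans_lt hyc
  rw [← hy, ← hx, ← Complex.exp_sub, Complex.log_exp (by linarith [(abs_lt.1 him).1])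
    (abs_lt.1 him).2.le]
  ring

theorem hasDerivAt_ofReal_zpow_neg (n : ℕ) {x : ℝ} (hx : 0 < x) :
    HasDerivAt (fun x : ℝ => (x : ℂ) ^ (-(n : ℤ))) (-(n : ℂ) * (x : ℂ) ^ (-((n + 1 : ℕ) : ℤ))) x := by
  have h := (hasDerivAt_zpow (-(n : ℤ)) (x : ℂ)
    (Or.inl (by exact_mod_cast hx.ne'))).comp_ofReal
  refine h.congr_deriv ?_
  push_cast
  congr 2
  ring

theorem hasDerivAt_ofReal_log {x : ℝ} (hx : 0 < x) :
    HasDerivAt (fun x : ℝ => (Real.log x : ℂ)) ((x : ℂ) ^ (-((1 : ℕ) : ℤ))) x := by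
  have := (Real.hasDerivAt_log hx.ne').ofReal_comp
  refine this.congr_deriv ?_
  simp

theorem hasDerivAt_stirling_sum (c : ℕ → ℂ) (k N : ℕ) {x : ℝ} (hx : 0 < x) :
    HasDerivAt (fun x : ℝ => ∑ n ∈ Finset.Icc 1 N, c n * (x : ℂ) ^ (-((n + k : ℕ) : ℤ)))
      (∑ n ∈ Finset.Icc 1 N, (-((n + k : ℕ) : ℂ) * c n) * (x : ℂ) ^ (-((n + (k + 1) : ℕ) : ℤ)))
      x := by
  refine HasDerivAt.fun_sum fun n _ => ?_
  refine ((hasDerivAt_ofReal_zpow_neg (n + k) hx).const_mul (c n)).congr_deriv ?_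
  rw [add_assoc]
  ring

theorem stirling_logDeriv {G : ℂ → ℂ} (hGd : Differentiable ℂ G) {a₁ b₁ a₀ b₀ : ℂ} {a : ℕ → ℂ}
    (hG : HasStirlingExpansion G a₁ b₁ a₀ b₀ a) :
    (fun x : ℝ => -logDeriv G x - (a₁ * (Real.log x : ℂ) + b₁ + a₀ * (x : ℂ) ^ (-((1 : ℕ) : ℤ))))
      =O[atTop] (fun x : ℝ => x ^ (-(2 : ℤ))) ∧
    ∀ N : ℕ, (fun x : ℝ => -deriv (logDeriv G) x -
      (a₁ * (x : ℂ) ^ (-((1 : ℕ) : ℤ)) - a₀ * (x : ℂ) ^ (-((2 : ℕ) : ℤ)) +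
        ∑ n ∈ Finset.Icc 1 N, (((n : ℂ) + 1) * n * a n) * (x : ℂ) ^ (-((n + 2 : ℕ) : ℤ))))
      =O[atTop] fun x : ℝ => x ^ (-((N : ℤ) + 3)) := by
  obtain ⟨logG, hc, hexp, hO⟩ := hG
  have hGne : ∀ x : ℝ, 0 < x → G x ≠ 0 := fun x hx => hexp x hx ▸ Complex.exp_ne_zero _
  have hlog : ∀ x : ℝ, 0 < x → HasDerivAt logG (logDeriv G x) x := fun x hx =>
    hasDerivAt_of_exp_eq (hGd x) (hc.continuousAt (Ioi_mem_nhds hx))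
      ((eventually_gt_nhds hx).mono fun y hy => hexp y hy)
  have hld : ∀ x : ℝ, 0 < x →
      HasDerivAt (fun x : ℝ => logDeriv G x) (deriv (logDeriv G) x) x := fun x hx =>
    (analyticAt_logDeriv (hGd.analyticAt x)
      (hGne x hx)).differentiableAt.hasDerivAt.comp_ofReal
  have h1 : ∀ N : ℕ, ∀ x : ℝ, 0 < x → HasDerivAt (fun x : ℝ => -logG x -
      (a₁ * x * ((Real.log x : ℂ) - 1) + b₁ * x + a₀ * (Real.log x : ℂ) + b₀ +
        ∑ n ∈ Finset.Icc 1 N, a n * (x : ℂ) ^ (-(n : ℤ))))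
      (-logDeriv G x - (a₁ * (Real.log x : ℂ) + b₁ + a₀ * (x : ℂ) ^ (-((1 : ℕ) : ℤ)) +
        ∑ n ∈ Finset.Icc 1 N, (-(n : ℂ) * a n) * (x : ℂ) ^ (-((n + 1 : ℕ) : ℤ)))) x := by
    intro N x hx
    have hid : HasDerivAt (fun x : ℝ => (x : ℂ)) 1 x := Complex.ofRealCLM.hasDerivAt
    have hS := hasDerivAt_stirling_sum a 0 N hx
    simp only [add_zero, zero_add] at hS
    have hL := hasDerivAt_ofReal_log hx
    refine ((hlog x hx).neg.sub ((((((hid.const_mul a₁).mul (hL.sub_const 1)).add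
      (hid.const_mul b₁)).add (hL.const_mul a₀)).add_const b₀).add hS)).congr_deriv ?_
    have hx0 : (x : ℂ) ≠ 0 := by exact_mod_cast hx.ne'
    simp only [Nat.cast_one, zpow_neg_one]
    field_simp
    ring
  have h2 : ∀ N : ℕ, ∀ x : ℝ, 0 < x → HasDerivAt (fun x : ℝ =>
      -logDeriv G x - (a₁ * (Real.log x : ℂ) + b₁ + a₀ * (x : ℂ) ^ (-((1 : ℕ) : ℤ)) +
        ∑ n ∈ Finset.Icc 1 N, (-(n : ℂ) * a n) * (x : ℂ) ^ (-((n + 1 : ℕ) : ℤ))))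
      (-deriv (logDeriv G) x -
      (a₁ * (x : ℂ) ^ (-((1 : ℕ) : ℤ)) - a₀ * (x : ℂ) ^ (-((2 : ℕ) : ℤ)) +
        ∑ n ∈ Finset.Icc 1 N, (((n : ℂ) + 1) * n * a n) * (x : ℂ) ^ (-((n + 2 : ℕ) : ℤ)))) x := by
    intro N x hx
    have hS := hasDerivAt_stirling_sum (fun n => -(n : ℂ) * a n) 1 N hx
    refine ((hld x hx).neg.sub (((((hasDerivAt_ofReal_log hx).const_mul a₁).add_const b₁).add
      ((hasDerivAt_ofReal_zpow_neg 1 hx).const_mul a₀)).add hS)).congr_deriv ?_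
    have hsum : ∑ n ∈ Finset.Icc 1 N,
        (-((n + 1 : ℕ) : ℂ) * (-(n : ℂ) * a n)) * (x : ℂ) ^ (-((n + (1 + 1) : ℕ) : ℤ)) =
        ∑ n ∈ Finset.Icc 1 N, (((n : ℂ) + 1) * n * a n) * (x : ℂ) ^ (-((n + 2 : ℕ) : ℤ)) := by
      refine Finset.sum_congr rfl fun n _ => ?_
      push_cast
      ring
    rw [hsum]
    push_cast
    ring
  constructor
  -- Order 0 with one derivative already leaves O(x^(-2)), enough for the constant b₁.
  · refine (hO 0 1).congr' ?_ ?_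
    · filter_upwards [eventually_gt_atTop 0] with x hx
      rw [iteratedDeriv_one, (h1 0 x hx).deriv]
      simp
    · filter_upwards with x
      norm_num
  · intro N
    refine (hO N 2).congr' ?_ ?_
    · filter_upwards [eventually_gt_atTop 0] with x hx
      rw [iteratedDeriv_succ, iteratedDeriv_one, ← (h2 N x hx).deriv]
      refine Filter.EventuallyEq.deriv_eq ?_
      filter_upwards [eventually_gt_nhds hx] with y hy
      exact (h1 N y hy).deriv
    · filter_upwards with x
      norm_num [add_assoc]

end Asymptotics

/-! ### Expansions and continuations for the trivial and nontrivial zeros -/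

section PrimaryFunctions

open Set MeasureTheory

theorem isBigO_shift {f : ℝ → ℂ} {k : ℕ}
    (h : f =O[atTop] fun x : ℝ => x ^ (-(k : ℤ))) :
    (fun y : ℝ => f (1 / 2 + y)) =O[atTop] fun y : ℝ => y ^ (-(k : ℤ)) := by
  have h1 := h.comp_tendsto (tendsto_atTop_add_const_left atTop (1 / 2 : ℝ) tendsto_id)
  refine h1.trans (IsBigO.of_norm_eventuallyLE ?_)
  filter_upwards [eventually_gt_atTop 0] with y hy
  simp only [Function.comp, id, zpow_neg, zpow_natCast]
  rw [Real.norm_of_nonneg (by positivity)]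
  gcongr
  linarith

theorem isBigO_zpow_neg_of_le {m n : ℤ} (h : m ≤ n) :
    (fun y : ℝ => y ^ (-n)) =O[atTop] fun y : ℝ => y ^ (-m) := by
  refine IsBigO.of_norm_eventuallyLE ?_
  filter_upwards [eventually_ge_atTop 1] with y hy
  have : 0 < y := by linarith
  rw [Real.norm_of_nonneg (by positivity)]
  exact zpow_le_zpow_right₀ hy (neg_le_neg h)

theorem half_add_ofReal (y : ℝ) : ((1 / 2 + y : ℝ) : ℂ) = 1 / 2 + (y : ℂ) := by
  push_cast; ring

variable {L G Ξ : ℂ → ℂ} {q : ℕ} {a₁ b₁ a₀ b₀ : ℂ} {a : ℕ → ℂ}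

/-- Recentring from x to x = 1/2 + y: 1/x = v(1/y) with v(u) = u/(1 + u/2), and a polynomial in v is
analytic at u = 0. The coefficients need not be known, because they cancel later. -/
theorem exists_hasInvExpansion_of_stirling (hGd : Differentiable ℂ G)
    (hG : HasStirlingExpansion G a₁ b₁ a₀ b₀ a) (N : ℕ) :
    ∃ d, HasInvExpansion (fun y : ℝ => -deriv (logDeriv G) (1 / 2 + y)) N d := by
  set v : ℂ → ℂ := fun u => u / (1 + u / 2) with hv
  have hva : AnalyticAt ℂ v 0 := analyticAt_id.div
    (analyticAt_const.add (analyticAt_id.div analyticAt_const (by norm_num))) (by simp)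
  set φ : ℂ → ℂ := fun u => a₁ * v u - a₀ * v u ^ 2 +
    ∑ n ∈ Finset.Icc 1 N, (((n : ℂ) + 1) * n * a n) * v u ^ (n + 2) with hφ
  have hφa : AnalyticAt ℂ φ 0 := ((analyticAt_const.mul hva).sub
    (analyticAt_const.mul (hva.pow 2))).add
    (Finset.analyticAt_fun_sum _ fun n _ => analyticAt_const.mul (hva.pow (n + 2)))
  obtain ⟨d, hd⟩ := exists_hasInvExpansion_of_analyticAt hφa (by simp [hφ, hv]) N
  refine ⟨d, hd.of_sub_isBigO ?_⟩
  have h1 := (stirling_logDeriv hGd hG).2 N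
  have h2 := (isBigO_shift (k := N + 3)
    (h1.congr_right fun x => by rw [Nat.cast_add, Nat.cast_ofNat])).trans
    (isBigO_zpow_neg_of_le (m := (N : ℤ) + 1) (by push_cast; omega))
  refine h2.congr' ?_ EventuallyEq.rfl
  filter_upwards [eventually_gt_atTop 0] with y hy
  have hy0 : (y : ℂ) ≠ 0 := by exact_mod_cast hy.ne'
  have hvy : v (y : ℂ)⁻¹ = (1 / 2 + (y : ℂ))⁻¹ := by
    have h3 : (1 / 2 + (y : ℂ)) ≠ 0 := by
      rw [← half_add_ofReal]
      exact_mod_cast (by positivity : (1 / 2 + y) ≠ 0)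
    have h4 : 1 + (y : ℂ)⁻¹ / 2 = (1 / 2 + y) / y := by
      field_simp
      ring
    simp only [hv]
    rw [h4]
    field_simp
  simp only [hφ, hvy, half_add_ofReal, zpow_neg, zpow_natCast, pow_one, inv_pow]

/-- The one coefficient that is needed explicitly: the shift by 1/2 alters a₁/x only by O(y^(-2)).
Only index 1 of the constant sequence is used. -/
theorem hasInvExpansion_one_of_stirling (hGd : Differentiable ℂ G)
    (hG : HasStirlingExpansion G a₁ b₁ a₀ b₀ a) :
    HasInvExpansion (fun y : ℝ => -deriv (logDeriv G) (1 / 2 + y)) 1 fun _ => a₁ := by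
  have h1 := (stirling_logDeriv hGd hG).2 0
  have h2 := (isBigO_shift (k := 3) (by simpa using h1)).trans
    (isBigO_zpow_neg_of_le (m := ((1 : ℕ) : ℤ) + 1) (by norm_num))
  have h3 : (fun y : ℝ => a₀ * ((1 / 2 + y : ℝ) : ℂ) ^ (-2 : ℤ)) =O[atTop]
      fun y : ℝ => y ^ (-(((1 : ℕ) : ℤ) + 1)) := by
    refine (IsBigO.const_mul_left ?_ a₀)
    have h4 : (fun x : ℝ => (x : ℂ) ^ (-2 : ℤ)) =O[atTop] fun x : ℝ => x ^ (-((2 : ℕ) : ℤ)) := by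
      refine IsBigO.of_norm_eventuallyLE ?_
      filter_upwards [eventually_gt_atTop 0] with x hx
      rw [norm_zpow, Complex.norm_real, Real.norm_of_nonneg hx.le]
      norm_num
    simpa using isBigO_shift h4
  have h5 : (fun y : ℝ => a₁ * (((1 / 2 + y : ℝ) : ℂ)⁻¹ - (y : ℂ)⁻¹)) =O[atTop]
      fun y : ℝ => y ^ (-(((1 : ℕ) : ℤ) + 1)) := by
    refine (IsBigO.const_mul_left ?_ a₁)
    refine IsBigO.of_norm_eventuallyLE ?_
    filter_upwards [eventually_gt_atTop 0] with y hy
    rw [← Complex.ofReal_inv, ← Complex.ofReal_inv, ← Complex.ofReal_sub, Complex.norm_real]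
    have : (1 / 2 + y)⁻¹ - y⁻¹ = -((1 / 2) / ((1 / 2 + y) * y)) := by
      field_simp
      ring
    rw [this, norm_neg, Real.norm_of_nonneg (by positivity)]
    have h6 : y ^ (-(((1 : ℕ) : ℤ) + 1)) = 1 / (y * y) := by
      rw [zpow_neg, one_div]
      norm_cast
      rw [sq]
    rw [h6]
    gcongr
    · norm_num
    · linarith
  refine ((h2.sub h3).add h5).congr_left fun y => ?_
  simp only [Finset.Icc_self, Finset.sum_singleton, half_add_ofReal, Nat.cast_one, zpow_neg_one]
  simp
  ring

theorem continuousOn_neg_deriv_logDeriv {f : ℂ → ℂ} (hf : IsZetaAdmissible f (1 / 2)) :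
    ContinuousOn (fun y : ℝ => -deriv (logDeriv f) (1 / 2 + y)) (Ici 0) := by
  intro y hy
  have ha : AnalyticAt ℂ (logDeriv f) (1 / 2 + y) :=
    analyticAt_logDeriv (hf.differentiable.analyticAt _) (hf.ne_zero hy)
  refine (ContinuousAt.neg ?_).continuousWithinAt
  exact ContinuousAt.comp (f := fun y : ℝ => (1 / 2 + y : ℂ)) ha.deriv.continuousAt (by fun_prop)

theorem ne_one_of_one_lt_re {z : ℂ} (hz : 1 < z.re) : z ≠ 1 := by
  rintro rfl
  simp at hz

namespace IsPrimaryFunction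

theorem Xi_admissible (hL : IsPrimaryFunction L q G Ξ) : IsZetaAdmissible Ξ (1 / 2) where
  differentiable := hL.Xi_entire
  growth _ hA := exists_growth_bound hL.Xi_entire hL.Xi_order _ (by norm_num) hA
  mem_slitPlane ρ hρ := by
    right
    simpa using (hL.Xi_zeros ρ hρ).2.2
  le_re ρ hρ := by
    have := (hL.Xi_zeros ρ hρ).2.1
    simp
    linarith

theorem G_admissible (hL : IsPrimaryFunction L q G Ξ) : IsZetaAdmissible G (1 / 2) where
  differentiable := hL.G_entire
  growth _ hA := exists_growth_bound hL.G_entire hL.G_order _ (by norm_num) hA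
  mem_slitPlane ρ hρ := by
    left
    have := hL.G_zeros ρ hρ
    simp
    linarith
  le_re ρ hρ := by
    have := hL.G_zeros ρ hρ
    simp
    linarith

theorem analyticAt_of_ne (hL : IsPrimaryFunction L q G Ξ) {z : ℂ} (hz : z ≠ 1) : AnalyticAt ℂ L z :=
  hL.differentiableOn.analyticAt (isOpen_compl_singleton.mem_nhds hz)

theorem tendsto_one (hL : IsPrimaryFunction L q G Ξ) : Tendsto (fun x : ℝ => L x) atTop (𝓝 1) := by
  have h1 : Tendsto (fun x : ℝ => Complex.log (L x)) atTop (𝓝 0) := by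
    have h2 := (hL.log_isBigO 0 1).trans_tendsto (g'' := fun x : ℝ => x ^ (-((1 : ℕ) : ℤ)))
      (by simpa using tendsto_inv_atTop_zero)
    simpa using h2
  have h3 := (Complex.continuous_exp.tendsto 0).comp h1
  rw [Complex.exp_zero] at h3
  refine h3.congr' ?_
  filter_upwards [eventually_gt_atTop 1] with x hx
  exact Complex.exp_log (hL.ne_zero x (by simpa using hx))

/-- Since L tends to 1 it eventually lies in the slit plane, where the principal logarithm is
holomorphic. -/
theorem hasDerivAt_log (hL : IsPrimaryFunction L q G Ξ) : ∀ᶠ x : ℝ in atTop,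
    HasDerivAt (fun x : ℝ => Complex.log (L x)) (logDeriv L x) x := by
  have h1 : ∀ᶠ x : ℝ in atTop, L x ∈ Complex.slitPlane :=
    hL.tendsto_one.eventually (Complex.isOpen_slitPlane.mem_nhds Complex.one_mem_slitPlane)
  filter_upwards [h1, eventually_gt_atTop 1] with x hx hx1
  have hd : DifferentiableAt ℂ L x :=
    (hL.analyticAt_of_ne (ne_one_of_one_lt_re (by simpa using hx1))).differentiableAt
  exact hd.hasDerivAt.comp_ofReal.clog_real hx

theorem logDeriv_isBigO (hL : IsPrimaryFunction L q G Ξ) (N : ℕ) :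
    (fun x : ℝ => logDeriv L x) =O[atTop] fun x : ℝ => x ^ (-(N : ℤ)) := by
  refine (hL.log_isBigO 1 N).congr' ?_ EventuallyEq.rfl
  filter_upwards [hL.hasDerivAt_log] with x hx
  rw [iteratedDeriv_one, hx.deriv]

theorem deriv_logDeriv_isBigO (hL : IsPrimaryFunction L q G Ξ) (N : ℕ) :
    (fun x : ℝ => deriv (logDeriv L) x) =O[atTop] fun x : ℝ => x ^ (-(N : ℤ)) := by
  refine (hL.log_isBigO 2 N).congr' ?_ EventuallyEq.rfl
  obtain ⟨K, hK⟩ := eventually_atTop.1 hL.hasDerivAt_log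
  filter_upwards [eventually_gt_atTop K, eventually_gt_atTop 1] with x hx hx1
  have h1 : deriv (fun x : ℝ => Complex.log (L x)) =ᶠ[𝓝 x] fun x : ℝ => logDeriv L x := by
    filter_upwards [eventually_gt_nhds hx] with y hy
    exact (hK y hy.le).deriv
  rw [iteratedDeriv_succ, iteratedDeriv_one, h1.deriv_eq]
  have hre : 1 < (x : ℂ).re := by simpa using hx1
  have ha := analyticAt_logDeriv (hL.analyticAt_of_ne (ne_one_of_one_lt_re hre))
    (hL.ne_zero x hre)
  exact ha.differentiableAt.hasDerivAt.comp_ofReal.deriv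

theorem logDeriv_Xi_add (hL : IsPrimaryFunction L q G Ξ) {z : ℂ} (hz : 1 < z.re) :
    logDeriv Ξ z + logDeriv G z = q / (z - 1) + logDeriv L z := by
  have hz1 := ne_one_of_one_lt_re hz
  have hz1' : z - 1 ≠ 0 := sub_ne_zero.2 hz1
  have hΞ : Ξ z ≠ 0 := fun h => by linarith [(hL.Xi_zeros z h).2.1]
  have hG : G z ≠ 0 := fun h => by linarith [hL.G_zeros z h]
  rw [← logDeriv_mul z hΞ hG (hL.Xi_entire z) (hL.G_entire z)]
  have he : (fun z => Ξ z * G z) =ᶠ[𝓝 z] fun z => (z - 1) ^ q * L z := by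
    filter_upwards [isOpen_ne.mem_nhds hz1] with w hw using hL.factorization w hw
  have h1 : logDeriv (fun z => Ξ z * G z) z = logDeriv (fun z => (z - 1) ^ q * L z) z := by
    rw [logDeriv_apply, logDeriv_apply, he.deriv_eq, hL.factorization z hz1]
  rw [h1, logDeriv_mul (f := fun z => (z - 1) ^ q) z (pow_ne_zero _ hz1')
    (hL.ne_zero z hz) (by fun_prop)
    (hL.analyticAt_of_ne hz1).differentiableAt, logDeriv_fun_pow (by fun_prop), logDeriv_apply]
  congr 1
  have : deriv (fun z : ℂ => z - 1) z = 1 := ((hasDerivAt_id z).sub_const 1).deriv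
  rw [this]
  ring

theorem deriv_logDeriv_Xi_add (hL : IsPrimaryFunction L q G Ξ) {z : ℂ} (hz : 1 < z.re) :
    deriv (logDeriv Ξ) z + deriv (logDeriv G) z = -(q / (z - 1) ^ 2) + deriv (logDeriv L) z := by
  have hz1 := ne_one_of_one_lt_re hz
  have hz1' : z - 1 ≠ 0 := sub_ne_zero.2 hz1
  have hΞ : Ξ z ≠ 0 := fun h => by linarith [(hL.Xi_zeros z h).2.1]
  have hG : G z ≠ 0 := fun h => by linarith [hL.G_zeros z h]
  have d1 := (analyticAt_logDeriv (hL.Xi_entire.analyticAt z) hΞ).differentiableAt.hasDerivAt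
  have d2 := (analyticAt_logDeriv (hL.G_entire.analyticAt z) hG).differentiableAt.hasDerivAt
  have d3 := (analyticAt_logDeriv (hL.analyticAt_of_ne hz1)
    (hL.ne_zero z hz)).differentiableAt.hasDerivAt
  have d4 : HasDerivAt (fun z : ℂ => (q : ℂ) / (z - 1)) (-(q / (z - 1) ^ 2)) z := by
    refine ((hasDerivAt_const z (q : ℂ)).fun_div ((hasDerivAt_id z).sub_const 1)
      hz1').congr_deriv ?_
    simp [neg_div]
  refine ((d1.add d2).congr_of_eventuallyEq ?_).unique (d4.add d3)
  filter_upwards [(isOpen_re_gt 1).mem_nhds hz] with w hw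
  exact (hL.logDeriv_Xi_add hw).symm

theorem hasInvExpansion_add (hL : IsPrimaryFunction L q G Ξ) (N : ℕ) :
    HasInvExpansion (fun y : ℝ => -deriv (logDeriv Ξ) (1 / 2 + y) + -deriv (logDeriv G) (1 / 2 + y))
      N (fun n => q * (4 * ((n : ℂ) - 1) * (1 / 2) ^ n)) := by
  refine (hasInvExpansion_inv_sq N q).of_sub_isBigO ?_
  refine ((isBigO_shift (hL.deriv_logDeriv_isBigO (N + 1))).neg_left).congr' ?_ ?_
  · filter_upwards [eventually_gt_atTop 1] with y hy
    rw [half_add_ofReal]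
    have hre : 1 < (1 / 2 + (y : ℂ)).re := by
      rw [← half_add_ofReal, Complex.ofReal_re]; linarith
    have h := hL.deriv_logDeriv_Xi_add hre
    rw [show (1 / 2 + (y : ℂ)) - 1 = y - 1 / 2 by ring] at h
    linear_combination h
  · filter_upwards with y
    push_cast
    rfl

/-- The factorization transfers the expansion from `G` to `Ξ`, since (log L)'' decays faster than
any power. -/
theorem hasInvExpansion_Xi (hL : IsPrimaryFunction L q G Ξ) {N : ℕ} {d : ℕ → ℂ}
    (hd : HasInvExpansion (fun y : ℝ => -deriv (logDeriv G) (1 / 2 + y)) N d) :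
    HasInvExpansion (fun y : ℝ => -deriv (logDeriv Ξ) (1 / 2 + y)) N
      (fun n => q * (4 * ((n : ℂ) - 1) * (1 / 2) ^ n) - d n) := by
  have := (hL.hasInvExpansion_add N).sub hd
  simpa using this

theorem logDeriv_Xi_half (hL : IsPrimaryFunction L q G Ξ) : logDeriv Ξ (1 / 2) = 0 := by
  have h1 : HasDerivAt (fun z => Ξ (1 - z)) (-deriv Ξ (1 / 2)) (1 / 2) := by
    have h2 : HasDerivAt Ξ (deriv Ξ (1 / 2)) (1 - 1 / 2) := by
      rw [show (1 - 1 / 2 : ℂ) = 1 / 2 by norm_num]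
      exact (hL.Xi_entire _).hasDerivAt
    exact (h2.comp (1 / 2 : ℂ) ((hasDerivAt_id (1 / 2 : ℂ)).const_sub 1)).congr_deriv (by ring)
  rw [← funext hL.functional_equation] at h1
  have h3 := h1.unique (hL.Xi_entire _).hasDerivAt
  have h4 : deriv Ξ (1 / 2) = 0 := by linear_combination (-1 / 2) * h3
  rw [logDeriv_apply, h4, zero_div]

theorem integral_neg_deriv_logDeriv_Xi (hL : IsPrimaryFunction L q G Ξ) {Y : ℝ} (hY : 0 ≤ Y) :
    ∫ y in (0 : ℝ)..Y, -deriv (logDeriv Ξ) (1 / 2 + y) = -logDeriv Ξ (1 / 2 + Y) := by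
  have hA := hL.Xi_admissible
  have hd : ∀ y ∈ uIcc 0 Y, HasDerivAt (fun y : ℝ => -logDeriv Ξ (1 / 2 + y))
      (-deriv (logDeriv Ξ) (1 / 2 + y)) y := by
    intro y hy
    rw [uIcc_of_le hY] at hy
    have ha : AnalyticAt ℂ (logDeriv Ξ) (1 / 2 + y) :=
      analyticAt_logDeriv (hL.Xi_entire.analyticAt _) (hA.ne_zero hy.1)
    have h1 := ha.differentiableAt.hasDerivAt.comp (y : ℂ)
      ((hasDerivAt_id (y : ℂ)).const_add (1 / 2))
    rw [mul_one] at h1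
    exact h1.comp_ofReal.neg
  rw [intervalIntegral.integral_eq_sub_of_hasDerivAt hd
    ((continuousOn_neg_deriv_logDeriv hA).mono (by
      rw [uIcc_of_le hY]; exact Icc_subset_Ici_self)).intervalIntegrable]
  simp only [Complex.ofReal_zero, add_zero, hL.logDeriv_Xi_half]
  ring

/-- The integral equals -(log Ξ)'(1/2 + Y), since its boundary term at 1/2 vanishes. The
factorization turns this into (log G)' plus vanishing terms, and Stirling gives -a₁ log Y - b₁ +
o(1). -/
theorem tendsto_finitePart (hL : IsPrimaryFunction L q G Ξ)
    (hG : HasStirlingExpansion G a₁ b₁ a₀ b₀ a) :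
    Tendsto (fun Y : ℝ => (∫ y in (0 : ℝ)..Y, -deriv (logDeriv Ξ) (1 / 2 + y)) -
      -a₁ * (Real.log Y : ℂ)) atTop (𝓝 (-b₁)) := by
  have hshift : Tendsto (fun Y : ℝ => 1 / 2 + Y) atTop atTop :=
    tendsto_atTop_add_const_left atTop (1 / 2 : ℝ) tendsto_id
  have hinv : Tendsto (fun x : ℝ => ((x : ℂ))⁻¹) atTop (𝓝 0) := tendsto_inv_ofReal_atTop
  have hG0 : Tendsto (fun x : ℝ => -logDeriv G x - (a₁ * (Real.log x : ℂ) + b₁ +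
      a₀ * (x : ℂ) ^ (-((1 : ℕ) : ℤ)))) atTop (𝓝 0) := by
    refine (stirling_logDeriv hL.G_entire hG).1.trans_tendsto ?_
    exact tendsto_zpow_atTop_zero (by norm_num)
  have hL0 : Tendsto (fun x : ℝ => logDeriv L x) atTop (𝓝 0) :=
    (hL.logDeriv_isBigO 1).trans_tendsto (tendsto_zpow_atTop_zero (by norm_num))
  have hq0 : Tendsto (fun x : ℝ => (q : ℂ) / ((x : ℂ) - 1)) atTop (𝓝 0) := by
    have h1 := (tendsto_inv_ofReal_atTop.comp
      (tendsto_atTop_add_const_right atTop (-1 : ℝ) tendsto_id)).const_mul (q : ℂ)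
    rw [mul_zero] at h1
    refine h1.congr fun x => ?_
    simp [div_eq_mul_inv, sub_eq_add_neg]
  have hlog : Tendsto (fun Y : ℝ => a₁ * ((Real.log Y - Real.log (1 / 2 + Y) : ℝ) : ℂ))
      atTop (𝓝 0) := by
    have h1 : Tendsto (fun Y : ℝ => 1 + 1 / 2 * Y⁻¹) atTop (𝓝 1) := by
      simpa using (tendsto_inv_atTop_zero.const_mul (1 / 2 : ℝ)).const_add 1
    have h2 := (Real.continuousAt_log one_ne_zero).tendsto.comp h1
    rw [Real.log_one] at h2
    have h3 := ((Complex.continuous_ofReal.tendsto 0).comp h2).const_mul (-a₁)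
    rw [Complex.ofReal_zero, mul_zero] at h3
    refine h3.congr' ?_
    filter_upwards [eventually_gt_atTop 0] with Y hY
    have h4 : 1 / 2 + Y = Y * (1 + 1 / 2 * Y⁻¹) := by
      field_simp
      ring
    have h5 : 0 < 1 + 1 / 2 * Y⁻¹ := by positivity
    simp only [Function.comp]
    rw [h4, Real.log_mul hY.ne' h5.ne']
    push_cast
    ring
  have hall := (((((hq0.add hL0).neg.sub hG0).sub (hinv.const_mul a₀)).comp hshift).add
    hlog).const_add (-b₁)
  simp only [mul_zero, add_zero, neg_zero, sub_zero] at hall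
  refine hall.congr' ?_
  filter_upwards [eventually_gt_atTop 1] with Y hY
  have hre : 1 < (1 / 2 + (Y : ℂ)).re := by
    rw [← half_add_ofReal, Complex.ofReal_re]; linarith
  rw [hL.integral_neg_deriv_logDeriv_Xi (by linarith)]
  have h := hL.logDeriv_Xi_add hre
  simp only [Function.comp, half_add_ofReal, Nat.cast_one, zpow_neg_one]
  push_cast
  linear_combination h

theorem exists_continuations (hL : IsPrimaryFunction L q G Ξ)
    (hG : HasStirlingExpansion G a₁ b₁ a₀ b₀ a) :
    ∃ Zfirst Ztriv : ℂ → ℂ,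
      IsMeromorphicContinuation (zeroZetaTerm Ξ (1 / 2)) 1 {1} Zfirst ∧
      IsMeromorphicContinuation (zeroZetaTerm G (1 / 2)) 1 {1} Ztriv ∧
      Tendsto (fun s => Zfirst s - (-a₁) / (s - 1)) (𝓝[≠] 1) (𝓝 (-b₁)) ∧
      ∀ m : ℕ, 1 ≤ m →
        Zfirst (1 - 2 * m) + Ztriv (1 - 2 * m) = -(q * (2 : ℂ) ^ (1 - 2 * (m : ℤ))) := by
  have hX := hL.Xi_admissible
  have hGa := hL.G_admissible
  have hexp := exists_hasInvExpansion_of_stirling hL.G_entire hG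
  obtain ⟨Z₁, hZ₁⟩ := exists_isExpansionContinuation hX.differentiableOn_tsum
    (continuousOn_neg_deriv_logDeriv hX)
    (fun N => ⟨_, hL.hasInvExpansion_Xi (hexp N).choose_spec⟩)
    (fun s h1 h2 => hX.tsum_eq_integral h1 h2)
  obtain ⟨Z₂, hZ₂⟩ := exists_isExpansionContinuation hGa.differentiableOn_tsum
    (continuousOn_neg_deriv_logDeriv hGa) hexp
    (fun s h1 h2 => hGa.tsum_eq_integral h1 h2)
  have hcont : ∀ {f : ℂ → ℂ} {F : ℝ → ℂ} {E : ℂ → ℂ}, IsZetaAdmissible f (1 / 2) →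
      IsExpansionContinuation (fun s => ∑' ρ, zeroZetaTerm f (1 / 2) ρ s) F E →
      IsMeromorphicContinuation (zeroZetaTerm f (1 / 2)) 1 {1} E := by
    intro f F E hf hE
    refine ⟨fun s hs => ?_, fun s _ => ?_, fun s hs => hE.analyticAt s hs⟩
    · rw [hE.eq s hs]
      exact (hf.summable_norm hs).of_norm.hasSum
    · by_cases h : s = 1
      · rw [h]; exact hE.meromorphicAt
      · exact (hE.analyticAt s h).meromorphicAt
  refine ⟨Z₁, Z₂, hcont hX hZ₁, hcont hGa hZ₂, ?_, fun m hm => ?_⟩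
  · have h1 := hL.hasInvExpansion_Xi (hasInvExpansion_one_of_stirling hL.G_entire hG)
    have h2 := hZ₁.tendsto_sub_one (continuousOn_neg_deriv_logDeriv hX) h1 (l := -b₁)
      (by simpa using hL.tendsto_finitePart hG)
    simpa using h2
  · obtain ⟨d, hd⟩ := hexp (2 * m + 1)
    -- The coefficients d cancel, leaving -q · 4 · 2m · 2^(-2m-1)/(2m) = -q 2^(1-2m).
    rw [hZ₁.apply_one_sub_two_mul hm (hL.hasInvExpansion_Xi hd), hZ₂.apply_one_sub_two_mul hm hd]
    have hm0 : (m : ℂ) ≠ 0 := by exact_mod_cast (by omega : m ≠ 0)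
    have h2 : (2 : ℂ) ^ (1 - 2 * (m : ℤ)) = 2 * (2 ^ (2 * m))⁻¹ := by
      rw [zpow_sub₀ two_ne_zero, zpow_one]
      norm_cast
    rw [h2, pow_succ, one_div, inv_pow]
    push_cast
    field_simp
    ring

end IsPrimaryFunction

end PrimaryFunctions

/-! ### Pairing the zeros 1/2 ± iτ and passing to the enumeration -/

section Enumeration

open Set

theorem hasSum_comp_of_ncard_fiber {ι κ : Type*} (f : κ → ι) (n : ι → ℕ)
    (hfin : ∀ i, {k | f k = i}.Finite) (hn : ∀ i, {k | f k = i}.ncard = n i) {g : ι → ℂ}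
    (hg : Summable fun i => (n i : ℝ) * ‖g i‖) :
    HasSum (fun k => g (f k)) (∑' i, (n i : ℂ) * g i) := by
  have hcard : ∀ i, Nat.card {k // f k = i} = n i := fun i => by
    rw [← hn i]; exact Nat.card_coe_set_eq _
  have hfinite : ∀ i, Finite {k // f k = i} := fun i => (hfin i).to_subtype
  have hval : ∀ x : (i : ι) × {k // f k = i}, f (Equiv.sigmaFiberEquiv f x) = x.1 := fun x => x.2.2
  have hs1 : Summable fun x : (i : ι) × {k // f k = i} =>
      ‖g (f (Equiv.sigmaFiberEquiv f x))‖ := by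
    refine (summable_sigma_of_nonneg fun _ => norm_nonneg _).2 ⟨fun i => ?_, ?_⟩
    · have := hfinite i
      exact summable_of_hasFiniteSupport (Set.toFinite _)
    · refine hg.congr fun i => ?_
      simp only [hval, tsum_const, hcard, nsmul_eq_mul]
  have hs2 : Summable fun x : (i : ι) × {k // f k = i} => g (f (Equiv.sigmaFiberEquiv f x)) :=
    hs1.of_norm
  have hs3 : Summable fun k => g (f k) :=
    (Equiv.sigmaFiberEquiv f).summable_iff.1 hs2
  have ht : ∑' k, g (f k) = ∑' i, (n i : ℂ) * g i := by
    rw [← (Equiv.sigmaFiberEquiv f).tsum_eq, hs2.tsum_sigma]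
    refine tsum_congr fun i => ?_
    simp only [hval, tsum_const, hcard, nsmul_eq_mul]
  rw [← ht]
  exact hs3.hasSum

/-- For Re w > 0 the argument lies in (-π/2, π/2), so a quarter turn does not cross the cut of the
logarithm. -/
theorem I_mul_cpow {w : ℂ} (hw : 0 < w.re) (s : ℂ) :
    (Complex.I * w) ^ (-s) = Complex.exp (-(Real.pi * s / 2 * Complex.I)) * w ^ (-s) := by
  have hw0 : w ≠ 0 := fun h => by simp [h] at hw
  have ha := Complex.abs_arg_lt_pi_div_two_iff.2 (Or.inl hw)
  have hlog : Complex.log (Complex.I * w) = Real.pi / 2 * Complex.I + Complex.log w := by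
    rw [Complex.log_mul Complex.I_ne_zero hw0, Complex.log_I]
    rw [Complex.arg_I]
    exact ⟨by linarith [(abs_lt.1 ha).1, Real.pi_pos], by linarith [(abs_lt.1 ha).2]⟩
  rw [Complex.cpow_def_of_ne_zero (mul_ne_zero Complex.I_ne_zero hw0),
    Complex.cpow_def_of_ne_zero hw0, hlog, ← Complex.exp_add]
  congr 1
  ring

theorem neg_I_mul_cpow {w : ℂ} (hw : 0 < w.re) (s : ℂ) :
    (-Complex.I * w) ^ (-s) = Complex.exp (Real.pi * s / 2 * Complex.I) * w ^ (-s) := by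
  have hw0 : w ≠ 0 := fun h => by simp [h] at hw
  have ha := Complex.abs_arg_lt_pi_div_two_iff.2 (Or.inl hw)
  have hlog : Complex.log (-Complex.I * w) = -(Real.pi / 2) * Complex.I + Complex.log w := by
    rw [Complex.log_mul (neg_ne_zero.2 Complex.I_ne_zero) hw0, Complex.log_neg_I]
    rw [Complex.arg_neg_I]
    exact ⟨by linarith [(abs_lt.1 ha).1], by linarith [(abs_lt.1 ha).2, Real.pi_pos]⟩
  rw [Complex.cpow_def_of_ne_zero (mul_ne_zero (neg_ne_zero.2 Complex.I_ne_zero) hw0),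
    Complex.cpow_def_of_ne_zero hw0, hlog, ← Complex.exp_add]
  congr 1
  ring

theorem sq_cpow_neg {w : ℂ} (hw : 0 < w.re) (σ : ℂ) : (w ^ 2) ^ (-σ) = w ^ (-(2 * σ)) := by
  have hw0 : w ≠ 0 := fun h => by simp [h] at hw
  have ha := abs_lt.1 (Complex.abs_arg_lt_pi_div_two_iff.2 (Or.inl hw))
  have hlog : Complex.log (w ^ 2) = 2 * Complex.log w := by
    rw [sq, Complex.log_mul hw0 hw0 ⟨by linarith, by linarith⟩]
    ring
  rw [Complex.cpow_def_of_ne_zero (pow_ne_zero 2 hw0), Complex.cpow_def_of_ne_zero hw0, hlog]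
  congr 1
  ring

/-- The multiplicity of a zero in the upper half-plane, and `0` for the other zeros. -/
def upperOrder (f : ℂ → ℂ) (ρ : ℂ) : ℕ := if 0 < ρ.im then analyticOrderNatAt f ρ else 0

/-- The terms of the series `∑ τ ^ (-s)` over the zeros `1/2 + i τ` with `Re τ > 0`. -/
def upperZetaTerm (f : ℂ → ℂ) (ρ : {ρ : ℂ // f ρ = 0}) (s : ℂ) : ℂ :=
  (upperOrder f ρ : ℂ) * (-Complex.I * (ρ - 1 / 2)) ^ (-s)

namespace IsPrimaryFunction

variable {L G Ξ : ℂ → ℂ} {q : ℕ} {τ : ℕ → ℂ}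

theorem analyticOrderNatAt_one_sub (hL : IsPrimaryFunction L q G Ξ) (ρ : ℂ) :
    analyticOrderNatAt Ξ (1 - ρ) = analyticOrderNatAt Ξ ρ := by
  have h1 : HasDerivAt (fun z : ℂ => 1 - z) (-1) ρ := (hasDerivAt_id ρ).const_sub 1
  have h := analyticOrderAt_comp_of_deriv_ne_zero (f := Ξ) (g := fun z : ℂ => 1 - z) (z₀ := ρ)
    (by fun_prop) (by rw [h1.deriv]; norm_num)
  have he : Ξ ∘ (fun z : ℂ => 1 - z) = Ξ := funext fun z => (hL.functional_equation z).symm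
  rw [he] at h
  rw [analyticOrderNatAt, analyticOrderNatAt, h]

/-- The reflection `ρ ↦ 1 - ρ` of the nontrivial zeros. -/
def reflect (hL : IsPrimaryFunction L q G Ξ) : {ρ : ℂ // Ξ ρ = 0} ≃ {ρ : ℂ // Ξ ρ = 0} where
  toFun ρ := ⟨1 - ρ, by rw [← hL.functional_equation]; exact ρ.2⟩
  invFun ρ := ⟨1 - ρ, by rw [← hL.functional_equation]; exact ρ.2⟩
  left_inv ρ := Subtype.ext (by simp)
  right_inv ρ := Subtype.ext (by simp)

theorem zeroZetaTerm_eq_upper (hL : IsPrimaryFunction L q G Ξ) {ρ : {ρ : ℂ // Ξ ρ = 0}}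
    (h : 0 < (ρ : ℂ).im) (s : ℂ) :
    zeroZetaTerm Ξ (1 / 2) ρ s = Complex.exp (Real.pi * s / 2 * Complex.I) * upperZetaTerm Ξ ρ s ∧
    zeroZetaTerm Ξ (1 / 2) (hL.reflect ρ) s =
      Complex.exp (-(Real.pi * s / 2 * Complex.I)) * upperZetaTerm Ξ ρ s ∧
    upperZetaTerm Ξ (hL.reflect ρ) s = 0 := by
  have hre : 0 < (-Complex.I * ((ρ : ℂ) - 1 / 2)).re := by simpa using h
  have hr : ((hL.reflect ρ : {ρ : ℂ // Ξ ρ = 0}) : ℂ) = 1 - ρ := rfl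
  refine ⟨?_, ?_, ?_⟩
  · have e : (1 / 2 - (ρ : ℂ)) = -Complex.I * (-Complex.I * (ρ - 1 / 2)) := by
      linear_combination (-(ρ : ℂ) + 1 / 2) * Complex.I_sq
    rw [zeroZetaTerm, e, neg_I_mul_cpow hre, upperZetaTerm, upperOrder, if_pos h]
    ring
  · have e : (1 / 2 - (1 - (ρ : ℂ))) = Complex.I * (-Complex.I * (ρ - 1 / 2)) := by
      linear_combination ((ρ : ℂ) - 1 / 2) * Complex.I_sq
    rw [zeroZetaTerm, hr, e, I_mul_cpow hre, upperZetaTerm, upperOrder, if_pos h,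
      hL.analyticOrderNatAt_one_sub]
    ring
  · rw [upperZetaTerm, upperOrder, hr, if_neg (by simpa using h.le)]
    simp

/-- No zero is real, so exactly one of ρ and 1 - ρ lies in the upper half-plane, and the other term
on the right vanishes. In this form both parts can be summed over all zeros, using the bijection
`reflect`. -/
theorem zeroZetaTerm_eq (hL : IsPrimaryFunction L q G Ξ) (ρ : {ρ : ℂ // Ξ ρ = 0}) (s : ℂ) :
    zeroZetaTerm Ξ (1 / 2) ρ s =
      Complex.exp (Real.pi * s / 2 * Complex.I) * upperZetaTerm Ξ ρ s +
      Complex.exp (-(Real.pi * s / 2 * Complex.I)) * upperZetaTerm Ξ (hL.reflect ρ) s := by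
  rcases lt_or_gt_of_ne (hL.Xi_zeros ρ ρ.2).2.2 with h | h
  · have hr : 0 < ((hL.reflect ρ : {ρ : ℂ // Ξ ρ = 0}) : ℂ).im := by
      change 0 < (1 - (ρ : ℂ)).im
      simpa using h
    have hrr : hL.reflect (hL.reflect ρ) = ρ := hL.reflect.left_inv ρ
    have h1 := (hL.zeroZetaTerm_eq_upper hr s).2
    rw [hrr] at h1
    rw [h1.1, h1.2, mul_zero, zero_add]
  · have h1 := hL.zeroZetaTerm_eq_upper h s
    rw [h1.2.2, h1.1, mul_zero, add_zero]

theorem norm_upperZetaTerm_le (hL : IsPrimaryFunction L q G Ξ) (ρ : {ρ : ℂ // Ξ ρ = 0}) (s : ℂ) :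
    ‖upperZetaTerm Ξ ρ s‖ ≤ Real.exp (Real.pi * ‖s‖ / 2) * ‖zeroZetaTerm Ξ (1 / 2) ρ s‖ := by
  by_cases h : 0 < (ρ : ℂ).im
  · have h1 : upperZetaTerm Ξ ρ s =
        Complex.exp (-(Real.pi * s / 2 * Complex.I)) * zeroZetaTerm Ξ (1 / 2) ρ s := by
      rw [(hL.zeroZetaTerm_eq_upper h s).1, ← mul_assoc, ← Complex.exp_add]
      simp
    rw [h1, norm_mul, Complex.norm_exp]
    refine mul_le_mul_of_nonneg_right (Real.exp_le_exp.2 ?_) (norm_nonneg _)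
    refine (Complex.re_le_norm _).trans (le_of_eq ?_)
    simp [abs_of_pos Real.pi_pos]
  · rw [upperZetaTerm, upperOrder, if_neg h]
    simp only [Nat.cast_zero, zero_mul, norm_zero]
    positivity

theorem summable_norm_upper (hL : IsPrimaryFunction L q G Ξ) {s : ℂ} (hs : 1 < s.re) :
    Summable fun ρ => ‖upperZetaTerm Ξ ρ s‖ :=
  Summable.of_nonneg_of_le (fun _ => norm_nonneg _) (fun ρ => hL.norm_upperZetaTerm_le ρ s)
    ((hL.Xi_admissible.summable_norm hs).mul_left _)

theorem differentiableOn_tsum_upper (hL : IsPrimaryFunction L q G Ξ) :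
    DifferentiableOn ℂ (fun s => ∑' ρ, upperZetaTerm Ξ ρ s) {s | 1 < s.re} := by
  intro s hs
  have hs' : 1 < s.re := hs
  obtain ⟨b, hb, h⟩ := hL.Xi_admissible.exists_summable_bound (σ := (1 + s.re) / 2)
    (by linarith) (‖s‖ + 1)
  have hopen : IsOpen ({w : ℂ | (1 + s.re) / 2 < w.re} ∩ {w : ℂ | ‖w‖ < ‖s‖ + 1}) :=
    (isOpen_re_gt _).inter (isOpen_lt continuous_norm continuous_const)
  have hmem : s ∈ ({w : ℂ | (1 + s.re) / 2 < w.re} ∩ {w : ℂ | ‖w‖ < ‖s‖ + 1}) :=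
    ⟨by rw [Set.mem_ofPred_eq]; linarith, by rw [Set.mem_ofPred_eq]; linarith⟩
  refine DifferentiableAt.differentiableWithinAt ?_
  refine (Complex.differentiableOn_tsum_of_summable_norm
    (hb.mul_left (Real.exp (Real.pi * (‖s‖ + 1) / 2))) (fun ρ => ?_) hopen
    (fun ρ w hw => ?_)).differentiableAt (hopen.mem_nhds hmem)
  · refine Differentiable.differentiableOn fun w => ?_
    have hne : -Complex.I * ((ρ : ℂ) - 1 / 2) ≠ 0 := by
      refine mul_ne_zero (neg_ne_zero.2 Complex.I_ne_zero) fun h => ?_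
      have him := (hL.Xi_zeros ρ ρ.2).2.2
      rw [sub_eq_zero.1 h] at him
      simp at him
    exact (((differentiableAt_id.neg).const_cpow (Or.inl hne))).const_mul _
  · refine (hL.norm_upperZetaTerm_le ρ w).trans ?_
    have h1 : ‖w‖ ≤ ‖s‖ + 1 := hw.2.le
    have h2 := h ρ w hw.1.le h1
    gcongr

theorem hasSum_zeroZetaTerm (hL : IsPrimaryFunction L q G Ξ) {s : ℂ} (hs : 1 < s.re) :
    HasSum (fun ρ => zeroZetaTerm Ξ (1 / 2) ρ s)
      (2 * Complex.cos (Real.pi * s / 2) * ∑' ρ, upperZetaTerm Ξ ρ s) := by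
  have h1 := (hL.summable_norm_upper hs).of_norm.hasSum
  have h2 : HasSum (fun ρ => upperZetaTerm Ξ (hL.reflect ρ) s) (∑' ρ, upperZetaTerm Ξ ρ s) :=
    hL.reflect.hasSum_iff.2 h1
  have h3 := (h1.mul_left (Complex.exp (Real.pi * s / 2 * Complex.I))).add
    (h2.mul_left (Complex.exp (-(Real.pi * s / 2 * Complex.I))))
  rw [← add_mul, ← neg_mul, ← Complex.two_cos] at h3
  have h4 : (fun ρ => zeroZetaTerm Ξ (1 / 2) ρ s) = fun ρ =>
      Complex.exp (Real.pi * s / 2 * Complex.I) * upperZetaTerm Ξ ρ s +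
      Complex.exp (-(Real.pi * s / 2) * Complex.I) * upperZetaTerm Ξ (hL.reflect ρ) s := by
    funext ρ
    rw [hL.zeroZetaTerm_eq, neg_mul]
  rw [h4]
  exact h3

/-- The map k ↦ 1/2 + iτ_k hits each upper zero as often as its multiplicity and no lower zero.
Regrouping the series by fibres gives the sum over the upper zeros. -/
theorem hasSum_secondZetaTerm (hL : IsPrimaryFunction L q G Ξ) (hτ : EnumeratesZeros Ξ τ) {σ : ℂ}
    (hσ : 1 / 2 < σ.re) :
    HasSum (fun k => secondZetaTerm τ 0 k σ) (∑' ρ, upperZetaTerm Ξ ρ (2 * σ)) := by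
  have hs : 1 < (2 * σ).re := by simp; linarith
  have hX := hL.Xi_admissible
  have htop : ∀ z, analyticOrderAt Ξ z ≠ ⊤ :=
    analyticOrderAt_ne_top_of_entire hL.Xi_entire hX.ne_zero_center
  have hzero : ∀ k, Ξ (1 / 2 + Complex.I * τ k) = 0 := by
    intro k
    have h1 := hτ.multiplicity (τ k) (hτ.re_pos k)
    have h2 : Set.encard {j | τ j = τ k} ≠ 0 := by
      rw [Set.encard_ne_zero]
      exact ⟨k, rfl⟩
    rw [h1] at h2
    exact (analyticOrderAt_ne_zero.1 h2).2
  set f : ℕ → {ρ : ℂ // Ξ ρ = 0} := fun k => ⟨1 / 2 + Complex.I * τ k, hzero k⟩ with hf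
  have hfk : ∀ k (ρ : {ρ : ℂ // Ξ ρ = 0}), f k = ρ ↔ τ k = -Complex.I * (ρ - 1 / 2) := by
    intro k ρ
    rw [Subtype.ext_iff]
    constructor
    · intro h
      rw [← h]
      simp only [hf]
      linear_combination τ k * Complex.I_sq
    · intro h
      simp only [hf]
      rw [h]
      linear_combination (1 / 2 - (ρ : ℂ)) * Complex.I_sq
  have hencard : ∀ ρ, {k | f k = ρ}.encard = upperOrder Ξ ρ := by
    intro ρ
    have hset : {k | f k = ρ} = {k | τ k = -Complex.I * ((ρ : ℂ) - 1 / 2)} := by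
      ext k
      exact hfk k ρ
    rw [hset, upperOrder]
    split_ifs with h
    · rw [hτ.multiplicity _ (by simpa using h), Nat.cast_analyticOrderNatAt (htop _)]
      congr 1
      linear_combination (1 / 2 - (ρ : ℂ)) * Complex.I_sq
    · rw [Nat.cast_zero, Set.encard_eq_zero, Set.eq_empty_iff_forall_notMem]
      intro k hk
      have h1 := hτ.re_pos k
      rw [Set.mem_ofPred_eq] at hk
      rw [hk] at h1
      apply h
      simpa using h1
  have hfin : ∀ ρ, {k | f k = ρ}.Finite := fun ρ => by
    rw [← Set.encard_ne_top_iff, hencard]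
    exact ENat.natCast_ne_top _
  have hncard : ∀ ρ, {k | f k = ρ}.ncard = upperOrder Ξ ρ := fun ρ => by
    rw [Set.ncard, hencard]
    simp
  have key := hasSum_comp_of_ncard_fiber f (fun ρ => upperOrder Ξ ρ) hfin hncard
    (g := fun ρ => (-Complex.I * ((ρ : ℂ) - 1 / 2)) ^ (-(2 * σ)))
    ((hL.summable_norm_upper hs).congr fun ρ => by
      rw [upperZetaTerm, norm_mul, Complex.norm_natCast])
  convert key using 2 with k
  rw [secondZetaTerm, add_zero, sq_cpow_neg (hτ.re_pos k), ← (hfk k (f k)).1 rfl]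
  rfl

end IsPrimaryFunction

end Enumeration

/-! ### Expansion of 1/cos πσ and the pole orders -/

section PolarParts

theorem AnalyticAt.sub_linear_isBigO {f : ℂ → ℂ} {f' : ℂ} (hf : AnalyticAt ℂ f 0)
    (hf' : HasDerivAt f f' 0) :
    (fun ε => f ε - (f 0 + f' * ε)) =O[𝓝 0] fun ε : ℂ => ε ^ 2 := by
  obtain ⟨p, hp⟩ := hf
  have h := hp.isBigO_sub_partialSum_pow 2
  have h0 : p.coeff 0 = f 0 := by
    rw [FormalMultilinearSeries.coeff]
    exact hp.coeff_zero _
  have h1 : p.coeff 1 = f' := hp.hasDerivAt.unique hf'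
  refine (h.congr_left fun ε => ?_).trans (IsBigO.of_bound 1 (by simp))
  simp [FormalMultilinearSeries.partialSum, Finset.sum_range_succ, h0, h1, mul_comm]

theorem cos_pi_mul_int (m : ℤ) : Complex.cos (Real.pi * m) = (-1) ^ m := by
  have := congrArg (fun x : ℝ => (x : ℂ)) (Real.cos_int_mul_pi m)
  push_cast at this
  rw [mul_comm]
  exact this

theorem cos_pi_half_sub_nat (m : ℕ) (ε : ℂ) :
    Complex.cos (Real.pi * (1 / 2 - m + ε)) = (-1) ^ (m + 1) * Complex.sin (Real.pi * ε) := by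
  have hs : Complex.sin (Real.pi * m) = 0 := by
    simpa using sin_pi_mul_int m
  have hc : Complex.cos (Real.pi * m) = (-1) ^ m := by
    simpa using cos_pi_mul_int m
  rw [show (Real.pi : ℂ) * (1 / 2 - m + ε) = Real.pi / 2 - (Real.pi * m - Real.pi * ε) by ring,
    Complex.cos_pi_div_two_sub, Complex.sin_sub, hs, hc]
  ring

theorem cos_pi_eq_zero {σ : ℂ} (h : Complex.cos (Real.pi * σ) = 0) :
    ∃ k : ℤ, σ = 1 / 2 + k := by
  have hpi : (Real.pi : ℂ) ≠ 0 := by exact_mod_cast Real.pi_ne_zero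
  obtain ⟨k, hk⟩ := Complex.cos_eq_zero_iff.1 h
  refine ⟨k, mul_left_cancel₀ hpi ?_⟩
  rw [hk]
  ring

theorem eventually_cos_pi_ne_zero (σ : ℂ) : ∀ᶠ w in 𝓝[≠] σ, Complex.cos (Real.pi * w) ≠ 0 := by
  by_cases h : Complex.cos (Real.pi * σ) = 0
  · have hd : HasDerivAt (fun w : ℂ => Complex.cos (Real.pi * w))
        (-Complex.sin (Real.pi * σ) * Real.pi) σ := by
      simpa using ((hasDerivAt_id σ).const_mul (Real.pi : ℂ)).ccos
    refine hd.eventually_ne (mul_ne_zero (neg_ne_zero.2 fun hs => ?_)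
      (by exact_mod_cast Real.pi_ne_zero))
    have := Complex.sin_sq_add_cos_sq (Real.pi * σ)
    rw [h, hs] at this
    norm_num at this
  · have hc : ContinuousAt (fun w : ℂ => Complex.cos (Real.pi * w)) σ := by fun_prop
    exact (hc.eventually_ne h).filter_mono nhdsWithin_le_nhds

theorem sin_pi_mul_eq (ε : ℂ) :
    Complex.sin (Real.pi * ε) = Real.pi * ε * sinKernel (1 + ε) := by
  by_cases h : ε = 0
  · simp [h]
  · have hpi : (Real.pi : ℂ) ≠ 0 := by exact_mod_cast Real.pi_ne_zero
    rw [sinKernel_of_ne (by simpa using h),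
      show (Real.pi : ℂ) * (1 + ε) = Real.pi * ε + Real.pi by ring,
      Complex.sin_add_pi, show (1 : ℂ) - (1 + ε) = -ε by ring]
    field_simp

/-- The reciprocal of `sin (π ε) / (π ε)`. -/
def sinRecip (ε : ℂ) : ℂ := (sinKernel (1 + ε))⁻¹

theorem sinRecip_zero : sinRecip 0 = 1 := by
  rw [sinRecip, add_zero, sinKernel_one, inv_one]

theorem analyticAt_sinRecip : AnalyticAt ℂ sinRecip 0 := by
  refine AnalyticAt.inv ?_ (by rw [add_zero, sinKernel_one]; exact one_ne_zero)
  exact (differentiable_sinKernel.comp (by fun_prop)).analyticAt 0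

/-- The vanishing derivative keeps a₁ out of the 1/ε coefficient at the double pole. -/
theorem hasDerivAt_sinRecip : HasDerivAt sinRecip 0 0 := by
  have h0 : HasDerivAt sinKernel 0 (1 + 0) := by
    rw [add_zero, ← deriv_sinKernel_one]
    exact (differentiable_sinKernel 1).hasDerivAt
  have h1 : HasDerivAt (fun ε : ℂ => sinKernel (1 + ε)) 0 0 :=
    (h0.comp (0 : ℂ) ((hasDerivAt_id (0 : ℂ)).const_add 1)).congr_deriv (by ring)
  refine (h1.fun_inv (by rw [add_zero, sinKernel_one]; exact one_ne_zero)).congr_deriv (by simp)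

theorem inv_two_mul_cos (m : ℕ) (ε : ℂ) :
    (2 * Complex.cos (Real.pi * (1 / 2 - m + ε)))⁻¹ =
      (-1) ^ (m + 1) * sinRecip ε / (2 * Real.pi * ε) := by
  rw [cos_pi_half_sub_nat, sin_pi_mul_eq, sinRecip]
  have h : ((-1 : ℂ) ^ (m + 1))⁻¹ = (-1) ^ (m + 1) := by
    rw [← inv_pow]; norm_num
  rw [mul_inv, mul_inv, mul_inv, mul_inv, h, div_eq_mul_inv, mul_inv, mul_inv]
  ring

/-- The numerator of the double pole at `1/2` of the second zeta function. -/
theorem exists_double_pole_numerator {Zfirst Z : ℂ → ℂ} {a₁ b₁ : ℂ}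
    (hana : ∀ s, s ≠ 1 → AnalyticAt ℂ Zfirst s)
    (hlim : Tendsto (fun s => Zfirst s - (-a₁) / (s - 1)) (𝓝[≠] 1) (𝓝 (-b₁)))
    (hrel : ∀ σ : ℂ, Complex.cos (Real.pi * σ) ≠ 0 →
      Z σ = (2 * Complex.cos (Real.pi * σ))⁻¹ * Zfirst (2 * σ)) :
    ∃ M : ℂ → ℂ, AnalyticAt ℂ M 0 ∧ M 0 = a₁ ∧ HasDerivAt M (2 * b₁) 0 ∧
      ∀ᶠ ε in 𝓝[≠] 0, Z (1 / 2 + ε) = M ε / (4 * Real.pi * ε ^ 2) := by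
  classical
  -- The regular part at 1, made analytic there by removing the singularity with the value -b₁.
  set g : ℂ → ℂ := Function.update (fun s => Zfirst s - (-a₁) / (s - 1)) 1 (-b₁) with hg
  have hgne : ∀ s, s ≠ 1 → g s = Zfirst s - (-a₁) / (s - 1) := fun s hs =>
    Function.update_of_ne hs _ _
  have hg1 : g 1 = -b₁ := Function.update_self _ _ _
  have hga : AnalyticAt ℂ g 1 := by
    refine Complex.analyticAt_of_differentiable_on_punctured_nhds_of_continuousAt ?_
      (continuousAt_update_same.2 hlim)
    filter_upwards [self_mem_nhdsWithin] with s hs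
    have hs1 : s ≠ 1 := hs
    have : DifferentiableAt ℂ (fun s => Zfirst s - (-a₁) / (s - 1)) s :=
      (hana s hs1).differentiableAt.sub ((differentiableAt_const _).div (by fun_prop)
        (sub_ne_zero.2 hs1))
    refine this.congr_of_eventuallyEq ?_
    filter_upwards [isOpen_ne.mem_nhds hs1] with w hw using hgne w hw
  have hga' : AnalyticAt ℂ g (1 + 2 * 0) := by simpa using hga
  have hi : AnalyticAt ℂ (fun ε : ℂ => 1 + 2 * ε) 0 := by fun_prop
  have hgc : AnalyticAt ℂ (fun ε : ℂ => g (1 + 2 * ε)) 0 := AnalyticAt.fun_comp hga' hi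
  -- Here Z(1/2 + ε) is -`sinRecip` ε/(2πε) times g(1 + 2ε) - a₁/(2ε); clearing 4πε² gives M, with
  -- M'(0) = -2g(1) = 2b₁.
  set M : ℂ → ℂ := fun ε => sinRecip ε * (a₁ - 2 * ε * g (1 + 2 * ε)) with hM
  refine ⟨M, analyticAt_sinRecip.mul (analyticAt_const.sub
    ((analyticAt_const.mul analyticAt_id).mul hgc)), by simp [hM, sinRecip_zero], ?_, ?_⟩
  · have h1 : HasDerivAt (fun ε : ℂ => 2 * ε) 2 0 := by
      simpa using (hasDerivAt_id (0 : ℂ)).const_mul 2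
    have h2 := h1.mul hgc.differentiableAt.hasDerivAt
    refine (hasDerivAt_sinRecip.mul (h2.const_sub a₁)).congr_deriv ?_
    simp [sinRecip_zero, hg1]
  · have hcos : ∀ᶠ ε in 𝓝[≠] (0 : ℂ), Complex.sin (Real.pi * ε) ≠ 0 := by
      have := (hasDerivAt_sin_pi 0).eventually_ne (c := 0) (by
        simp [Real.pi_ne_zero])
      exact this
    filter_upwards [hcos, self_mem_nhdsWithin] with ε hε hε0
    have hε1 : ε ≠ 0 := hε0
    have hpi : (Real.pi : ℂ) ≠ 0 := by exact_mod_cast Real.pi_ne_zero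
    have hc := cos_pi_half_sub_nat 0 ε
    have hi := inv_two_mul_cos 0 ε
    rw [Nat.cast_zero, sub_zero] at hc hi
    rw [hrel _ (by rw [hc]; simpa using hε), hi, show (2 : ℂ) * (1 / 2 + ε) = 1 + 2 * ε by ring]
    have h3 : Zfirst (1 + 2 * ε) = g (1 + 2 * ε) + (-a₁) / (2 * ε) := by
      rw [hgne _ (by simpa using hε1)]
      ring
    rw [h3]
    simp only [hM]
    field_simp
    ring

theorem exists_simple_pole_numerator {Zfirst Z : ℂ → ℂ} {m : ℕ} (hm : 1 ≤ m)
    (hana : ∀ s, s ≠ 1 → AnalyticAt ℂ Zfirst s)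
    (hrel : ∀ σ : ℂ, Complex.cos (Real.pi * σ) ≠ 0 →
      Z σ = (2 * Complex.cos (Real.pi * σ))⁻¹ * Zfirst (2 * σ)) :
    ∃ M : ℂ → ℂ, AnalyticAt ℂ M 0 ∧
      M 0 = (-1) ^ (m + 1) / (2 * Real.pi) * Zfirst (1 - 2 * m) ∧
      ∀ᶠ ε in 𝓝[≠] 0, Z (1 / 2 - m + ε) = M ε / ε := by
  have hne : (1 - 2 * (m : ℂ) + 2 * 0) ≠ 1 := by
    intro h
    have h2 : (m : ℂ) = 0 := by linear_combination (-1 / 2) * h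
    have h3 : m = 0 := by exact_mod_cast h2
    omega
  have hi : AnalyticAt ℂ (fun ε : ℂ => 1 - 2 * (m : ℂ) + 2 * ε) 0 := by fun_prop
  have hc : AnalyticAt ℂ (fun ε : ℂ => Zfirst (1 - 2 * m + 2 * ε)) 0 :=
    AnalyticAt.fun_comp (hana _ hne) hi
  refine ⟨fun ε => (-1) ^ (m + 1) / (2 * Real.pi) * (sinRecip ε * Zfirst (1 - 2 * m + 2 * ε)),
    analyticAt_const.mul (analyticAt_sinRecip.mul hc), by simp [sinRecip_zero], ?_⟩
  have hsin : ∀ᶠ ε in 𝓝[≠] (0 : ℂ), Complex.sin (Real.pi * ε) ≠ 0 :=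
    (hasDerivAt_sin_pi 0).eventually_ne (c := 0) (by simp [Real.pi_ne_zero])
  filter_upwards [hsin, self_mem_nhdsWithin] with ε hε hε0
  have hε1 : ε ≠ 0 := hε0
  have hpi : (Real.pi : ℂ) ≠ 0 := by exact_mod_cast Real.pi_ne_zero
  rw [hrel _ (by
      rw [cos_pi_half_sub_nat]
      exact mul_ne_zero (pow_ne_zero _ (by norm_num)) hε), inv_two_mul_cos,
    show (2 : ℂ) * (1 / 2 - m + ε) = 1 - 2 * m + 2 * ε by ring]
  field_simp

theorem meromorphicOrderAt_of_eventually_eq_div {Z M : ℂ → ℂ} {x : ℂ} {c : ℂ} (hc : c ≠ 0) (n : ℕ)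
    (hZ : MeromorphicAt Z x) (hM : AnalyticAt ℂ M 0) (hM0 : M 0 ≠ 0)
    (h : ∀ᶠ ε in 𝓝[≠] 0, Z (x + ε) = M ε / (c * ε ^ n)) :
    meromorphicOrderAt Z x = ((-(n : ℤ) : ℤ) : WithTop ℤ) := by
  rw [meromorphicOrderAt_eq_int_iff hZ]
  have hM' : AnalyticAt ℂ M (x - x) := by rwa [sub_self]
  have hi : AnalyticAt ℂ (fun z : ℂ => z - x) x := by fun_prop
  refine ⟨fun z => M (z - x) / c, (AnalyticAt.fun_comp (f := fun z => z - x) hM' hi).fun_div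
    analyticAt_const hc, by
    simp only [sub_self]; exact div_ne_zero hM0 hc, ?_⟩
  have ht : Tendsto (fun z : ℂ => z - x) (𝓝[≠] x) (𝓝[≠] 0) := by
    refine tendsto_nhdsWithin_iff.2 ⟨?_, ?_⟩
    · have : Tendsto (fun z : ℂ => z - x) (𝓝 x) (𝓝 (x - x)) := tendsto_id.sub_const x
      rw [sub_self] at this
      exact this.mono_left nhdsWithin_le_nhds
    · filter_upwards [self_mem_nhdsWithin] with z hz
      exact sub_ne_zero.2 hz
  filter_upwards [ht.eventually h] with z hz
  rw [add_sub_cancel] at hz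
  rw [hz, zpow_neg, zpow_natCast, smul_eq_mul, div_mul_eq_div_div, div_eq_mul_inv _ ((z - x) ^ n)]
  ring

end PolarParts

/-! ### Continuation of the second zeta function -/

theorem IsPrimaryFunction.exists_second_zeta {L G Ξ : ℂ → ℂ} {q : ℕ}
    (hL : IsPrimaryFunction L q G Ξ) {τ : ℕ → ℂ} (hτ : EnumeratesZeros Ξ τ) {Zfirst : ℂ → ℂ}
    (h₁ : IsMeromorphicContinuation (zeroZetaTerm Ξ (1 / 2)) 1 {1} Zfirst) :
    ∃ Z : ℂ → ℂ, IsMeromorphicContinuation (secondZetaTerm τ 0) (1 / 2)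
        {σ : ℂ | ∃ m : ℕ, σ = 1 / 2 - m} Z ∧
      ∀ σ : ℂ, Complex.cos (Real.pi * σ) ≠ 0 →
        Z σ = (2 * Complex.cos (Real.pi * σ))⁻¹ * Zfirst (2 * σ) := by
  classical
  set W : ℂ → ℂ := fun σ => ∑' ρ, upperZetaTerm Ξ ρ (2 * σ) with hW
  -- At the zeros of the cosine with Re σ > 1/2 the series is regular, while the quotient would take
  -- the default value 0; hence the series is used on that half-plane.
  set Z : ℂ → ℂ := fun σ => if 1 / 2 < σ.re then W σ else
    (2 * Complex.cos (Real.pi * σ))⁻¹ * Zfirst (2 * σ) with hZ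
  have hrel : ∀ σ : ℂ, Complex.cos (Real.pi * σ) ≠ 0 →
      Z σ = (2 * Complex.cos (Real.pi * σ))⁻¹ * Zfirst (2 * σ) := by
    intro σ hσ
    simp only [hZ]
    split_ifs with h
    · have hs : 1 < (2 * σ).re := by simp; linarith
      rw [(h₁.hasSum _ hs).unique (hL.hasSum_zeroZetaTerm hs),
        show (Real.pi : ℂ) * (2 * σ) / 2 = Real.pi * σ by ring]
      field_simp
      rfl
    · rfl
  have hi (σ : ℂ) : AnalyticAt ℂ (fun σ : ℂ => 2 * σ) σ := by fun_prop
  have hright : ∀ σ : ℂ, 1 / 2 < σ.re → AnalyticAt ℂ Z σ := by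
    intro σ hσ
    have hs : 1 < (2 * σ).re := by simp; linarith
    have hWa : AnalyticAt ℂ W σ := AnalyticAt.fun_comp
      (hL.differentiableOn_tsum_upper.analyticAt ((isOpen_re_gt 1).mem_nhds hs)) (hi σ)
    refine hWa.congr ?_
    filter_upwards [(isOpen_re_gt (1 / 2)).mem_nhds hσ] with w hw
    exact (if_pos hw).symm
  have hcosd : Differentiable ℂ fun σ : ℂ => 2 * Complex.cos (Real.pi * σ) := by fun_prop
  refine ⟨Z, ⟨fun σ hσ => ?_, fun σ _ => ?_, fun σ hσ => ?_⟩, hrel⟩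
  · have : Z σ = W σ := if_pos hσ
    rw [this]
    exact hL.hasSum_secondZetaTerm hτ hσ
  · have hm : MeromorphicAt (fun σ => (2 * Complex.cos (Real.pi * σ))⁻¹ * Zfirst (2 * σ)) σ := by
      refine (hcosd.analyticAt σ).meromorphicAt.inv.mul ?_
      exact (h₁.meromorphicOn (2 * σ) trivial).comp_analyticAt (hi σ)
    refine hm.congr ?_
    filter_upwards [eventually_cos_pi_ne_zero σ] with w hw using (hrel w hw).symm
  · by_cases h : 1 / 2 < σ.re
    · exact hright σ h
    · have hcos : Complex.cos (Real.pi * σ) ≠ 0 := by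
        intro h0
        obtain ⟨k, hk⟩ := cos_pi_eq_zero h0
        have hk0 : k ≤ 0 := by
          rw [hk] at h
          have h3 : (1 / 2 + (k : ℂ)).re = 1 / 2 + k := by simp
          rw [h3] at h
          push Not at h
          have : (k : ℝ) ≤ 0 := by linarith
          exact_mod_cast this
        refine hσ ⟨(-k).toNat, ?_⟩
        have h4 : (((-k).toNat : ℤ) : ℂ) = ((-k : ℤ) : ℂ) := by
          rw [Int.toNat_of_nonneg (by omega)]
        rw [Int.cast_natCast] at h4
        rw [hk, h4]
        push_cast
        ring
      have h21 : 2 * σ ≠ 1 := by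
        intro h0
        refine hσ ⟨0, ?_⟩
        rw [Nat.cast_zero]
        linear_combination (1 / 2) * h0
      have ha : AnalyticAt ℂ (fun σ => (2 * Complex.cos (Real.pi * σ))⁻¹ * Zfirst (2 * σ)) σ := by
        refine ((hcosd.analyticAt σ).fun_inv (mul_ne_zero two_ne_zero hcos)).mul ?_
        exact AnalyticAt.fun_comp (h₁.analyticAt (2 * σ) h21) (hi σ)
      refine ha.congr ?_
      filter_upwards [hcosd.continuous.continuousAt.eventually_ne
        (mul_ne_zero two_ne_zero hcos)] with w hw
      exact (hrel w fun h0 => hw (by rw [h0, mul_zero])).symm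

end

/-! ### Assembly -/

theorem mainTheorem5 (L G Ξ : ℂ → ℂ) (q : ℕ) (hL : IsPrimaryFunction L q G Ξ)
    (a₁ b₁ a₀ b₀ : ℂ) (a : ℕ → ℂ) (hG : HasStirlingExpansion G a₁ b₁ a₀ b₀ a)
    (τ : ℕ → ℂ) (hτ : EnumeratesZeros Ξ τ) :
    -- the second zeta function at `v = 0`, the first zeta function and the zeta function over the
    -- trivial zeros at `x = 1/2`, and the residues
    ∃ (Z Zfirst Ztriv : ℂ → ℂ) (R : ℕ → ℂ),
      IsMeromorphicContinuation (secondZetaTerm τ 0) (1 / 2)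
        {σ : ℂ | ∃ m : ℕ, σ = 1 / 2 - m} Z ∧
      IsMeromorphicContinuation (zeroZetaTerm Ξ (1 / 2)) 1 {1} Zfirst ∧
      IsMeromorphicContinuation (zeroZetaTerm G (1 / 2)) 1 {1} Ztriv ∧
      -- the basic relation, away from the zeros of the cosine
      (∀ σ : ℂ, Complex.cos (Real.pi * σ) ≠ 0 →
        Z σ = (2 * Complex.cos (Real.pi * σ))⁻¹ * Zfirst (2 * σ)) ∧
      -- residue and finite part of the first zeta function at `s = 1`
      Tendsto (fun s => Zfirst s - (-a₁) / (s - 1)) (𝓝[≠] 1) (𝓝 (-b₁)) ∧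
      -- polar part at `1/2`
      ((fun ε : ℂ => Z (1 / 2 + ε) - (a₁ / (4 * Real.pi * ε ^ 2) + b₁ / (2 * Real.pi * ε)))
        =O[𝓝[≠] 0] fun _ => (1 : ℂ)) ∧
      (a₁ ≠ 0 → meromorphicOrderAt Z (1 / 2) = ((-2 : ℤ) : WithTop ℤ)) ∧
      -- polar parts at `1/2 - m`, `m ≥ 1`
      (∀ m : ℕ, 1 ≤ m →
        ((fun ε : ℂ => Z (1 / 2 - m + ε) - R m / ε) =O[𝓝[≠] 0] fun _ => (1 : ℂ)) ∧
        (R m ≠ 0 → meromorphicOrderAt Z (1 / 2 - m) = ((-1 : ℤ) : WithTop ℤ)) ∧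
        R m = (-1) ^ (m + 1) / (2 * Real.pi) * Zfirst (1 - 2 * m) ∧
        R m = (-1) ^ m / (2 * Real.pi) *
          (Ztriv (1 - 2 * m) + q * (2 : ℂ) ^ (1 - 2 * (m : ℤ)))) ∧
      -- special values
      (∀ m : ℤ, Z m = 1 / 2 * (-1) ^ m * Zfirst (2 * m)) ∧
      deriv Z 0 = deriv Zfirst 0 := by
  obtain ⟨Zfirst, Ztriv, h₁, h₂, hlim, hodd⟩ := hL.exists_continuations hG
  obtain ⟨Z, hZ, hrel⟩ := hL.exists_second_zeta hτ h₁
  have hpi : (Real.pi : ℂ) ≠ 0 := by exact_mod_cast Real.pi_ne_zero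
  have hana : ∀ s, s ≠ 1 → AnalyticAt ℂ Zfirst s := fun s hs => h₁.analyticAt s hs
  have hcosint : ∀ m : ℤ, Complex.cos (Real.pi * m) ≠ 0 := fun m => by
    rw [cos_pi_mul_int]
    exact zpow_ne_zero _ (by norm_num)
  obtain ⟨M, hMa, hM0, hM1, hMZ⟩ := exists_double_pole_numerator hana hlim hrel
  refine ⟨Z, Zfirst, Ztriv, fun m => (-1) ^ (m + 1) / (2 * Real.pi) * Zfirst (1 - 2 * m),
    hZ, h₁, h₂, hrel, hlim, ?_, fun ha => ?_, fun m hm => ⟨?_, fun hR => ?_, rfl, ?_⟩,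
    fun m => ?_, ?_⟩
  -- Divide M(ε) = a₁ + 2b₁ε + O(ε²) by 4πε².
  · have hb := (hMa.sub_linear_isBigO hM1).mono (nhdsWithin_le_nhds (s := {0}ᶜ))
    have hb2 := hb.mul (isBigO_refl (fun ε : ℂ => (4 * Real.pi * ε ^ 2)⁻¹) (𝓝[≠] 0))
    refine (hb2.congr' ?_ ?_).trans
      ((isBigO_refl (fun _ : ℂ => (1 : ℂ)) (𝓝[≠] 0)).const_mul_left (4 * Real.pi)⁻¹)
    · filter_upwards [hMZ, self_mem_nhdsWithin] with ε hε hε0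
      have hε1 : ε ≠ 0 := hε0
      rw [hε, hM0]
      field_simp
      ring
    · filter_upwards [self_mem_nhdsWithin] with ε hε0
      have hε1 : ε ≠ 0 := hε0
      field_simp
  · exact meromorphicOrderAt_of_eventually_eq_div (c := 4 * Real.pi)
      (mul_ne_zero (by norm_num) hpi) 2 (hZ.meromorphicOn _ trivial) hMa (hM0 ▸ ha) hMZ
  · obtain ⟨K, hKa, hK0, hKZ⟩ := exists_simple_pole_numerator hm hana hrel
    have hb := hKa.differentiableAt.isBigO_sub.mono (nhdsWithin_le_nhds (s := {0}ᶜ))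
    have hb2 := hb.mul (isBigO_refl (fun ε : ℂ => ε⁻¹) (𝓝[≠] 0))
    refine hb2.congr' ?_ ?_
    · filter_upwards [hKZ] with ε hε
      rw [hε, ← hK0]
      ring
    · filter_upwards [self_mem_nhdsWithin] with ε hε0
      have hε1 : ε ≠ 0 := hε0
      rw [sub_zero, mul_inv_cancel₀ hε1]
  · obtain ⟨K, hKa, hK0, hKZ⟩ := exists_simple_pole_numerator hm hana hrel
    refine meromorphicOrderAt_of_eventually_eq_div (c := 1) one_ne_zero 1
      (hZ.meromorphicOn _ trivial) hKa (hK0 ▸ hR) ?_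
    simpa using hKZ
  · have h := hodd m hm
    simp only [pow_succ]
    linear_combination -((-1) ^ m / (2 * Real.pi)) * h
  · rw [hrel _ (hcosint m), cos_pi_mul_int]
    have h : ((-1 : ℂ) ^ m)⁻¹ = (-1) ^ m := by
      rw [← inv_zpow]; norm_num
    rw [mul_inv, h]
    ring
  · have h0 : Complex.cos (Real.pi * 0) ≠ 0 := by simp
    have hc : ContinuousAt (fun w : ℂ => Complex.cos (Real.pi * w)) 0 := by fun_prop
    have he : Z =ᶠ[𝓝 0] fun σ => (2 * Complex.cos (Real.pi * σ))⁻¹ * Zfirst (2 * σ) := by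
      filter_upwards [hc.eventually_ne h0] with w hw using hrel w hw
    -- The cosine is stationary at 0, so only the derivative of Zfirst(2σ) counts, and its factor 2
    -- cancels the prefactor 1/2.
    have hd1 : HasDerivAt (fun w : ℂ => (2 * Complex.cos (Real.pi * w))⁻¹) 0 0 := by
      have h1 : HasDerivAt (fun w : ℂ => Complex.cos (Real.pi * w))
          (-Complex.sin (Real.pi * 0) * (Real.pi * 1)) 0 :=
        ((hasDerivAt_id (0 : ℂ)).const_mul (Real.pi : ℂ)).ccos
      refine ((h1.const_mul 2).fun_inv (mul_ne_zero two_ne_zero h0)).congr_deriv ?_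
      simp
    have hd2 : HasDerivAt (fun w : ℂ => Zfirst (2 * w)) (deriv Zfirst 0 * 2) 0 := by
      have h2 : HasDerivAt Zfirst (deriv Zfirst 0) (2 * 0) := by
        rw [mul_zero]
        exact (hana 0 (by norm_num)).differentiableAt.hasDerivAt
      exact (h2.comp (0 : ℂ) ((hasDerivAt_id (0 : ℂ)).const_mul 2)).congr_deriv (by ring)
    rw [he.deriv_eq, (hd1.fun_mul hd2).deriv]
    simp
    ring
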